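/- Conventions. A Hermitian threefold $(M^3,g)$ is a complex manifold of complex dimension $3$ with a Hermitian metric $g=\langle\,,\rangle$ (extended complex bilinearly), complex structure $J$ and Kähler form $\omega=\langle J\cdot,\cdot\rangle$. It is Kähler if $d\omega=0$ and balanced if $d(\omega^2)=0$. The Chern (respectively Bismut) connection is the unique connection with $\nabla g=0$, $\nabla J=0$ whose torsion has no $(1,1)$-part (respectively is totally skew-symmetric); $g$ is BTP if the Bismut connection $\nabla^b$ has parallel torsion, $\nabla^bT^b=0$. Let $e$ be a unitary frame of $T^{1,0}M$, i.e. $\langle e_i,\bar e_j\rangle=\delta_{ij}$, write the Chern torsion as $T(e_i,e_j)=2\sum_kT^k_{ij}e_k$, and put $B_{i\bar j}=\sum_{r,s}T^j_{rs}\overline{T^i_{rs}}$; a balanced BTP threefold is of middle type if $\operatorname{rank}B=2$ everywhere. $(M^3,g)$ is Lie-Hermitian if its universal cover, with the lifted structure, is a connected, simply connected Lie group with a left-invariant complex structure and a compatible left-invariant metric. Families. For a coframe $\varphi_1,\varphi_2,\varphi_3$ of $(1,0)$-forms write $\varphi_{ij}=\varphi_i\wedge\varphi_j$ and $\varphi_{i\bar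 j}=\varphi_i\wedge\overline{\varphi_j}$, and let $i=\sqrt{-1}$ outside of indices. Consider the structure equations * $A_{a,b}$ ($a,b\in\mathbb R$): $d\varphi_1=a\,\varphi_1\wedge(\varphi_3-\overline{\varphi_3})$, $\;d\varphi_2=b\,\varphi_2\wedge(\varphi_3-\overline{\varphi_3})$, $\;d\varphi_3=i\,(\varphi_{2\bar2}-\varphi_{1\bar1})$; * $B^{\varepsilon}_{u,v,w}$ ($\varepsilon=\pm1$, $u,v,w\in\mathbb C$, $w-\bar w=\varepsilon i(|u-v|^2-|u+v|^2)$): $d\varphi_1=\sqrt2\,v\,\varphi_{12}-\sqrt2\,\bar v\,\varphi_{1\bar2}+w\,\varphi_{13}-\bar w\,\varphi_{1\bar3}$, $\;d\varphi_2=-\sqrt2\,\bar u\,\varphi_{2\bar2}$, $\;d\varphi_3=\varepsilon i\,(\varphi_{2\bar2}-\varphi_{1\bar1})$; * $C_{u,v}$ ($u,v\in\mathbb C$): $d\varphi_1=u(\varphi_{1\bar1}+\varphi_{2\bar2})+v(\varphi_{2\bar1}-\varphi_{1\bar2})$, $\;d\varphi_2=-v(\varphi_{1\bar1}+\varphi_{2\bar2})+u(\varphi_{2\bar1}-\varphi_{1\bar2})$,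 $\;d\varphi_3=\varphi_{2\bar1}-\varphi_{1\bar2}$; * $D^{\varepsilon}_{u,\rho}$ ($\varepsilon=\pm1$, $u,\rho\in\mathbb C$, $|\rho|=1$): $d\varphi_1=\bar u(1+\rho\varepsilon i)\varphi_{12}+u\{-\bar\rho\,\varphi_{1\bar1}+\varepsilon i\,\varphi_{2\bar2}-\varphi_{2\bar1}+\bar\rho\,\varepsilon i\,\varphi_{1\bar2}\}$, $\;d\varphi_2=\bar u\,\varepsilon i(1+\rho\varepsilon i)\varphi_{12}+u\{\varphi_{1\bar1}+\bar\rho\,\varepsilon i\,\varphi_{2\bar2}-\bar\rho\,\varphi_{2\bar1}-\varepsilon i\,\varphi_{1\bar2}\}$, $\;d\varphi_3=\varphi_{2\bar1}-\varphi_{1\bar2}$. A six-dimensional real Lie group $G$ with an almost complex structure $J$ and a compatible Riemannian metric $g$ is called a member of one of these families if it has a left-invariant unitary coframe $\varphi$ (of type $(1,0)$ for $J$) that satisfies the corresponding structure equations for some admissible parameters. Theorem 1.11. (1) Let $(M^3,g)$ be a non-Kähler, balanced BTP Lie-Hermitian threefold of middle type. Then there is a constant $c>0$ such that the universal cover of $M$,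 with the metric $c\,g$ (lifted), is a member of one of the families $A_{a,b}$, $B^{\pm}_{u,v,w}$, $C_{u,v}$, $D^{\pm}_{u,\rho}$. (2) Conversely, on every member of these families the almost complex structure is integrable and the metric is balanced and BTP. Moreover, for all admissible values of the parameters the structure equations are consistent ($d^2=0$), i.e. they are the structure equations of a real six-dimensional Lie algebra. -/

import Mathlib

open scoped Manifold ContDiff ComplexConjugate Matrix
open VectorField

universe u v

/-- The model space of real six-dimensional manifolds, i.e. of complex threefolds. -/
abbrev E6 : Type := EuclideanSpace ℝ (Fin 6)

noncomputable section

/-! ### Almost Hermitian structures on real six-manifolds -/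

section Hermitian

variable {M : Type u} [TopologicalSpace M] [ChartedSpace E6 M]

/-- The exterior derivative of a form of degree `k + 1`, evaluated on vector fields by the
invariant formula
`dα(X₀,…,X_{k+1}) = ∑ⱼ (-1)ʲ Xⱼ(α(X₀,…,X̂ⱼ,…))
  + ∑_{i<j} (-1)^{i+j} α([Xᵢ,Xⱼ], X₀,…,X̂ᵢ,…,X̂ⱼ,…)`.
In the second sum the bracket is put into the slot of `Xᵢ`, which absorbs the sign `(-1)ⁱ`. -/
def extDerivFields {F : Type*} [NormedAddCommGroup F] [NormedSpace ℝ F] {k : ℕ}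
    (α : (x : M) → (Fin (k + 1) → TangentSpace (𝓡 6) x) → F)
    (X : Fin (k + 2) → (x : M) → TangentSpace (𝓡 6) x) (x : M) : F :=
  (∑ j : Fin (k + 2), (-1 : ℝ) ^ (j : ℕ) •
      mvfderiv (𝓡 6) (fun y => α y (fun l => X (j.succAbove l) y)) x (X j x)) +
    ∑ j : Fin (k + 2), ∑ i : Fin (k + 1), if (i : ℕ) < (j : ℕ) then
      (-1 : ℝ) ^ (j : ℕ) • α x (Function.update (fun l => X (j.succAbove l) x) i
        (mlieBracket (𝓡 6) (X (j.succAbove i)) (X j) x))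
    else 0

variable [IsManifold (𝓡 6) ∞ M]

/-- The vector field `X` is differentiable at the point `x`. -/
def DiffFieldAt (X : (y : M) → TangentSpace (𝓡 6) y) (x : M) : Prop :=
  MDifferentiableAt (𝓡 6) (𝓡 6).tangent (fun y => (⟨y, X y⟩ : TangentBundle (𝓡 6) M)) x

variable (M) in
/-- A smooth almost Hermitian structure: a smooth Riemannian metric `g = ⟨ , ⟩` together with a
smooth almost complex structure `J` that is orthogonal for the metric. -/
structure AlmostHermitian where
  metric : Bundle.ContMDiffRiemannianMetric (𝓡 6) ∞ E6 (fun x : M => TangentSpace (𝓡 6) x)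
  J : (x : M) → TangentSpace (𝓡 6) x →L[ℝ] TangentSpace (𝓡 6) x
  contMDiff_J : ContMDiff (𝓡 6) ((𝓡 6).prod 𝓘(ℝ, E6 →L[ℝ] E6)) ∞
    (fun x => Bundle.TotalSpace.mk' (E6 →L[ℝ] E6)
      (E := fun x : M => TangentSpace (𝓡 6) x →L[ℝ] TangentSpace (𝓡 6) x) x (J x))
  J_J : ∀ (x : M) (v : TangentSpace (𝓡 6) x), J x (J x v) = -v
  metric_J_J : ∀ (x : M) (v w : TangentSpace (𝓡 6) x),
    metric.inner x (J x v) (J x w) = metric.inner x v w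

namespace AlmostHermitian

variable (h : AlmostHermitian M)

/-- The almost complex structure is integrable: its Nijenhuis tensor vanishes. Then `(M, J, g)` is
a Hermitian threefold. -/
def IsIntegrable : Prop :=
  ∀ (x : M) (X Y : (y : M) → TangentSpace (𝓡 6) y), DiffFieldAt X x → DiffFieldAt Y x →
    mlieBracket (𝓡 6) (fun y => h.J y (X y)) (fun y => h.J y (Y y)) x
      - h.J x (mlieBracket (𝓡 6) (fun y => h.J y (X y)) Y x)
      - h.J x (mlieBracket (𝓡 6) X (fun y => h.J y (Y y)) x)
      - mlieBracket (𝓡 6) X Y x = 0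

/-- The fundamental (Kähler) form `ω(X, Y) = ⟨J X, Y⟩`. -/
def kahlerForm (x : M) (v : Fin 2 → TangentSpace (𝓡 6) x) : ℝ :=
  h.metric.inner x (h.J x (v 0)) (v 1)

/-- The four-form `ω ∧ ω`. -/
def kahlerFormSq (x : M) (v : Fin 4 → TangentSpace (𝓡 6) x) : ℝ :=
  2 * (h.kahlerForm x ![v 0, v 1] * h.kahlerForm x ![v 2, v 3]
    - h.kahlerForm x ![v 0, v 2] * h.kahlerForm x ![v 1, v 3]
    + h.kahlerForm x ![v 0, v 3] * h.kahlerForm x ![v 1, v 2])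

/-- The metric is Kähler: `dω = 0`. -/
def IsKahler : Prop :=
  ∀ (x : M) (X : Fin 3 → (y : M) → TangentSpace (𝓡 6) y), (∀ i, DiffFieldAt (X i) x) →
    extDerivFields h.kahlerForm X x = 0

/-- The metric is balanced: `d(ω ^ (n - 1)) = 0`, where `n = 3`. -/
def IsBalanced : Prop :=
  ∀ (x : M) (X : Fin 5 → (y : M) → TangentSpace (𝓡 6) y), (∀ i, DiffFieldAt (X i) x) →
    extDerivFields h.kahlerFormSq X x = 0

/-- A Hermitian connection: `∇g = 0` and `∇J = 0`. Here `cov Y x v` is `∇_v Y` at the point `x`. -/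
structure IsHermitianConnection
    (cov : CovariantDerivative (𝓡 6) E6 (TangentSpace (𝓡 6) : M → Type)) : Prop where
  metric : ∀ (x : M) (Y Z : (y : M) → TangentSpace (𝓡 6) y), DiffFieldAt Y x → DiffFieldAt Z x →
    ∀ v : TangentSpace (𝓡 6) x,
      mvfderiv (𝓡 6) (fun y => h.metric.inner y (Y y) (Z y)) x v =
        h.metric.inner x (cov Y x v) (Z x) + h.metric.inner x (Y x) (cov Z x v)
  complex : ∀ (x : M) (Y : (y : M) → TangentSpace (𝓡 6) y), DiffFieldAt Y x →
    ∀ v : TangentSpace (𝓡 6) x, cov (fun y => h.J y (Y y)) x v = h.J x (cov Y x v)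

/-- The Bismut connection `∇ᵇ`: the Hermitian connection whose torsion is totally skew-symmetric. -/
structure IsBismut
    (cov : CovariantDerivative (𝓡 6) E6 (TangentSpace (𝓡 6) : M → Type)) : Prop where
  hermitian : h.IsHermitianConnection cov
  torsion_skew : ∀ (x : M) (v w z : TangentSpace (𝓡 6) x),
    h.metric.inner x (cov.torsion x v w) z = -h.metric.inner x (cov.torsion x v z) w

/-- The Chern connection `∇ᶜ`: the Hermitian connection whose torsion has no `(1,1)`-part, i.e.
`T(X, Ȳ) = 0` for all `X`, `Y` of type `(1,0)`; in terms of real vectors, `T(Jv, Jw) = -T(v, w)`. -/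
structure IsChern
    (cov : CovariantDerivative (𝓡 6) E6 (TangentSpace (𝓡 6) : M → Type)) : Prop where
  hermitian : h.IsHermitianConnection cov
  torsion_J_J : ∀ (x : M) (v w : TangentSpace (𝓡 6) x),
    cov.torsion x (h.J x v) (h.J x w) = -cov.torsion x v w

/-- The metric is Bismut torsion parallel (BTP): `∇ᵇ Tᵇ = 0`. -/
def IsBTP : Prop :=
  ∃ cov : CovariantDerivative (𝓡 6) E6 (TangentSpace (𝓡 6) : M → Type), h.IsBismut cov ∧
    ∀ (x : M) (Y Z : (y : M) → TangentSpace (𝓡 6) y), DiffFieldAt Y x → DiffFieldAt Z x →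
      ∀ v : TangentSpace (𝓡 6) x,
        cov (fun y => cov.torsion y (Y y) (Z y)) x v
          - cov.torsion x (cov Y x v) (Z x) - cov.torsion x (Y x) (cov Z x v) = 0

/-- Real vectors `ε₁, ε₂, ε₃` at `x` such that `ε₁, Jε₁, ε₂, Jε₂, ε₃, Jε₃` is orthonormal.
Equivalently, the vectors `eᵢ = (εᵢ - √-1 Jεᵢ)/√2` form a unitary frame of `T^{1,0}`, that is,
`⟨eᵢ, ēⱼ⟩ = δᵢⱼ`. -/
def IsUnitaryFrame (x : M) (ε : Fin 3 → TangentSpace (𝓡 6) x) : Prop :=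
  ∀ i j, h.metric.inner x (ε i) (ε j) = (if i = j then 1 else 0) ∧
    h.metric.inner x (ε i) (h.J x (ε j)) = 0

/-- The components `T^k_{rs}` of a torsion tensor `T` with `T(eᵣ, eₛ) = 2 ∑ₖ T^k_{rs} eₖ`, where
`eᵢ = (εᵢ - √-1 Jεᵢ)/√2`. For the Chern torsion `T(eᵣ, eₛ) = T(εᵣ, εₛ) - √-1 J T(εᵣ, εₛ)`, so that
`2 T^k_{rs} = √2 (⟨T(εᵣ, εₛ), εₖ⟩ + √-1 ⟨T(εᵣ, εₛ), Jεₖ⟩)`. -/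
def torsionComponent (x : M)
    (T : TangentSpace (𝓡 6) x →L[ℝ] TangentSpace (𝓡 6) x →L[ℝ] TangentSpace (𝓡 6) x)
    (ε : Fin 3 → TangentSpace (𝓡 6) x) (k r s : Fin 3) : ℂ :=
  ((h.metric.inner x (T (ε r) (ε s)) (ε k) : ℂ)
    + Complex.I * (h.metric.inner x (T (ε r) (ε s)) (h.J x (ε k)) : ℂ)) / (√2 : ℝ)

/-- The matrix `B_{i j̄} = ∑_{r,s} T^j_{rs} conj(T^i_{rs})` of the `B` tensor under a unitary
frame. -/
def bMatrix (x : M)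
    (T : TangentSpace (𝓡 6) x →L[ℝ] TangentSpace (𝓡 6) x →L[ℝ] TangentSpace (𝓡 6) x)
    (ε : Fin 3 → TangentSpace (𝓡 6) x) : Matrix (Fin 3) (Fin 3) ℂ :=
  Matrix.of fun i j => ∑ r, ∑ s,
    h.torsionComponent x T ε j r s * conj (h.torsionComponent x T ε i r s)

/-- Middle type: the `B` tensor of the Chern torsion has rank two everywhere. -/
def IsMiddleType : Prop :=
  ∃ cov : CovariantDerivative (𝓡 6) E6 (TangentSpace (𝓡 6) : M → Type), h.IsChern cov ∧
    ∀ (x : M) (ε : Fin 3 → TangentSpace (𝓡 6) x), h.IsUnitaryFrame x ε →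
      (h.bMatrix x (cov.torsion x) ε).rank = 2

/-- The structure `(J, c g)` obtained by scaling the metric by a positive constant. -/
def scale (c : ℝ) (hc : 0 < c) : AlmostHermitian M where
  metric :=
    { inner := fun x => c • h.metric.inner x
      symm := fun x v w => by simp [h.metric.symm x v w]
      pos := fun x v hv => by simpa using mul_pos hc (h.metric.pos x v hv)
      isVonNBounded := fun x => by
        have hs : √c ≠ 0 := (Real.sqrt_pos.2 hc).ne'
        refine ((h.metric.isVonNBounded x).image
          ((√c)⁻¹ • ContinuousLinearMap.id ℝ (TangentSpace (𝓡 6) x))).subset ?_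
        intro v hv
        refine ⟨√c • v, ?_, by simp [smul_smul, hs]⟩
        have : √c * (√c * h.metric.inner x v v) = c * h.metric.inner x v v := by
          rw [← mul_assoc, Real.mul_self_sqrt hc.le]
        simpa [this] using hv
      contMDiff := h.metric.contMDiff.const_smul_section }
  J := h.J
  contMDiff_J := h.contMDiff_J
  J_J := h.J_J
  metric_J_J := fun x v w => by simp [h.metric_J_J x v w]

end AlmostHermitian

end Hermitian

/-! ### The structure equations

A system of structure equations `dφ = R` for a coframe `φ = (φ₁, φ₂, φ₃)` (indexed by `0, 1, 2`) is
encoded by the function `R` for which `dφₖ(X, Y) = R (φ(X)) (φ(Y)) k`. -/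

/-- Structure equations: `R z w k` is the value of `dφₖ` on vectors `X`, `Y` with `φ(X) = z`,
`φ(Y) = w`. -/
abbrev StructureEquations : Type := (Fin 3 → ℂ) → (Fin 3 → ℂ) → (Fin 3 → ℂ)

/-- The two-form `φᵢ ∧ φⱼ`. -/
def wedge (i j : Fin 3) (z w : Fin 3 → ℂ) : ℂ := z i * w j - w i * z j

/-- The two-form `φᵢ ∧ φ̄ⱼ`. -/
def wedgeBar (i j : Fin 3) (z w : Fin 3 → ℂ) : ℂ := z i * conj (w j) - w i * conj (z j)

/-- `A_{a,b}`:
`dφ₁ = a φ₁∧(φ₃ - φ̄₃)`, `dφ₂ = b φ₂∧(φ₃ - φ̄₃)`, `dφ₃ = √-1 (φ₂∧φ̄₂ - φ₁∧φ̄₁)`. -/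
def familyA (a b : ℝ) : StructureEquations := fun z w =>
  ![(a : ℂ) * (wedge 0 2 z w - wedgeBar 0 2 z w),
    (b : ℂ) * (wedge 1 2 z w - wedgeBar 1 2 z w),
    Complex.I * (wedgeBar 1 1 z w - wedgeBar 0 0 z w)]

/-- `B^ε_{p,q,r}`:
`dφ₁ = √2 q φ₁∧φ₂ - √2 q̄ φ₁∧φ̄₂ + r φ₁∧φ₃ - r̄ φ₁∧φ̄₃`, `dφ₂ = -√2 p̄ φ₂∧φ̄₂`,
`dφ₃ = ε √-1 (φ₂∧φ̄₂ - φ₁∧φ̄₁)`. -/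
def familyB (ε : ℝ) (p q r : ℂ) : StructureEquations := fun z w =>
  ![(√2 : ℝ) * q * wedge 0 1 z w - (√2 : ℝ) * conj q * wedgeBar 0 1 z w
      + r * wedge 0 2 z w - conj r * wedgeBar 0 2 z w,
    -((√2 : ℝ) * conj p * wedgeBar 1 1 z w),
    ε * Complex.I * (wedgeBar 1 1 z w - wedgeBar 0 0 z w)]

/-- `C_{p,q}`:
`dφ₁ = p (φ₁∧φ̄₁ + φ₂∧φ̄₂) + q (φ₂∧φ̄₁ - φ₁∧φ̄₂)`,
`dφ₂ = -q (φ₁∧φ̄₁ + φ₂∧φ̄₂) + p (φ₂∧φ̄₁ - φ₁∧φ̄₂)`, `dφ₃ = φ₂∧φ̄₁ - φ₁∧φ̄₂`. -/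
def familyC (p q : ℂ) : StructureEquations := fun z w =>
  ![p * (wedgeBar 0 0 z w + wedgeBar 1 1 z w) + q * (wedgeBar 1 0 z w - wedgeBar 0 1 z w),
    -q * (wedgeBar 0 0 z w + wedgeBar 1 1 z w) + p * (wedgeBar 1 0 z w - wedgeBar 0 1 z w),
    wedgeBar 1 0 z w - wedgeBar 0 1 z w]

/-- `D^ε_{p,ρ}`, where `i = √-1`:
`dφ₁ = p̄ (1 + ρεi) φ₁∧φ₂ + p {(-ρ̄ φ₁∧φ̄₁ + εi φ₂∧φ̄₂) + (-φ₂∧φ̄₁ + ρ̄εi φ₁∧φ̄₂)}`,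
`dφ₂ = p̄ εi (1 + ρεi) φ₁∧φ₂ + p {(φ₁∧φ̄₁ + ρ̄εi φ₂∧φ̄₂) + (-ρ̄ φ₂∧φ̄₁ - εi φ₁∧φ̄₂)}`,
`dφ₃ = φ₂∧φ̄₁ - φ₁∧φ̄₂`. -/
def familyD (ε : ℝ) (p ρ : ℂ) : StructureEquations := fun z w =>
  ![conj p * (1 + ρ * ε * Complex.I) * wedge 0 1 z w
      + p * ((-conj ρ * wedgeBar 0 0 z w + ε * Complex.I * wedgeBar 1 1 z w)
        + (-wedgeBar 1 0 z w + conj ρ * ε * Complex.I * wedgeBar 0 1 z w)),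
    conj p * ε * Complex.I * (1 + ρ * ε * Complex.I) * wedge 0 1 z w
      + p * ((wedgeBar 0 0 z w + conj ρ * ε * Complex.I * wedgeBar 1 1 z w)
        + (-conj ρ * wedgeBar 1 0 z w - ε * Complex.I * wedgeBar 0 1 z w)),
    wedgeBar 1 0 z w - wedgeBar 0 1 z w]

/-- `R` is one of the systems in the four families, with admissible parameters. -/
def IsFamilyMember (R : StructureEquations) : Prop :=
  (∃ a b : ℝ, R = familyA a b) ∨
  (∃ (ε : ℝ) (p q r : ℂ), (ε = 1 ∨ ε = -1) ∧
    r - conj r = ε * Complex.I * ((‖p - q‖ ^ 2 - ‖p + q‖ ^ 2 : ℝ) : ℂ) ∧ R = familyB ε p q r) ∨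
  (∃ p q : ℂ, R = familyC p q) ∨
  (∃ (ε : ℝ) (p ρ : ℂ), (ε = 1 ∨ ε = -1) ∧ ‖ρ‖ = 1 ∧ R = familyD ε p ρ)

/-- The system `dφ = R` satisfies `d² = 0`: the bracket on `ℂ³` given by
`φₖ([X, Y]) = -dφₖ(X, Y)` satisfies the Jacobi identity, so that it defines a real six-dimensional
Lie algebra. -/
def StructureEquations.IsConsistent (R : StructureEquations) : Prop :=
  ∀ x y z : Fin 3 → ℂ, R x (R y z) + R y (R z x) + R z (R x y) = 0

/-! ### Lie-Hermitian threefolds -/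

section LieHermitian

variable {G : Type v} [TopologicalSpace G] [ChartedSpace E6 G] [Group G]
  [LieGroup (𝓡 6) ∞ G]

/-- Both the almost complex structure and the metric are left-invariant. -/
structure AlmostHermitian.IsLeftInvariant (h : AlmostHermitian G) : Prop where
  metric : ∀ (a x : G) (v w : TangentSpace (𝓡 6) x),
    h.metric.inner (a * x) (mfderiv (𝓡 6) (𝓡 6) (a * ·) x v) (mfderiv (𝓡 6) (𝓡 6) (a * ·) x w) =
      h.metric.inner x v w
  complex : ∀ (a x : G) (v : TangentSpace (𝓡 6) x),
    h.J (a * x) (mfderiv (𝓡 6) (𝓡 6) (a * ·) x v) = mfderiv (𝓡 6) (𝓡 6) (a * ·) x (h.J x v)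

/-- `φ = (φ₁, φ₂, φ₃)` is a left-invariant unitary coframe: left-invariant complex one-forms of
type `(1,0)`, with `g = ∑ᵢ (φᵢ ⊗ φ̄ᵢ + φ̄ᵢ ⊗ φᵢ)`, so that `φ` is dual to a unitary frame `e` with
`⟨eᵢ, ēⱼ⟩ = δᵢⱼ`. -/
structure AlmostHermitian.IsLeftInvariantUnitaryCoframe (h : AlmostHermitian G)
    (φ : Fin 3 → (x : G) → TangentSpace (𝓡 6) x →L[ℝ] ℂ) : Prop where
  leftInvariant : ∀ (i : Fin 3) (a x : G) (v : TangentSpace (𝓡 6) x),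
    φ i (a * x) (mfderiv (𝓡 6) (𝓡 6) (a * ·) x v) = φ i x v
  type_one_zero : ∀ (i : Fin 3) (x : G) (v : TangentSpace (𝓡 6) x),
    φ i x (h.J x v) = Complex.I * φ i x v
  unitary : ∀ (x : G) (v w : TangentSpace (𝓡 6) x),
    (h.metric.inner x v w : ℂ) = ∑ i, (φ i x v * conj (φ i x w) + conj (φ i x v) * φ i x w)

/-- `dφ = R`. Both sides are left-invariant, and so are compared on left-invariant vector fields,
which span every tangent space. -/
def SatisfiesStructureEquations (φ : Fin 3 → (x : G) → TangentSpace (𝓡 6) x →L[ℝ] ℂ)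
    (R : StructureEquations) : Prop :=
  ∀ (v w : GroupLieAlgebra (𝓡 6) G) (x : G) (k : Fin 3),
    extDerivFields (fun y (u : Fin 1 → TangentSpace (𝓡 6) y) => φ k y (u 0))
        ![mulInvariantVectorField v, mulInvariantVectorField w] x =
      R (fun i => φ i x (mulInvariantVectorField v x))
        (fun i => φ i x (mulInvariantVectorField w x)) k

/-- The Lie group `G` with the almost Hermitian structure `h` is a member of one of the families
`A_{a,b}`, `B^±_{p,q,r}`, `C_{p,q}`, `D^±_{p,ρ}`. -/
def AlmostHermitian.IsMember (h : AlmostHermitian G) : Prop :=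
  ∃ (R : StructureEquations) (φ : Fin 3 → (x : G) → TangentSpace (𝓡 6) x →L[ℝ] ℂ),
    IsFamilyMember R ∧ h.IsLeftInvariantUnitaryCoframe φ ∧ SatisfiesStructureEquations φ R

/-- `π : G → M` presents `(M, hM)` as a Lie-Hermitian threefold: `π` is a smooth covering (the
universal one, when `G` is simply connected), it is a local holomorphic isometry, and the structure
`hG` on the Lie group `G` is left-invariant. -/
structure IsLieHermitianCover {M : Type u} [TopologicalSpace M] [ChartedSpace E6 M]
    [IsManifold (𝓡 6) ∞ M] (hM : AlmostHermitian M) (hG : AlmostHermitian G) (π : G → M) :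
    Prop where
  isCoveringMap : IsCoveringMap π
  surjective : Function.Surjective π
  isLocalDiffeomorph : IsLocalDiffeomorph (𝓡 6) (𝓡 6) ∞ π
  isometry : ∀ (x : G) (v w : TangentSpace (𝓡 6) x),
    hM.metric.inner (π x) (mfderiv (𝓡 6) (𝓡 6) π x v) (mfderiv (𝓡 6) (𝓡 6) π x w) =
      hG.metric.inner x v w
  holomorphic : ∀ (x : G) (v : TangentSpace (𝓡 6) x),
    hM.J (π x) (mfderiv (𝓡 6) (𝓡 6) π x v) = mfderiv (𝓡 6) (𝓡 6) π x (hG.J x v)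
  isLeftInvariant : hG.IsLeftInvariant

end LieHermitian

end

/-!
The argument takes place in a left-invariant unitary frame, which identifies the Lie algebra with
`ℂ³` with the metric `realDot`; brackets, connections and torsions become real-bilinear maps
`ℂ³ × ℂ³ → ℂ³`.

*Reduction to algebra.* A left-invariant frame on the covering group is transported to an open
subset of the quotient by a local section of the covering, so that the hypotheses on the quotient
become conditions on a frame with constant structure functions (`IsConstFrame.pullFrame`). A
connection enters the hypotheses only through its defining properties; because the Bismut connection
is unique (`IsBismutSymbol.unique`), its coefficients in the frame are constant
(`IsConstFrame.exists_isBismutSymbol`), and parallel torsion says that these coefficients act on the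
torsion as derivations. The Chern torsion is minus the complex-bilinear part `T` of the Bismut
torsion (`chernTorsion_eq_neg_holPart`), and the Bismut torsion is recovered from `T`
(`realDot_torsion_eq_cyclic`).

*Adapted frames.* As `B` is degenerate, the image of `T` is orthogonal to a unit vector `e₃`. As the
metric is balanced, `T` is trace-free (`holPart_trace`), and with an eigenvector `e₂` of `T(e₃, ·)`
the only components left are `T(e₃, e₁) = s e₁ + t e₂` and `T(e₃, e₂) = -s e₂`. Here `s ≠ 0`, since
otherwise `B` would have rank at most one (`exists_unitary_adapted`, `exists_isAdaptedTorsion`).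

*The normal form.* A skew-Hermitian derivation of such a `T` is diagonal and annihilates `e₃`
(`IsAdaptedTorsion.symbol_eq`), so the bracket is known up to two real covectors. The Jacobi
identity gives `t = 0`. After the metric has been scaled so that `|s| = 1`, and `e₃` rotated, the
structure equations are `dφ₁ = i α∧φ₁`, `dφ₂ = i β∧φ₂`, `dφ₃ = i (φ₂∧φ̄₂ - φ₁∧φ̄₁)` with real
covectors `α` and `β` (`IsAdaptedTorsion.exists_normalForm`). The remaining part of the Jacobi
identity leaves four cases (`isAdmissible_of_isConsistent`), each of which is one of the families up
to a unitary change of the coframe (`IsAdmissible.exists_isFamilyMember`).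

*The converse.* Every family is unitarily equivalent to a normal form
(`IsFamilyMember.exists_eq_conjBy_normalForm`), for which the Bismut connection is explicit and
diagonal (`normalFormSymbol`); that its torsion is parallel and that `dω ∧ ω = 0` are then
identities in `ℂ³`. The Jacobi identity holds because `dα` and `dβ` are multiples of `φ₁∧φ̄₁` and
`φ₂∧φ̄₂`, so that `dα ∧ φ₁ = dβ ∧ φ₂ = 0` (`IsAdmissible.isConsistent`).
-/

noncomputable section

/-! ### The model space and its metric -/

/-- The model `ℂ³` of the Lie algebra, in which a unitary coframe takes its values. -/
abbrev C3 : Type := Fin 3 → ℂ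

/-- Real-bilinear maps `ℂ³ × ℂ³ → ℂ³`: brackets, connection symbols and torsions in a frame. -/
abbrev RealBilin : Type := C3 →ₗ[ℝ] C3 →ₗ[ℝ] C3

/-- The metric of a unitary coframe: `⟨z, w⟩ = ∑ᵢ (zᵢ w̄ᵢ + z̄ᵢ wᵢ)`. -/
def realDot : C3 →ₗ[ℝ] C3 →ₗ[ℝ] ℝ :=
  LinearMap.mk₂ ℝ (fun z w => 2 * ∑ i, (z i * conj (w i)).re)
    (fun a b c => by simp [add_mul, Finset.sum_add_distrib, mul_add])
    (fun r a c => by simp only [Pi.smul_apply, Complex.real_smul, mul_assoc, Complex.re_ofReal_mul,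
      ← Finset.mul_sum, smul_eq_mul]; ring)
    (fun a b c => by
      simp only [Pi.add_apply, map_add, mul_add, Complex.add_re, Finset.sum_add_distrib])
    (fun r a c => by
      simp only [Pi.smul_apply, Complex.real_smul, map_mul, Complex.conj_ofReal,
        mul_left_comm _ (r : ℂ), Complex.re_ofReal_mul, ← Finset.mul_sum, smul_eq_mul]
      ring)

lemma realDot_apply (z w : C3) : realDot z w = 2 * ∑ i, (z i * conj (w i)).re := rfl

lemma realDot_comm (z w : C3) : realDot z w = realDot w z := by
  simp only [realDot_apply]
  congr 1
  refine Finset.sum_congr rfl fun i _ => ?_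
  simp; ring

lemma realDot_I_I (z w : C3) : realDot (Complex.I • z) (Complex.I • w) = realDot z w := by
  simp only [realDot_apply]
  congr 1
  refine Finset.sum_congr rfl fun i _ => ?_
  simp

lemma I_smul_I_smul (z : C3) : Complex.I • Complex.I • z = -z := by
  rw [smul_smul]; simp

lemma realDot_I_left (z w : C3) : realDot (Complex.I • z) w = -realDot z (Complex.I • w) := by
  have := realDot_I_I z (Complex.I • w)
  rw [I_smul_I_smul, map_neg] at this
  linarith

lemma realDot_self_pos {z : C3} (hz : z ≠ 0) : 0 < realDot z z := by
  obtain ⟨i, hi⟩ := Function.ne_iff.1 hz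
  rw [realDot_apply]
  have h : ∀ j, (z j * conj (z j)).re = Complex.normSq (z j) := fun j => by
    rw [Complex.mul_conj, Complex.ofReal_re]
  simp only [h]
  have := Finset.sum_pos' (s := Finset.univ) (f := fun j => Complex.normSq (z j))
    (fun j _ => Complex.normSq_nonneg _) ⟨i, Finset.mem_univ _, Complex.normSq_pos.2 hi⟩
  linarith

lemma realDot_ext {z w : C3} (h : ∀ v, realDot z v = realDot w v) : z = w := by
  by_contra hne
  have := realDot_self_pos (sub_ne_zero.2 hne)
  rw [LinearMap.map_sub₂, h, sub_self] at this
  exact lt_irrefl _ this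

/-- The component `zₖ` is recovered from the metric products with `eₖ` and `i eₖ`. -/
lemma realDot_single (z : C3) (k : Fin 3) (a : ℂ) :
    realDot z (Pi.single k a) = 2 * (z k * conj a).re := by
  rw [realDot_apply, Finset.sum_eq_single k]
  · simp
  · intro b _ hb
    simp [Pi.single_eq_of_ne hb]
  · simp

/-! ### Connections with constant coefficients in a unitary frame -/

/-- `Γ z w` are the coefficients of `∇_z w` for a connection with `∇g = 0` and `∇J = 0`. -/
structure IsHermitianSymbol (Γ : RealBilin) : Prop where
  complex : ∀ z w, Γ z (Complex.I • w) = Complex.I • Γ z w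
  metric : ∀ z w v, realDot (Γ z w) v + realDot w (Γ z v) = 0

/-- The torsion of the connection with coefficients `Γ`, in a frame with brackets
`[E_z, E_w] = -E_{R z w}`. -/
def symbolTorsion (R Γ : RealBilin) : RealBilin := Γ - Γ.flip + R

lemma symbolTorsion_apply (R Γ : RealBilin) (z w : C3) :
    symbolTorsion R Γ z w = Γ z w - Γ w z + R z w := rfl

/-- `Γ` are the coefficients of the Bismut connection. -/
structure IsBismutSymbol (R Γ : RealBilin) : Prop where
  hermitian : IsHermitianSymbol Γ
  skew : ∀ z w v, realDot (symbolTorsion R Γ z w) v = -realDot (symbolTorsion R Γ z v) w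

/-- The Bismut connection is unique. The difference `a` of two Bismut connections is a three-form
with `a(z, Jw, Jv) = a(z, w, v)`, hence zero. -/
theorem IsBismutSymbol.unique {R Γ Γ' : RealBilin} (h : IsBismutSymbol R Γ)
    (h' : IsBismutSymbol R Γ') : Γ = Γ' := by
  set a : C3 → C3 → C3 → ℝ := fun z w v => realDot (Γ z w - Γ' z w) v with ha
  have h23 : ∀ z w v, a z w v = -a z v w := fun z w v => by
    have e1 := h.hermitian.metric z w v
    have e2 := h'.hermitian.metric z w v
    simp only [ha, map_sub, LinearMap.sub_apply]
    rw [realDot_comm (Γ z v), realDot_comm (Γ' z v)]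
    linarith
  have hI : ∀ z w v, a z (Complex.I • w) (Complex.I • v) = a z w v := fun z w v => by
    simp only [ha]
    rw [h.hermitian.complex, h'.hermitian.complex, ← smul_sub, realDot_I_I]
  have hs : ∀ z w v, a z w v - a w z v = -(a z v w - a v z w) := fun z w v => by
    have e1 := h.skew z w v
    have e2 := h'.skew z w v
    simp only [symbolTorsion_apply, map_sub, map_add, LinearMap.sub_apply, LinearMap.add_apply]
      at e1 e2
    simp only [ha, map_sub, LinearMap.sub_apply]
    linarith
  have h13 : ∀ z w v, a z w v = -a v w z := fun z w v => by
    linarith [hs w z v, h23 w z v]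
  have h12 : ∀ z w v, a z w v = -a w z v := fun z w v => by
    linarith [h23 z w v, h13 z v w, h23 w v z]
  have hII : ∀ z w v, a (Complex.I • z) (Complex.I • w) v = a z w v := fun z w v => by
    linarith [h13 (Complex.I • z) (Complex.I • w) v, h23 v (Complex.I • w) (Complex.I • z),
      hI v z w, h12 v z w, h23 z v w]
  have hz : ∀ z w v, a z w v = 0 := fun z w v => by
    have e1 := hII z w v
    have e2 := hI (Complex.I • z) (Complex.I • w) v
    have e3 := hII z w (Complex.I • v)
    have e4 : a (Complex.I • z) w (Complex.I • v) = a z w v := by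
      have h1 := h12 (Complex.I • z) w (Complex.I • v)
      have h2 := hI w z v
      have h3 := h12 z w v
      linarith
    rw [I_smul_I_smul] at e2
    have e5 : a (Complex.I • z) (-w) (Complex.I • v) = -a (Complex.I • z) w (Complex.I • v) := by
      simp only [ha, map_neg, map_sub, LinearMap.sub_apply, LinearMap.neg_apply]; ring
    linarith
  refine LinearMap.ext fun z => LinearMap.ext fun w => ?_
  refine realDot_ext fun v => ?_
  have := hz z w v
  simp only [ha, map_sub, LinearMap.sub_apply] at this
  linarith

/-! ### The complex-bilinear part of the torsion -/

/-- The Nijenhuis tensor vanishes, in terms of the torsion `τ` of a Hermitian connection. -/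
def IsTypeIntegrable (τ : RealBilin) : Prop :=
  ∀ z w, τ (Complex.I • z) (Complex.I • w) - Complex.I • τ (Complex.I • z) w
    - Complex.I • τ z (Complex.I • w) - τ z w = 0

/-- The complex-bilinear part of a torsion tensor of type `(2,0) + (1,1)`. -/
def holPart (τ : RealBilin) (z w : C3) : C3 :=
  (2⁻¹ : ℝ) • (τ z w - τ (Complex.I • z) (Complex.I • w))

section holPart

variable {τ : RealBilin}

lemma holPart_add_left (x y z : C3) : holPart τ (x + y) z = holPart τ x z + holPart τ y z := by
  simp only [holPart, smul_add, map_add, LinearMap.add_apply]; module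

lemma holPart_add_right (x y z : C3) : holPart τ x (y + z) = holPart τ x y + holPart τ x z := by
  simp only [holPart, smul_add, map_add]; module

lemma holPart_real_smul_left (r : ℝ) (x y : C3) : holPart τ (r • x) y = r • holPart τ x y := by
  simp only [holPart, smul_comm Complex.I r, map_smul, LinearMap.smul_apply]; module

lemma holPart_swap (hτ : ∀ z w, τ z w = -τ w z) (x y : C3) : holPart τ x y = -holPart τ y x := by
  rw [holPart, holPart, hτ x y, hτ (Complex.I • x)]; module

lemma holPart_I_left (hN : IsTypeIntegrable τ) (x y : C3) :
    holPart τ (Complex.I • x) y = Complex.I • holPart τ x y := by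
  have h := hN (Complex.I • x) y
  simp only [I_smul_I_smul, map_neg, LinearMap.neg_apply] at h
  rw [holPart, holPart, I_smul_I_smul, map_neg, LinearMap.neg_apply, smul_comm Complex.I]
  congr 1
  rw [← sub_eq_zero, ← neg_eq_zero, ← h]
  simp only [smul_sub, smul_neg]
  abel

lemma holPart_smul_left (hN : IsTypeIntegrable τ) (c : ℂ) (x y : C3) :
    holPart τ (c • x) y = c • holPart τ x y := by
  have h : ∀ v : C3, c • v = c.re • v + c.im • Complex.I • v := fun v => by
    ext i
    simp only [Pi.smul_apply, Pi.add_apply, smul_eq_mul, Complex.real_smul]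
    rw [← mul_assoc, ← add_mul, Complex.re_add_im]
  rw [h, h (holPart τ x y), holPart_add_left, holPart_real_smul_left, holPart_real_smul_left,
    holPart_I_left hN]

lemma holPart_smul_right (hN : IsTypeIntegrable τ) (hτ : ∀ z w, τ z w = -τ w z) (c : ℂ)
    (x y : C3) : holPart τ x (c • y) = c • holPart τ x y := by
  rw [holPart_swap hτ, holPart_smul_left hN, ← smul_neg, ← holPart_swap hτ]

/-- A totally skew torsion tensor without `(0,3)`-part is the sum of the cyclic permutations of
its complex-bilinear part. -/
lemma realDot_torsion_eq_cyclic (hN : IsTypeIntegrable τ) (hτ : ∀ z w, τ z w = -τ w z)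
    (hs : ∀ z w v, realDot (τ z w) v = -realDot (τ z v) w) (z w v : C3) :
    realDot (τ z w) v = realDot (holPart τ z w) v + realDot (holPart τ w v) z
      + realDot (holPart τ v z) w := by
  have h := congrArg (fun u => realDot u v) (hN z w)
  simp only [map_sub, map_zero, LinearMap.sub_apply, LinearMap.zero_apply, realDot_I_left] at h
  have hs' : ∀ z w v, realDot (τ z w) v = realDot (τ w v) z := fun z w v => by
    rw [hτ z w, map_neg, LinearMap.neg_apply, hs w z v, neg_neg]
  simp only [holPart, map_sub, map_smul, LinearMap.sub_apply, LinearMap.smul_apply, smul_eq_mul]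
  have e1 := hs' z w v
  have e2 := hs' w v z
  have e3 := hs' (Complex.I • w) (Complex.I • v) z
  have e5 := hs' (Complex.I • v) z (Complex.I • w)
  have e4 := hs' (Complex.I • v) (Complex.I • z) w
  have e6 := hs' z (Complex.I • w) (Complex.I • v)
  have e7 := hs' (Complex.I • z) w (Complex.I • v)
  linarith

end holPart

/-- The torsion of the Chern connection is minus the complex-bilinear part of the torsion of the
Bismut connection. The difference of the two connections is recovered from the difference of the
torsions by a Koszul formula, and has to commute with `J`. -/
theorem chernTorsion_eq_neg_holPart {τ T D : RealBilin}
    (hD : IsHermitianSymbol D) (hDT : ∀ z w, D z w - D w z = T z w - τ z w)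
    (hN : IsTypeIntegrable τ) (hτ : ∀ z w, τ z w = -τ w z)
    (hT : ∀ z w, T (Complex.I • z) (Complex.I • w) = -T z w)
    (hs : ∀ z w v, realDot (τ z w) v = -realDot (τ z v) w) (z w : C3) :
    T z w = -holPart τ z w := by
  -- the torsion `T` is complex bilinear, because it has no `(0,2)`-part either
  have hNT : IsTypeIntegrable T := fun z w => by
    have e : ∀ z w, T z w = D z w - D w z + τ z w := fun z w => by rw [hDT]; abel
    rw [e z w, e (Complex.I • z) w, e z (Complex.I • w), e (Complex.I • z) (Complex.I • w),
      ← hN z w]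
    simp only [hD.complex, smul_add, smul_sub, I_smul_I_smul]
    abel
  have hTs : ∀ z w, T z w = -T w z := fun z w => by
    have e1 := hDT z w
    have e2 := hDT w z
    rw [hτ w z] at e2
    rw [← sub_eq_zero, sub_neg_eq_add]
    have : T z w + T w z = (T z w - τ z w) + (T w z - -τ z w) := by abel
    rw [this, ← e1, ← e2]; abel
  have hhol : ∀ z w, holPart T z w = T z w := fun z w => by
    rw [holPart, hT]; module
  have hTI : ∀ z w, T (Complex.I • z) w = Complex.I • T z w := fun z w => by
    rw [← hhol, holPart_I_left hNT, hhol]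
  have hTI' : ∀ z w, T z (Complex.I • w) = Complex.I • T z w := fun z w => by
    rw [hTs, hTI, ← smul_neg, ← hTs]
  have hf : ∀ z w v, realDot (D z w) v - realDot (D w z) v
      = realDot (T z w) v - realDot (τ z w) v := fun z w v => by
    rw [← LinearMap.map_sub₂, hDT, LinearMap.map_sub₂]
  have hskew : ∀ z w v, realDot (D z w) v = -realDot (D z v) w := fun z w v => by
    linarith [hD.metric z w v, realDot_comm w (D z v)]
  have hcyc : ∀ z w v, realDot (τ z w) v = realDot (τ w v) z := fun z w v => by
    rw [hτ z w, map_neg, LinearMap.neg_apply, hs w z v, neg_neg]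
  have koszul : ∀ z w v, 2 * realDot (D z w) v = realDot (T z w) v - realDot (T w v) z
      + realDot (T v z) w - realDot (τ z w) v := fun z w v => by
    linarith [hf z w v, hf w v z, hf v z w, hskew z w v, hskew w v z, hskew v z w,
      hcyc z w v, hcyc w v z]
  refine realDot_ext fun v => ?_
  have e1 := koszul v (Complex.I • z) (Complex.I • w)
  have e2 := koszul v z w
  simp only [hD.complex, hTI, hTI', realDot_I_I, I_smul_I_smul, map_neg, LinearMap.neg_apply] at e1
  simp only [holPart, map_neg, map_sub, map_smul, LinearMap.neg_apply, LinearMap.sub_apply,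
    LinearMap.smul_apply, smul_eq_mul]
  have e3 := hcyc v z w
  have e4 := hcyc v (Complex.I • z) (Complex.I • w)
  linarith

/-! ### The normal form of the structure equations -/

/-- The real covector `α = ∑ₖ (aₖ φₖ + āₖ φ̄ₖ)`. -/
def reCovector (a z : C3) : ℝ := 2 * ∑ k, (a k * z k).re

/-- The structure equations `dφ₁ = i α∧φ₁`, `dφ₂ = i β∧φ₂`, `dφ₃ = i (φ₂∧φ̄₂ - φ₁∧φ̄₁)`, where `α`
and `β` are the real covectors with coefficients `a` and `b`. -/
def normalForm (a b : C3) : StructureEquations := fun z w =>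
  ![Complex.I * (reCovector a z * w 0 - reCovector a w * z 0),
    Complex.I * (reCovector b z * w 1 - reCovector b w * z 1),
    Complex.I * (wedgeBar 1 1 z w - wedgeBar 0 0 z w)]

/-- The integrability conditions on the coefficients of the normal form. They say that `dα` is a
multiple of `φ₁∧φ̄₁` and `dβ` a multiple of `φ₂∧φ̄₂`. The four cases lead to the families `B⁺`,
`B⁻`, `A` and `C`; the families `D⁺` and `D⁻` fall into the second and the first case. -/
def IsAdmissible (a b : C3) : Prop :=
  (a 0 = 0 ∧ b 0 = 0 ∧ b 2 = 0 ∧ (a 2).re = (a 1 * conj (b 1)).re) ∨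
  (a 1 = 0 ∧ b 1 = 0 ∧ a 2 = 0 ∧ (b 2).re = -(a 0 * conj (b 0)).re) ∨
  (a 0 = 0 ∧ a 1 = 0 ∧ b 0 = 0 ∧ b 1 = 0 ∧ (a 2).re = 0 ∧ (b 2).re = 0) ∨
  (a 1 = 0 ∧ a 2 = 0 ∧ b 0 = 0 ∧ b 2 = 0)

/-- The structure equations in the frame obtained by applying `A`. -/
def StructureEquations.conjBy (A : C3 ≃ₗ[ℂ] C3) (R : StructureEquations) : StructureEquations :=
  fun z w => A.symm (R (A z) (A w))

/-- `A` preserves the metric. -/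
def IsUnitaryEquiv (A : C3 ≃ₗ[ℂ] C3) : Prop := ∀ z w, realDot (A z) (A w) = realDot z w

lemma StructureEquations.conjBy_conjBy (A B : C3 ≃ₗ[ℂ] C3) (R : StructureEquations) :
    (R.conjBy A).conjBy B = R.conjBy (B.trans A) := rfl

lemma StructureEquations.conjBy_symm (A : C3 ≃ₗ[ℂ] C3) (R : StructureEquations) :
    (R.conjBy A).conjBy A.symm = R := by
  funext z w
  simp [StructureEquations.conjBy]

lemma StructureEquations.IsConsistent.conjBy {R : StructureEquations} (h : R.IsConsistent)
    (A : C3 ≃ₗ[ℂ] C3) : (R.conjBy A).IsConsistent := fun x y z => by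
  have := h (A x) (A y) (A z)
  simp only [StructureEquations.conjBy, LinearEquiv.apply_symm_apply, ← map_add]
  exact (congrArg A.symm this).trans (map_zero _)

lemma IsUnitaryEquiv.symm {A : C3 ≃ₗ[ℂ] C3} (h : IsUnitaryEquiv A) : IsUnitaryEquiv A.symm :=
  fun z w => by simpa using (h (A.symm z) (A.symm w)).symm

/-- The Jacobi identity forces the coefficients of the normal form to be admissible. Its values on
the triples of basis vectors used below give `dα ∧ φ₁ = 0` and `dβ ∧ φ₂ = 0`. -/
theorem isAdmissible_of_isConsistent {a b : C3} (h : (normalForm a b).IsConsistent) :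
    IsAdmissible a b := by
  -- the values of the Jacobi identity on triples of basis vectors
  have J := fun (i j k : Fin 3) (p q r : ℂ) =>
    h (Pi.single i p) (Pi.single j q) (Pi.single k r)
  have J0 := fun i j k p q r => congrFun (J i j k p q r) 0
  have J1 := fun i j k p q r => congrFun (J i j k p q r) 1
  have x1 := J0 0 0 2 1 Complex.I 1
  have x2 := J0 0 0 2 1 Complex.I Complex.I
  have x3 := J0 0 0 1 1 Complex.I 1
  have x4 := J0 0 0 1 1 Complex.I Complex.I
  have x5 := J0 0 1 2 1 1 1
  have x6 := J0 0 1 2 1 1 Complex.I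
  have x7 := J0 0 1 2 1 Complex.I 1
  have x8 := J0 0 1 2 1 Complex.I Complex.I
  have x9 := J0 0 1 1 1 1 Complex.I
  have y1 := J1 1 1 2 1 Complex.I 1
  have y2 := J1 1 1 2 1 Complex.I Complex.I
  have y3 := J1 1 1 0 1 Complex.I 1
  have y4 := J1 1 1 0 1 Complex.I Complex.I
  have y5 := J1 1 0 2 1 1 1
  have y6 := J1 1 0 2 1 1 Complex.I
  have y7 := J1 1 0 2 1 Complex.I 1
  have y8 := J1 1 0 2 1 Complex.I Complex.I
  have y9 := J1 1 0 0 1 1 Complex.I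
  simp [normalForm, reCovector, wedgeBar, Fin.sum_univ_three, Complex.ext_iff]
    at x1 x2 x3 x4 x5 x6 x7 x8 x9 y1 y2 y3 y4 y5 y6 y7 y8 y9
  clear J J0 J1 h
  -- their linear combinations are the real and imaginary parts of products of coefficients
  have e1 : a 0 = 0 ∨ a 2 = 0 := by
    rw [← mul_eq_zero]
    apply Complex.ext <;> simp only [Complex.mul_re, Complex.mul_im, Complex.zero_re,
      Complex.zero_im]
    · linear_combination -x1.2 / 4 - x2.1 / 4
    · linear_combination -x1.1 / 4 + x2.2 / 4
  have e2 : b 1 = 0 ∨ b 2 = 0 := by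
    rw [← mul_eq_zero]
    apply Complex.ext <;> simp only [Complex.mul_re, Complex.mul_im, Complex.zero_re,
      Complex.zero_im]
    · linear_combination -y1.2 / 4 - y2.1 / 4
    · linear_combination -y1.1 / 4 + y2.2 / 4
  have e3 : a 1 = 0 ∨ b 2 = 0 := by
    clear * - x5 x6 x7 x8
    simp only [Complex.ext_iff, Complex.zero_re, Complex.zero_im]; tauto
  have e4 : b 0 = 0 ∨ a 2 = 0 := by
    clear * - y5 y6 y7 y8
    simp only [Complex.ext_iff, Complex.zero_re, Complex.zero_im]; tauto
  have e5 : a 1 = 0 ∨ (a 0 = 0 ∧ b 0 = 0) := by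
    refine or_iff_not_imp_left.2 fun h => ?_
    have hN : Complex.normSq (a 1) ≠ 0 := fun h' => h (Complex.normSq_eq_zero.1 h')
    rw [Complex.normSq_apply] at hN
    refine ⟨Complex.ext ?_ ?_, Complex.ext ?_ ?_⟩ <;> refine (mul_eq_zero.1 ?_).resolve_left hN
    · linear_combination -(a 1).re / 4 * x3.2 + (a 1).im / 4 * x4.2
    · linear_combination -(a 1).re / 4 * x3.1 + (a 1).im / 4 * x4.1
    · linear_combination (a 1).im / 4 * x3.1 + (a 1).re / 4 * x4.1
    · linear_combination -(a 1).im / 4 * x3.2 - (a 1).re / 4 * x4.2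
  have e5' : b 0 = 0 ∨ (b 1 = 0 ∧ a 1 = 0) := by
    refine or_iff_not_imp_left.2 fun h => ?_
    have hN : Complex.normSq (b 0) ≠ 0 := fun h' => h (Complex.normSq_eq_zero.1 h')
    rw [Complex.normSq_apply] at hN
    refine ⟨Complex.ext ?_ ?_, Complex.ext ?_ ?_⟩ <;> refine (mul_eq_zero.1 ?_).resolve_left hN
    · linear_combination -(b 0).re / 4 * y3.2 + (b 0).im / 4 * y4.2
    · linear_combination -(b 0).re / 4 * y3.1 + (b 0).im / 4 * y4.1
    · linear_combination (b 0).im / 4 * y3.1 + (b 0).re / 4 * y4.1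
    · linear_combination -(b 0).im / 4 * y3.2 - (b 0).re / 4 * y4.2
  have e6 : (a 2).re = (a 1 * conj (b 1)).re := by
    simp only [Complex.mul_re, Complex.conj_re, Complex.conj_im]
    linear_combination x9.2 / 2
  have e7 : (b 2).re = -(a 0 * conj (b 0)).re := by
    simp only [Complex.mul_re, Complex.conj_re, Complex.conj_im]
    linear_combination -y9.2 / 2
  clear x1 x2 x3 x4 x5 x6 x7 x8 x9 y1 y2 y3 y4 y5 y6 y7 y8 y9
  unfold IsAdmissible
  by_cases ha1 : a 1 = 0
  · by_cases hb0 : b 0 = 0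
    · have ha2 : (a 2).re = 0 := by rw [e6, ha1]; simp
      have hb2 : (b 2).re = 0 := by rw [e7, hb0]; simp
      rcases e1 with h0 | h0 <;> rcases e2 with h2 | h2 <;> simp_all
    · exact Or.inr (Or.inl ⟨ha1, (e5'.resolve_left hb0).1, e4.resolve_left hb0, e7⟩)
  · obtain ⟨h1, h2⟩ := e5.resolve_left ha1
    exact Or.inl ⟨h1, h2, e3.resolve_left ha1, e6⟩

/-! ### The families as normal forms -/

/-- For admissible coefficients `dα` is a multiple of `φ₁∧φ̄₁` and `dβ` a multiple of `φ₂∧φ̄₂`. -/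
lemma IsAdmissible.reCovector_normalForm {a b : C3} (h : IsAdmissible a b) :
    (∃ c : ℝ, ∀ y z, reCovector a (normalForm a b y z) = c * (y 0 * conj (z 0)).im) ∧
    (∃ c : ℝ, ∀ y z, reCovector b (normalForm a b y z) = c * (y 1 * conj (z 1)).im) := by
  rcases h with ⟨h1, h2, h3, h4⟩ | ⟨h1, h2, h3, h4⟩ | ⟨h1, h2, h3, h4, h5, h6⟩ | ⟨h1, h2, h3, h4⟩
  · refine ⟨⟨4 * (a 2).re, fun y z => ?_⟩, ⟨4 * Complex.normSq (b 1), fun y z => ?_⟩⟩ <;>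
    · simp [reCovector, normalForm, Fin.sum_univ_three, h1, h2, h3, wedgeBar, h4,
        Complex.normSq_apply]
      ring
  · refine ⟨⟨4 * Complex.normSq (a 0), fun y z => ?_⟩, ⟨-4 * (b 2).re, fun y z => ?_⟩⟩ <;>
    · simp [reCovector, normalForm, Fin.sum_univ_three, h1, h2, h3, wedgeBar, h4,
        Complex.normSq_apply]
      ring
  · refine ⟨⟨0, fun y z => ?_⟩, ⟨0, fun y z => ?_⟩⟩ <;>
    · simp [reCovector, normalForm, Fin.sum_univ_three, h1, h2, h3, wedgeBar, h4, h5, h6]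
      exact Or.inr (by ring)
  · refine ⟨⟨4 * Complex.normSq (a 0), fun y z => ?_⟩,
      ⟨4 * Complex.normSq (b 1), fun y z => ?_⟩⟩ <;>
    · simp [reCovector, normalForm, Fin.sum_univ_three, h1, h2, h3, wedgeBar, h4,
        Complex.normSq_apply]
      ring

/-- Admissible coefficients give a Lie algebra: the components of the Jacobi identity are `i` times
`dα ∧ φ₁`, `dβ ∧ φ₂` and `d(φ₂∧φ̄₂ - φ₁∧φ̄₁)`, all of which vanish. -/
theorem IsAdmissible.isConsistent {a b : C3} (h : IsAdmissible a b) :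
    (normalForm a b).IsConsistent := by
  obtain ⟨⟨c, hc⟩, ⟨d, hd⟩⟩ := h.reCovector_normalForm
  have key : ∀ x y z, normalForm a b x (normalForm a b y z) =
      ![Complex.I * (reCovector a x * (normalForm a b y z 0)
          - (c * (y 0 * conj (z 0)).im : ℝ) * x 0),
        Complex.I * (reCovector b x * (normalForm a b y z 1)
          - (d * (y 1 * conj (z 1)).im : ℝ) * x 1),
        Complex.I * (wedgeBar 1 1 x (normalForm a b y z) - wedgeBar 0 0 x (normalForm a b y z))] :=
    fun x y z => by rw [← hc, ← hd]; rfl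
  intro x y z
  rw [key x y z, key y z x, key z x y]
  generalize hax : reCovector a x = ax
  generalize hay : reCovector a y = ay
  generalize haz : reCovector a z = az
  generalize hbx : reCovector b x = bx
  generalize hby : reCovector b y = bY
  generalize hbz : reCovector b z = bz
  ext k
  fin_cases k <;> apply Complex.ext <;>
    simp [normalForm, hax, hay, haz, hbx, hby, hbz, wedgeBar] <;> ring

lemma familyA_eq_normalForm (p q : ℝ) :
    familyA p q = normalForm ![0, 0, Complex.I * p] ![0, 0, Complex.I * q] := by
  funext z w k
  fin_cases k <;> apply Complex.ext <;>
    (simp [familyA, normalForm, reCovector, Fin.sum_univ_three, wedge, wedgeBar]; try ring)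

lemma familyB_one_eq_normalForm (p q r : ℂ) :
    familyB 1 p q r = normalForm ![0, Complex.I * (√2 : ℝ) * q, Complex.I * r]
      ![0, Complex.I * (√2 : ℝ) * p, 0] := by
  funext z w k
  fin_cases k <;> apply Complex.ext <;>
    simp [familyB, normalForm, reCovector, Fin.sum_univ_three, wedge, wedgeBar] <;> ring

/-- The exchange of `φ₁` and `φ₂`. -/
def swapEquiv : C3 ≃ₗ[ℂ] C3 := LinearEquiv.funCongrLeft ℂ ℂ (Equiv.swap (0 : Fin 3) 1)

lemma swapEquiv_apply (z : C3) : swapEquiv z = ![z 1, z 0, z 2] := by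
  funext k
  fin_cases k <;> rfl

lemma swapEquiv_symm_apply (z : C3) : swapEquiv.symm z = ![z 1, z 0, z 2] := by
  rw [LinearEquiv.symm_apply_eq, swapEquiv_apply]
  funext k
  fin_cases k <;> rfl

lemma isUnitaryEquiv_swapEquiv : IsUnitaryEquiv swapEquiv := fun z w => by
  simp [swapEquiv_apply, realDot_apply, Fin.sum_univ_three]; ring

lemma familyB_neg_one_eq_conjBy_normalForm (p q r : ℂ) :
    familyB (-1) p q r = (normalForm ![Complex.I * (√2 : ℝ) * p, 0, 0]
      ![Complex.I * (√2 : ℝ) * q, 0, Complex.I * r]).conjBy swapEquiv := by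
  funext z w k
  simp only [StructureEquations.conjBy, swapEquiv_apply, swapEquiv_symm_apply]
  fin_cases k <;> apply Complex.ext <;>
    simp [familyB, normalForm, reCovector, Fin.sum_univ_three, wedge, wedgeBar] <;> ring

lemma sqrt_two_mul_sqrt_two : (√2 : ℝ) * √2 = 2 := Real.mul_self_sqrt (by norm_num)

lemma ofReal_sqrt_two_mul_self : ((√2 : ℝ) : ℂ) * ((√2 : ℝ) : ℂ) = 2 := by
  rw [← Complex.ofReal_mul, sqrt_two_mul_sqrt_two]; norm_num

lemma ofReal_sqrt_two_sq : ((√2 : ℝ) : ℂ) ^ 2 = 2 := by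
  rw [sq, ofReal_sqrt_two_mul_self]

/-- The rotation `(φ₁, φ₂, φ₃) ↦ ((φ₁ + i φ₂)/√2, (φ₁ - i φ₂)/√2, φ₃)`. -/
def rotEquiv : C3 ≃ₗ[ℂ] C3 where
  toFun z := ![(z 0 + Complex.I * z 1) / (√2 : ℝ), (z 0 - Complex.I * z 1) / (√2 : ℝ), z 2]
  invFun z := ![(z 0 + z 1) / (√2 : ℝ), -Complex.I * (z 0 - z 1) / (√2 : ℝ), z 2]
  map_add' z w := by
    funext k; fin_cases k <;> simp <;> ring
  map_smul' c z := by
    funext k; fin_cases k <;> simp <;> ring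
  left_inv z := by
    have h : ((√2 : ℝ) : ℂ) ≠ 0 := by simp
    funext k; fin_cases k <;> simp [field, ofReal_sqrt_two_sq] <;> norm_num
  right_inv z := by
    have h : ((√2 : ℝ) : ℂ) ≠ 0 := by simp
    funext k; fin_cases k <;> simp [field, ofReal_sqrt_two_sq, Complex.I_sq] <;> norm_num

lemma rotEquiv_apply (z : C3) : rotEquiv z =
    ![(z 0 + Complex.I * z 1) / (√2 : ℝ), (z 0 - Complex.I * z 1) / (√2 : ℝ), z 2] := rfl

lemma isUnitaryEquiv_rotEquiv : IsUnitaryEquiv rotEquiv := fun z w => by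
  have h : (√2 : ℝ) ≠ 0 := by simp
  simp [rotEquiv_apply, realDot_apply, Fin.sum_univ_three, Complex.div_ofReal_re,
    Complex.div_ofReal_im]
  field_simp
  rw [Real.sq_sqrt (by norm_num)]
  ring

lemma StructureEquations.eq_conjBy {A : C3 ≃ₗ[ℂ] C3} {R S : StructureEquations}
    (h : ∀ z w, A (R z w) = S (A z) (A w)) : R = S.conjBy A := by
  funext z w
  rw [StructureEquations.conjBy, ← h, LinearEquiv.symm_apply_apply]

lemma familyC_eq_conjBy_normalForm (p q : ℂ) :
    familyC p q = (normalForm ![(√2 : ℝ) * (conj q - Complex.I * conj p), 0, 0]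
      ![0, -(√2 : ℝ) * (conj q + Complex.I * conj p), 0]).conjBy rotEquiv := by
  refine StructureEquations.eq_conjBy fun z w => ?_
  have h : (√2 : ℝ) ≠ 0 := by simp
  have h2 : (√2 : ℝ) ^ 2 = 2 := Real.sq_sqrt (by norm_num)
  funext k
  fin_cases k <;> apply Complex.ext <;>
    simp [rotEquiv_apply, familyC, normalForm, reCovector, Fin.sum_univ_three, wedgeBar,
      Complex.div_ofReal_re, Complex.div_ofReal_im] <;> field_simp <;> (try rw [h2]) <;> ring

lemma familyD_one_eq_conjBy_normalForm (p ρ : ℂ) :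
    familyD 1 p ρ = (normalForm ![(√2 : ℝ) * conj p * (-1 + Complex.I * ρ), 0, 0]
      ![(√2 : ℝ) * conj p * (1 + Complex.I * ρ), 0, 0]).conjBy rotEquiv := by
  refine StructureEquations.eq_conjBy fun z w => ?_
  have h : (√2 : ℝ) ≠ 0 := by simp
  have h2 : (√2 : ℝ) ^ 2 = 2 := Real.sq_sqrt (by norm_num)
  funext k
  fin_cases k <;> apply Complex.ext <;>
    simp [rotEquiv_apply, familyD, normalForm, reCovector, Fin.sum_univ_three, wedge, wedgeBar,
      Complex.div_ofReal_re, Complex.div_ofReal_im] <;> field_simp <;> (try rw [h2]) <;> ring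

lemma familyD_neg_one_eq_conjBy_normalForm (p ρ : ℂ) :
    familyD (-1) p ρ = (normalForm ![0, -(√2 : ℝ) * conj p * (1 - Complex.I * ρ), 0]
      ![0, (√2 : ℝ) * conj p * (1 + Complex.I * ρ), 0]).conjBy rotEquiv := by
  refine StructureEquations.eq_conjBy fun z w => ?_
  have h : (√2 : ℝ) ≠ 0 := by simp
  have h2 : (√2 : ℝ) ^ 2 = 2 := Real.sq_sqrt (by norm_num)
  funext k
  fin_cases k <;> apply Complex.ext <;>
    simp [rotEquiv_apply, familyD, normalForm, reCovector, Fin.sum_univ_three, wedge, wedgeBar,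
      Complex.div_ofReal_re, Complex.div_ofReal_im] <;> field_simp <;> (try rw [h2]) <;> ring

lemma isUnitaryEquiv_refl : IsUnitaryEquiv (LinearEquiv.refl ℂ C3) := fun _ _ => rfl

lemma StructureEquations.conjBy_refl (R : StructureEquations) :
    R.conjBy (LinearEquiv.refl ℂ C3) = R := rfl

/-- After a unitary change of the coframe, every family is a normal form with admissible
coefficients. -/
theorem IsFamilyMember.exists_eq_conjBy_normalForm {R : StructureEquations}
    (h : IsFamilyMember R) : ∃ (A : C3 ≃ₗ[ℂ] C3) (a b : C3), IsUnitaryEquiv A ∧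
      IsAdmissible a b ∧ R = (normalForm a b).conjBy A := by
  have h2 := sqrt_two_mul_sqrt_two
  have hsq : ∀ z w : ℂ, ‖z - w‖ ^ 2 - ‖z + w‖ ^ 2 = -4 * (z * conj w).re := fun z w => by
    rw [← Complex.normSq_eq_norm_sq, ← Complex.normSq_eq_norm_sq, Complex.normSq_apply,
      Complex.normSq_apply]
    simp; ring
  rcases h with ⟨a, b, rfl⟩ | ⟨ε, p, q, r, hε, hr, rfl⟩ | ⟨p, q, rfl⟩ | ⟨ε, p, ρ, hε, hρ, rfl⟩
  · refine ⟨_, _, _, isUnitaryEquiv_refl, Or.inr (Or.inr (Or.inl ?_)),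
      (familyA_eq_normalForm a b)⟩
    simp
  · rw [hsq] at hr
    have hr' := congrArg Complex.im hr
    rcases hε with rfl | rfl
    · refine ⟨_, _, _, isUnitaryEquiv_refl, Or.inl ?_, familyB_one_eq_normalForm p q r⟩
      simp at hr' ⊢
      linear_combination (-1 / 2 : ℝ) * hr' - (q.re * p.re + q.im * p.im) * h2
    · refine ⟨_, _, _, isUnitaryEquiv_swapEquiv, Or.inr (Or.inl ?_),
        familyB_neg_one_eq_conjBy_normalForm p q r⟩
      simp at hr' ⊢
      linear_combination (-1 / 2 : ℝ) * hr' + (q.re * p.re + q.im * p.im) * h2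
  · refine ⟨_, _, _, isUnitaryEquiv_rotEquiv, Or.inr (Or.inr (Or.inr ?_)),
      familyC_eq_conjBy_normalForm p q⟩
    simp
  · have hρ' : ρ.re * ρ.re + ρ.im * ρ.im = 1 := by
      rw [← Complex.normSq_apply, Complex.normSq_eq_norm_sq, hρ, one_pow]
    rcases hε with rfl | rfl
    · refine ⟨_, _, _, isUnitaryEquiv_rotEquiv, Or.inr (Or.inl ?_),
        familyD_one_eq_conjBy_normalForm p ρ⟩
      simp
      linear_combination (√2 * √2 * (p.re * p.re + p.im * p.im)) * hρ'
    · refine ⟨_, _, _, isUnitaryEquiv_rotEquiv, Or.inl ?_,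
        familyD_neg_one_eq_conjBy_normalForm p ρ⟩
      simp
      linear_combination (-√2 * √2 * (p.re * p.re + p.im * p.im)) * hρ'

theorem IsFamilyMember.isConsistent {R : StructureEquations} (h : IsFamilyMember R) :
    R.IsConsistent := by
  obtain ⟨A, a, b, -, hab, rfl⟩ := h.exists_eq_conjBy_normalForm
  exact hab.isConsistent.conjBy A

/-- A normal form with admissible coefficients belongs, after a unitary change of the coframe, to
one of the families `A`, `B` and `C`. -/
theorem IsAdmissible.exists_isFamilyMember {a b : C3} (h : IsAdmissible a b) :
    ∃ A : C3 ≃ₗ[ℂ] C3, IsUnitaryEquiv A ∧ IsFamilyMember ((normalForm a b).conjBy A) := by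
  have hs : ((√2 : ℝ) : ℂ) ≠ 0 := by simp
  have h2 := sqrt_two_mul_sqrt_two
  have hsq : ∀ z w : ℂ, ‖z - w‖ ^ 2 - ‖z + w‖ ^ 2 = -4 * (z * conj w).re := fun z w => by
    rw [← Complex.normSq_eq_norm_sq, ← Complex.normSq_eq_norm_sq, Complex.normSq_apply,
      Complex.normSq_apply]
    simp; ring
  have hc : conj (2 : ℂ) = 2 := Complex.conj_ofNat 2
  have hI : ∀ z : ℂ, Complex.I * (√2 : ℝ) * (-Complex.I * z / (√2 : ℝ)) = z := fun z => by
    field_simp; rw [Complex.I_sq]; ring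
  have hI' : ∀ z : ℂ, Complex.I * (-Complex.I * z) = z := fun z => by
    rw [← mul_assoc, mul_neg, Complex.I_mul_I]; ring
  -- the parameters of the family `B` are read off from its normal form
  have hB : ∀ x y : ℂ, ‖-Complex.I * y / (√2 : ℝ) - -Complex.I * x / (√2 : ℝ)‖ ^ 2
      - ‖-Complex.I * y / (√2 : ℝ) + -Complex.I * x / (√2 : ℝ)‖ ^ 2 = -2 * (x * conj y).re := by
    intro x y
    rw [hsq]
    simp [Complex.div_ofReal_re, Complex.div_ofReal_im]
    field_simp
    rw [sq, h2]
    ring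
  rcases h with ⟨h1, h2, h3, h4⟩ | ⟨h1, h2, h3, h4⟩ | ⟨h1, h2, h3, h4, h5, h6⟩ | ⟨h1, h2, h3, h4⟩
  · refine ⟨_, isUnitaryEquiv_refl, Or.inr (Or.inl ⟨1, -Complex.I * b 1 / (√2 : ℝ),
      -Complex.I * a 1 / (√2 : ℝ), -Complex.I * a 2, Or.inl rfl, ?_, ?_⟩)⟩
    · rw [hB, ← h4]
      apply Complex.ext <;> simp <;> ring
    · rw [familyB_one_eq_normalForm, hI, hI, hI', StructureEquations.conjBy_refl]
      congr 1 <;> funext k <;> fin_cases k <;> simp [h1, h2, h3]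
  · refine ⟨_, isUnitaryEquiv_swapEquiv, Or.inr (Or.inl ⟨-1, -Complex.I * a 0 / (√2 : ℝ),
      -Complex.I * b 0 / (√2 : ℝ), -Complex.I * b 2, Or.inr rfl, ?_, ?_⟩)⟩
    · rw [hB]
      have h5 : (b 0 * conj (a 0)).re = -(b 2).re := by rw [h4]; simp; ring
      rw [h5]
      apply Complex.ext <;> simp <;> ring
    · rw [familyB_neg_one_eq_conjBy_normalForm, hI, hI, hI']
      congr 2 <;> funext k <;> fin_cases k <;> simp [h1, h2, h3]
  · refine ⟨_, isUnitaryEquiv_refl, Or.inl ⟨(a 2).im, (b 2).im, ?_⟩⟩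
    rw [familyA_eq_normalForm, StructureEquations.conjBy_refl]
    congr 1 <;> funext k <;> fin_cases k <;> simp [h1, h2, h3, h4, Complex.ext_iff, h5, h6]
  · refine ⟨_, isUnitaryEquiv_rotEquiv, Or.inr (Or.inr (Or.inl
      ⟨-Complex.I * conj (a 0 + b 1) / (2 * (√2 : ℝ)), conj (a 0 - b 1) / (2 * (√2 : ℝ)), ?_⟩))⟩
    rw [familyC_eq_conjBy_normalForm]
    congr 2 <;> funext k <;> fin_cases k <;> simp [h1, h2, h3, h4, hc] <;> field_simp <;>
      rw [Complex.I_sq] <;> ring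

/-! ### The classification in an adapted frame -/

/-- An adapted frame: the complex-bilinear part `T` of the torsion has `T(e₁,e₂) = 0`,
`T(e₃,e₁) = s e₁ + t e₂` and `T(e₃,e₂) = -s e₂`. -/
structure IsAdaptedTorsion (τ : RealBilin) (s t : ℂ) : Prop where
  zero_one : holPart τ (Pi.single 0 1) (Pi.single 1 1) = 0
  two_zero : holPart τ (Pi.single 2 1) (Pi.single 0 1) = ![s, t, 0]
  two_one : holPart τ (Pi.single 2 1) (Pi.single 1 1) = ![0, -s, 0]

lemma eq_sum_single (z : C3) : z = z 0 • (Pi.single 0 1 : C3) + z 1 • (Pi.single 1 1 : C3)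
    + z 2 • (Pi.single 2 1 : C3) := by
  funext k
  fin_cases k <;> simp

section adapted

variable {R Γ τ : RealBilin} {s t : ℂ}

lemma IsAdaptedTorsion.holPart_eq (h : IsAdaptedTorsion τ s t) (hN : IsTypeIntegrable τ)
    (hτ : ∀ z w, τ z w = -τ w z) (z w : C3) :
    holPart τ z w = ![s * (z 2 * w 0 - w 2 * z 0),
      t * (z 2 * w 0 - w 2 * z 0) - s * (z 2 * w 1 - w 2 * z 1), 0] := by
  have h00 : ∀ x, holPart τ x x = 0 := fun x => by
    have := holPart_swap hτ x x
    exact self_eq_neg.1 this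
  conv_lhs => rw [eq_sum_single z, eq_sum_single w]
  simp only [holPart_add_left, holPart_add_right, holPart_smul_left hN, holPart_smul_right hN hτ,
    h00, holPart_swap hτ (Pi.single 1 1) (Pi.single 0 1),
    holPart_swap hτ (Pi.single 0 1) (Pi.single 2 1),
    holPart_swap hτ (Pi.single 1 1) (Pi.single 2 1), h.zero_one, h.two_zero, h.two_one]
  funext k
  fin_cases k <;> simp <;> ring

lemma IsAdaptedTorsion.torsion_eq (h : IsAdaptedTorsion τ s t) (hN : IsTypeIntegrable τ)
    (hτ : ∀ z w, τ z w = -τ w z) (hs : ∀ z w v, realDot (τ z w) v = -realDot (τ z v) w)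
    (z w : C3) :
    τ z w = ![s * (z 2 * w 0 - w 2 * z 0) + conj s * wedgeBar 0 2 z w + conj t * wedgeBar 1 2 z w,
      t * (z 2 * w 0 - w 2 * z 0) - s * (z 2 * w 1 - w 2 * z 1) - conj s * wedgeBar 1 2 z w,
      conj s * (wedgeBar 1 1 z w - wedgeBar 0 0 z w) - conj t * wedgeBar 1 0 z w] := by
  refine realDot_ext fun v => ?_
  rw [realDot_torsion_eq_cyclic hN hτ hs]
  simp only [h.holPart_eq hN hτ]
  simp [realDot_apply, Fin.sum_univ_three, wedgeBar]
  ring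

/-- A skew-Hermitian endomorphism that is a derivation of the torsion is diagonal, with vanishing
last entry. -/
lemma IsAdaptedTorsion.symbol_eq (h : IsAdaptedTorsion τ s t) (hs0 : s ≠ 0)
    (hN : IsTypeIntegrable τ) (hτ : ∀ z w, τ z w = -τ w z) (hΓ : IsHermitianSymbol Γ)
    (hpar : ∀ v z w, Γ v (τ z w) = τ (Γ v z) w + τ z (Γ v w)) (v z : C3) :
    Γ v z = ![Γ v (Pi.single 0 1) 0 * z 0, Γ v (Pi.single 1 1) 1 * z 1, 0] ∧
      (Γ v (Pi.single 0 1) 0).re = 0 ∧ (Γ v (Pi.single 1 1) 1).re = 0 := by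
  have hsmul : ∀ (c : ℂ) x, Γ v (c • x) = c • Γ v x := fun c x => by
    have h : ∀ v : C3, c • v = c.re • v + c.im • Complex.I • v := fun v => by
      ext i
      simp only [Pi.smul_apply, Pi.add_apply, smul_eq_mul, Complex.real_smul]
      rw [← mul_assoc, ← add_mul, Complex.re_add_im]
    rw [h, h, map_add, map_smul, map_smul, hΓ.complex]
  have hder : ∀ z w, Γ v (holPart τ z w) = holPart τ (Γ v z) w + holPart τ z (Γ v w) := by
    intro z w
    simp only [holPart, map_smul, map_sub, hpar, hΓ.complex]
    module
  have hskew : ∀ i j, Γ v (Pi.single i 1) j = -conj (Γ v (Pi.single j 1) i) := fun i j => by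
    have e1 := hΓ.metric v (Pi.single i 1) (Pi.single j 1)
    have e2 := hΓ.metric v (Pi.single i 1) (Complex.I • Pi.single j 1)
    rw [realDot_comm (Pi.single i 1), realDot_single, realDot_single] at e1
    rw [hΓ.complex, realDot_comm (Pi.single i 1), ← Pi.single_smul', realDot_single,
      realDot_single] at e2
    simp at e1 e2
    apply Complex.ext <;> simp <;> linarith
  -- compare coefficients in the derivation property for `T(e₃, e₂)` and `T(e₃, e₁)`; the other
  -- entries follow by skew-Hermitian symmetry
  have d1 := fun k => congrFun (hder (Pi.single 2 1) (Pi.single 1 1)) k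
  have d0 := fun k => congrFun (hder (Pi.single 2 1) (Pi.single 0 1)) k
  have v0 : ![s, t, 0] = s • (Pi.single 0 1 : C3) + t • (Pi.single 1 1 : C3) := by
    funext k; fin_cases k <;> simp
  have v1 : ![0, -s, 0] = (-s) • (Pi.single 1 1 : C3) := by
    funext k; fin_cases k <;> simp
  rw [h.two_one, v1, hsmul] at d1
  rw [h.two_zero, v0, map_add, hsmul, hsmul] at d0
  simp only [h.holPart_eq hN hτ] at d0 d1
  have d10 := d1 0
  have d11 := d1 1
  have d12 := d1 2
  have d02 := d0 2
  simp at d10 d11 d12 d02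
  have a21 := d12.resolve_left hs0
  have a20 : Γ v (Pi.single 0 1) 2 = 0 := by
    rw [a21, mul_zero, add_zero] at d02
    exact (mul_eq_zero.1 d02).resolve_left hs0
  have a01 : Γ v (Pi.single 1 1) 0 = 0 := by
    have : s * Γ v (Pi.single 1 1) 0 = 0 := by linear_combination -d10 / 2
    exact (mul_eq_zero.1 this).resolve_left hs0
  have a22 : Γ v (Pi.single 2 1) 2 = 0 := by
    have : s * Γ v (Pi.single 2 1) 2 = 0 := by linear_combination d11 + t * a01
    exact (mul_eq_zero.1 this).resolve_left hs0
  have a10 : Γ v (Pi.single 0 1) 1 = 0 := by rw [hskew, a01, map_zero, neg_zero]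
  have a02 : Γ v (Pi.single 2 1) 0 = 0 := by rw [hskew, a20, map_zero, neg_zero]
  have a12 : Γ v (Pi.single 2 1) 1 = 0 := by rw [hskew, a21, map_zero, neg_zero]
  refine ⟨?_, ?_, ?_⟩
  · conv_lhs => rw [eq_sum_single z]
    simp only [map_add, hsmul]
    funext k
    fin_cases k <;> simp [a21, a20, a01, a22, a10, a02, a12, mul_comm]
  · have := congrArg Complex.re (hskew 0 0)
    simp at this; linarith
  · have := congrArg Complex.re (hskew 1 1)
    simp at this; linarith

/-- A real covector is `reCovector a` for some `a`. -/
lemma exists_eq_reCovector (f : C3 →ₗ[ℝ] ℝ) : ∃ a : C3, ∀ z, f z = reCovector a z := by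
  refine ⟨fun k => ((f (Pi.single k 1) : ℝ) - Complex.I * f (Pi.single k Complex.I)) / 2,
    fun z => ?_⟩
  have hz : z = ∑ k,
      ((z k).re • (Pi.single k 1 : C3) + (z k).im • (Pi.single k Complex.I : C3)) := by
    funext j
    rw [Finset.sum_apply, Finset.sum_eq_single j]
    · simp
    · intro b _ hb
      simp [Pi.single_eq_of_ne' hb]
    · simp
  conv_lhs => rw [hz]
  rw [map_sum, reCovector, Finset.mul_sum]
  refine Finset.sum_congr rfl fun k _ => ?_
  simp
  ring

/-- In an adapted frame `T(e₃, ·)` is diagonal, by the Jacobi identity. -/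
lemma IsAdaptedTorsion.eq_zero (h : IsAdaptedTorsion (symbolTorsion R Γ) s t) (hs0 : s ≠ 0)
    (hR : ∀ z w, R z w = -R w z) (hb : IsBismutSymbol R Γ)
    (hN : IsTypeIntegrable (symbolTorsion R Γ))
    (hpar : ∀ v z w, Γ v (symbolTorsion R Γ z w)
      = symbolTorsion R Γ (Γ v z) w + symbolTorsion R Γ z (Γ v w))
    (hJ : StructureEquations.IsConsistent fun z w => R z w) : t = 0 := by
  have hτ : ∀ z w, symbolTorsion R Γ z w = -symbolTorsion R Γ w z := fun z w => by
    rw [symbolTorsion_apply, symbolTorsion_apply, hR]; abel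
  have hΓ := h.symbol_eq hs0 hN hτ hb.hermitian hpar
  have hRe : ∀ z w, R z w = symbolTorsion R Γ z w - Γ z w + Γ w z := fun z w => by
    rw [symbolTorsion_apply]; abel
  have hR2 : ∀ z w, R z w 2
      = conj s * (wedgeBar 1 1 z w - wedgeBar 0 0 z w) - conj t * wedgeBar 1 0 z w := by
    intro z w
    rw [hRe, h.torsion_eq hN hτ hb.skew, (hΓ z w).1, (hΓ w z).1]
    simp
  have hR0 : ∀ y, R (Pi.single 1 y) (Pi.single 2 1) 0 = conj t * y := by
    intro y
    rw [hRe, h.torsion_eq hN hτ hb.skew, (hΓ _ _).1, (hΓ (Pi.single 2 1) _).1]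
    simp [wedgeBar]
  have hR1 : ∀ y, R (Pi.single 1 y) (Pi.single 2 1) 1
      = (s - conj s + Γ (Pi.single 2 1) (Pi.single 1 1) 1) * y := by
    intro y
    rw [hRe, h.torsion_eq hN hτ hb.skew, (hΓ _ _).1, (hΓ (Pi.single 2 1) _).1]
    simp [wedgeBar]
    ring
  -- the third component of the Jacobi identity for `e₂, i e₂, e₃` contains `|t|²`
  have hJ2 := congrFun (hJ (Pi.single 1 1) (Pi.single 1 Complex.I) (Pi.single 2 1)) 2
  beta_reduce at hJ2
  rw [hR (Pi.single 2 1) (Pi.single 1 1)] at hJ2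
  simp only [Pi.add_apply, hR2, map_neg, Pi.neg_apply, wedgeBar, hR0, hR1] at hJ2
  have h1 := (hΓ (Pi.single 2 1) 0).2.2
  have := congrArg Complex.im hJ2
  simp [h1] at this
  rw [← Complex.normSq_eq_zero, Complex.normSq_apply]
  linarith

/-- The equations in an adapted frame become a normal form after the metric has been scaled by
`|s|²` and the last coframe element has been rotated. -/
theorem IsAdaptedTorsion.exists_normalForm (h : IsAdaptedTorsion (symbolTorsion R Γ) s t)
    (hs0 : s ≠ 0) (hR : ∀ z w, R z w = -R w z) (hb : IsBismutSymbol R Γ)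
    (hN : IsTypeIntegrable (symbolTorsion R Γ))
    (hpar : ∀ v z w, Γ v (symbolTorsion R Γ z w)
      = symbolTorsion R Γ (Γ v z) w + symbolTorsion R Γ z (Γ v w))
    (hJ : StructureEquations.IsConsistent fun z w => R z w) :
    ∃ (c : ℝ) (A : C3 ≃ₗ[ℂ] C3) (a b : C3), 0 < c ∧
      (∀ z w, c * realDot (A z) (A w) = realDot z w) ∧
      StructureEquations.conjBy A (fun z w => R z w) = normalForm a b := by
  obtain rfl := h.eq_zero hs0 hR hb hN hpar hJ
  have hτ : ∀ z w, symbolTorsion R Γ z w = -symbolTorsion R Γ w z := fun z w => by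
    rw [symbolTorsion_apply, symbolTorsion_apply, hR]; abel
  have hΓ := h.symbol_eq hs0 hN hτ hb.hermitian hpar
  set n : ℝ := Complex.normSq s with hn
  have hn0 : 0 < n := Complex.normSq_pos.2 hs0
  have hnc : (n : ℂ) ≠ 0 := by exact_mod_cast hn0.ne'
  have hsc : conj s ≠ 0 := by simpa using hs0
  have hss : conj s * s = n := by rw [hn, Complex.normSq_eq_conj_mul_self]
  have hn' : s.re * s.re + s.im * s.im = n := (Complex.normSq_apply s).symm
  set l : ℝ := (√n)⁻¹ with hl
  have hl2 : n * (l * l) = 1 := by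
    rw [hl, ← mul_inv, Real.mul_self_sqrt hn0.le, mul_inv_cancel₀ hn0.ne']
  have hl0 : l ≠ 0 := inv_ne_zero (Real.sqrt_pos.2 hn0).ne'
  -- `l` normalises the metric after scaling by `n = |s|²`; the factor `-i s̄ l²`, also of modulus
  -- `l`, turns the coefficient `s̄` of `dφ₃` into `i`
  let d : Fin 3 → ℂ := ![l, l, -Complex.I * conj s * (l * l)]
  have hd : ∀ i, d i ≠ 0 := fun i => by fin_cases i <;> simp [d, hl0, hs0]
  let A : C3 ≃ₗ[ℂ] C3 := LinearEquiv.piCongrRight fun i =>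
    LinearEquiv.smulOfNeZero ℂ ℂ (d i) (hd i)
  have hA : ∀ z, A z = ![l * z 0, l * z 1, -Complex.I * conj s * (l * l) * z 2] := fun z => by
    funext k
    fin_cases k <;> rfl
  let Al : C3 →ₗ[ℝ] C3 := A.toLinearMap.restrictScalars ℝ
  -- the coefficient of `w₁` in the first component of `R z w` is `s z₃ - s̄ z̄₃ - ⟨Γ z e₁⟩₁`; it is
  -- imaginary, and equal to `i α(z)`
  let α : C3 →ₗ[ℝ] ℝ :=
    { toFun := fun z => (2 * s * z 2 - Γ z (Pi.single 0 1) 0).im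
      map_add' := fun z w => by simp; ring
      map_smul' := fun c z => by simp; ring }
  let β : C3 →ₗ[ℝ] ℝ :=
    { toFun := fun z => (-2 * s * z 2 - Γ z (Pi.single 1 1) 1).im
      map_add' := fun z w => by simp; ring
      map_smul' := fun c z => by simp; ring }
  obtain ⟨a, ha⟩ := exists_eq_reCovector (α ∘ₗ Al)
  obtain ⟨b, hb'⟩ := exists_eq_reCovector (β ∘ₗ Al)
  refine ⟨n, A, a, b, hn0, fun z w => ?_, ?_⟩
  · simp only [hA, realDot_apply, Fin.sum_univ_three]
    simp
    linear_combination 2 * ((z 0).re * (w 0).re + (z 0).im * (w 0).im + (z 1).re * (w 1).re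
      + (z 1).im * (w 1).im) * hl2 + 2 * ((z 2).re * (w 2).re + (z 2).im * (w 2).im)
        * ((n * (l * l) + 1) * hl2 + n * l ^ 4 * hn')
  · symm
    refine StructureEquations.eq_conjBy fun z w => ?_
    have hRe : ∀ z w, R z w = symbolTorsion R Γ z w - Γ z w + Γ w z := fun z w => by
      rw [symbolTorsion_apply]; abel
    rw [hRe, h.torsion_eq hN hτ hb.skew, (hΓ (A z) (A w)).1, (hΓ (A w) (A z)).1]
    have ha1 : ∀ z, reCovector a z = α (A z) := fun z => (ha z).symm
    have hb1 : ∀ z, reCovector b z = β (A z) := fun z => (hb' z).symm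
    have g0 : ∀ v, Γ v (Pi.single 0 1) 0 = s * v 2 - conj s * conj (v 2) - Complex.I * α v := by
      intro v
      have h1 := (hΓ v 0).2.1
      apply Complex.ext <;> simp [α, h1]
      ring
    have g1 : ∀ v, Γ v (Pi.single 1 1) 1 = -s * v 2 + conj s * conj (v 2) - Complex.I * β v := by
      intro v
      have h1 := (hΓ v 0).2.2
      apply Complex.ext <;> simp [β, h1]
      ring
    rw [g0, g0, g1, g1, normalForm, ha1, ha1, hb1, hb1]
    generalize α (A z) = az
    generalize α (A w) = aw
    generalize β (A z) = bz
    generalize β (A w) = bw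
    simp only [hA]
    funext k
    fin_cases k <;> simp [wedgeBar] <;> ring_nf
    rw [Complex.I_sq]; ring

/-- The structure equations in an adapted frame belong to one of the families, up to scaling. -/
theorem IsAdaptedTorsion.exists_isFamilyMember (h : IsAdaptedTorsion (symbolTorsion R Γ) s t)
    (hs0 : s ≠ 0) (hR : ∀ z w, R z w = -R w z) (hb : IsBismutSymbol R Γ)
    (hN : IsTypeIntegrable (symbolTorsion R Γ))
    (hpar : ∀ v z w, Γ v (symbolTorsion R Γ z w)
      = symbolTorsion R Γ (Γ v z) w + symbolTorsion R Γ z (Γ v w))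
    (hJ : StructureEquations.IsConsistent fun z w => R z w) :
    ∃ (c : ℝ) (A : C3 ≃ₗ[ℂ] C3), 0 < c ∧ (∀ z w, c * realDot (A z) (A w) = realDot z w) ∧
      IsFamilyMember (StructureEquations.conjBy A fun z w => R z w) := by
  obtain ⟨c, A, a, b, hc, hA, hab⟩ := h.exists_normalForm hs0 hR hb hN hpar hJ
  have hadm : IsAdmissible a b := isAdmissible_of_isConsistent (hab ▸ hJ.conjBy A)
  obtain ⟨B, hB, hfam⟩ := hadm.exists_isFamilyMember
  refine ⟨c, B.trans A, hc, fun z w => ?_, ?_⟩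
  · rw [← hB z w]; exact hA (B z) (B w)
  · rw [← StructureEquations.conjBy_conjBy, hab]; exact hfam

end adapted

/-! ### The differential forms of a Hermitian connection -/

section HermitianConnections

variable {M : Type u} [TopologicalSpace M] [ChartedSpace E6 M]

/-- The formula `dφ(X, Y) = X(φ(Y)) - Y(φ(X)) - φ([X, Y])` for a one-form `φ`. -/
lemma extDerivFields_two (φ : (x : M) → TangentSpace (𝓡 6) x →L[ℝ] ℂ)
    (X Y : (x : M) → TangentSpace (𝓡 6) x) (x : M) :
    extDerivFields (fun y (u : Fin 1 → TangentSpace (𝓡 6) y) => φ y (u 0)) ![X, Y] x =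
      mvfderiv (𝓡 6) (fun y => φ y (Y y)) x (X x) - mvfderiv (𝓡 6) (fun y => φ y (X y)) x (Y x)
        - φ x (mlieBracket (𝓡 6) X Y x) := by
  rw [extDerivFields, Fin.sum_univ_two, Fin.sum_univ_two, Fin.sum_univ_one]
  have e0 : (0 : Fin 2).succAbove (0 : Fin 1) = 1 := rfl
  have e1 : (1 : Fin 2).succAbove (0 : Fin 1) = 0 := rfl
  simp only [Matrix.cons_val_zero, Matrix.cons_val_one, e0, e1]
  simp
  ring

variable [IsManifold (𝓡 6) ∞ M]

namespace AlmostHermitian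

variable (h : AlmostHermitian M)

instance instIsManifoldTwo : IsManifold (𝓡 6) 2 M := IsManifold.of_le (n := ∞) (by norm_cast)

instance instIsManifoldOne : IsManifold (𝓡 6) 1 M := IsManifold.of_le (n := ∞) (by norm_cast)

variable {h} in
lemma diffFieldAt_J {Y : (y : M) → TangentSpace (𝓡 6) y} {x : M} (hY : DiffFieldAt Y x) :
    DiffFieldAt (fun y => h.J y (Y y)) x :=
  MDifferentiableAt.clm_bundle_apply (F₁ := E6) (F₂ := E6)
    (h.contMDiff_J.mdifferentiable (by simp) x) hY

lemma mdifferentiableAt_metric {Y Z : (y : M) → TangentSpace (𝓡 6) y} {x : M}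
    (hY : DiffFieldAt Y x) (hZ : DiffFieldAt Z x) :
    MDifferentiableAt (𝓡 6) 𝓘(ℝ, ℝ) (fun y => h.metric.inner y (Y y) (Z y)) x := by
  have : MDifferentiableAt (𝓡 6) ((𝓡 6).prod 𝓘(ℝ, ℝ))
      (fun m => Bundle.TotalSpace.mk' ℝ (E := Bundle.Trivial M ℝ) m
        (h.metric.inner m (Y m) (Z m))) x := by
    apply MDifferentiableAt.clm_bundle_apply₂ (F₁ := E6) (F₂ := E6)
    · exact h.metric.contMDiff.mdifferentiable (by simp) x
    · exact hY
    · exact hZ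
  exact (mdifferentiableAt_totalSpace _ _ |>.1 this).2

/-- The Kähler form as a function of two vectors. -/
def omega (x : M) (v w : TangentSpace (𝓡 6) x) : ℝ := h.metric.inner x (h.J x v) w

lemma omega_swap (x : M) (v w : TangentSpace (𝓡 6) x) : h.omega x v w = -h.omega x w v := by
  rw [omega, omega, ← h.metric_J_J x (h.J x v) w, h.J_J, map_neg, neg_apply,
    h.metric.symm]

lemma omega_sub_right (x : M) (v w w' : TangentSpace (𝓡 6) x) :
    h.omega x v (w - w') = h.omega x v w - h.omega x v w' := by simp [omega]

lemma omega_sub_left (x : M) (v v' w : TangentSpace (𝓡 6) x) :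
    h.omega x (v - v') w = h.omega x v w - h.omega x v' w := by simp [omega]

variable {h} {cov : CovariantDerivative (𝓡 6) E6 (TangentSpace (𝓡 6) : M → Type)}

/-- The bracket of two vector fields in terms of a connection and its torsion. -/
lemma mlieBracket_eq {X Y : (y : M) → TangentSpace (𝓡 6) y} {x : M}
    (hX : DiffFieldAt X x) (hY : DiffFieldAt Y x) :
    mlieBracket (𝓡 6) X Y x = cov Y x (X x) - cov X x (Y x) - cov.torsion x (X x) (Y x) := by
  rw [cov.torsion_apply hX hY]; abel

/-- The Nijenhuis tensor in terms of the torsion of a Hermitian connection. -/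
lemma IsHermitianConnection.nijenhuis_eq (hc : h.IsHermitianConnection cov)
    {X Y : (y : M) → TangentSpace (𝓡 6) y} {x : M}
    (hX : DiffFieldAt X x) (hY : DiffFieldAt Y x) :
    mlieBracket (𝓡 6) (fun y => h.J y (X y)) (fun y => h.J y (Y y)) x
      - h.J x (mlieBracket (𝓡 6) (fun y => h.J y (X y)) Y x)
      - h.J x (mlieBracket (𝓡 6) X (fun y => h.J y (Y y)) x)
      - mlieBracket (𝓡 6) X Y x =
    -(cov.torsion x (h.J x (X x)) (h.J x (Y x)) - h.J x (cov.torsion x (h.J x (X x)) (Y x))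
      - h.J x (cov.torsion x (X x) (h.J x (Y x))) - cov.torsion x (X x) (Y x)) := by
  have hJX := diffFieldAt_J (h := h) hX
  have hJY := diffFieldAt_J (h := h) hY
  rw [mlieBracket_eq (cov := cov) hJX hJY, mlieBracket_eq (cov := cov) hJX hY,
    mlieBracket_eq (cov := cov) hX hJY, mlieBracket_eq (cov := cov) hX hY]
  simp only [hc.complex x X hX, hc.complex x Y hY, map_sub, h.J_J]
  abel

lemma mdifferentiableAt_omega {X Y : (y : M) → TangentSpace (𝓡 6) y} {x : M}
    (hX : DiffFieldAt X x) (hY : DiffFieldAt Y x) :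
    MDifferentiableAt (𝓡 6) 𝓘(ℝ, ℝ) (fun y => h.omega y (X y) (Y y)) x :=
  h.mdifferentiableAt_metric (diffFieldAt_J hX) hY

lemma IsHermitianConnection.mvfderiv_omega (hc : h.IsHermitianConnection cov)
    {X Y : (y : M) → TangentSpace (𝓡 6) y} {x : M}
    (hX : DiffFieldAt X x) (hY : DiffFieldAt Y x) (v : TangentSpace (𝓡 6) x) :
    mvfderiv (𝓡 6) (fun y => h.omega y (X y) (Y y)) x v =
      h.omega x (cov X x v) (Y x) + h.omega x (X x) (cov Y x v) := by
  have := hc.metric x _ Y (diffFieldAt_J (h := h) hX) hY v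
  rw [hc.complex x X hX] at this
  exact this

lemma kahlerFormSq_eq (x : M) (v : Fin 4 → TangentSpace (𝓡 6) x) : h.kahlerFormSq x v =
    2 * (h.omega x (v 0) (v 1) * h.omega x (v 2) (v 3)
    - h.omega x (v 0) (v 2) * h.omega x (v 1) (v 3)
    + h.omega x (v 0) (v 3) * h.omega x (v 1) (v 2)) := rfl

lemma IsHermitianConnection.mvfderiv_kahlerFormSq (hc : h.IsHermitianConnection cov)
    {X : Fin 4 → (y : M) → TangentSpace (𝓡 6) y} {x : M}
    (hX : ∀ i, DiffFieldAt (X i) x) (v : TangentSpace (𝓡 6) x) :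
    mvfderiv (𝓡 6) (fun y => h.kahlerFormSq y (fun l => X l y)) x v =
      2 * ((h.omega x (cov (X 0) x v) (X 1 x) + h.omega x (X 0 x) (cov (X 1) x v))
          * h.omega x (X 2 x) (X 3 x)
        + h.omega x (X 0 x) (X 1 x) * (h.omega x (cov (X 2) x v) (X 3 x)
          + h.omega x (X 2 x) (cov (X 3) x v))
        - (h.omega x (cov (X 0) x v) (X 2 x) + h.omega x (X 0 x) (cov (X 2) x v))
          * h.omega x (X 1 x) (X 3 x)
        - h.omega x (X 0 x) (X 2 x) * (h.omega x (cov (X 1) x v) (X 3 x)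
          + h.omega x (X 1 x) (cov (X 3) x v))
        + (h.omega x (cov (X 0) x v) (X 3 x) + h.omega x (X 0 x) (cov (X 3) x v))
          * h.omega x (X 1 x) (X 2 x)
        + h.omega x (X 0 x) (X 3 x) * (h.omega x (cov (X 1) x v) (X 2 x)
          + h.omega x (X 1 x) (cov (X 2) x v))) := by
  have hd : ∀ i j, MDifferentiableAt (𝓡 6) 𝓘(ℝ, ℝ) (fun y => h.omega y (X i y) (X j y)) x :=
    fun i j => mdifferentiableAt_omega (hX i) (hX j)
  have hf : (fun y => h.kahlerFormSq y (fun l => X l y)) =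
      (fun _ => (2 : ℝ)) * ((fun y => h.omega y (X 0 y) (X 1 y))
          * (fun y => h.omega y (X 2 y) (X 3 y))
        - (fun y => h.omega y (X 0 y) (X 2 y)) * (fun y => h.omega y (X 1 y) (X 3 y))
        + (fun y => h.omega y (X 0 y) (X 3 y)) * (fun y => h.omega y (X 1 y) (X 2 y))) := rfl
  have h1 := (hd 0 1).mul (hd 2 3)
  have h2 := (hd 0 2).mul (hd 1 3)
  have h3 := (hd 0 3).mul (hd 1 2)
  rw [hf, mvfderiv_mul mdifferentiableAt_const ((h1.sub h2).add h3), mvfderiv_add (h1.sub h2) h3,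
    mvfderiv_sub h1 h2, mvfderiv_mul (hd 0 1) (hd 2 3), mvfderiv_mul (hd 0 2) (hd 1 3),
    mvfderiv_mul (hd 0 3) (hd 1 2)]
  simp only [add_apply, sub_apply,
    smul_apply, smul_eq_mul, hc.mvfderiv_omega (hX _) (hX _), mvfderiv_const,
    zero_apply]
  ring

end AlmostHermitian
end HermitianConnections

/-- The cyclic sum `ω(T(a,b),c) + ω(T(b,c),a) + ω(T(c,a),b)`, that is `dω(a,b,c)` if `T` is the
torsion of a Hermitian connection. -/
def torsionForm {V : Type*} (om : V → V → ℝ) (T : V → V → V) (a b c : V) : ℝ :=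
  om (T a b) c + om (T b c) a + om (T c a) b

/-- The five-form `dω ∧ ω`, where `dω` is given by `torsionForm om T`. -/
def torsionFormWedge {V : Type*} (om : V → V → ℝ) (T : V → V → V) (X : Fin 5 → V) : ℝ :=
  torsionForm om T (X 2) (X 3) (X 4) * om (X 0) (X 1)
  - torsionForm om T (X 1) (X 3) (X 4) * om (X 0) (X 2)
  + torsionForm om T (X 1) (X 2) (X 4) * om (X 0) (X 3)
  - torsionForm om T (X 1) (X 2) (X 3) * om (X 0) (X 4)
  + torsionForm om T (X 0) (X 3) (X 4) * om (X 1) (X 2)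
  - torsionForm om T (X 0) (X 2) (X 4) * om (X 1) (X 3)
  + torsionForm om T (X 0) (X 2) (X 3) * om (X 1) (X 4)
  + torsionForm om T (X 0) (X 1) (X 4) * om (X 2) (X 3)
  - torsionForm om T (X 0) (X 1) (X 3) * om (X 2) (X 4)
  + torsionForm om T (X 0) (X 1) (X 2) * om (X 3) (X 4)

namespace AlmostHermitian
variable {M : Type u} [TopologicalSpace M] [ChartedSpace E6 M] [IsManifold (𝓡 6) ∞ M]
variable {h : AlmostHermitian M}
  {cov : CovariantDerivative (𝓡 6) E6 (TangentSpace (𝓡 6) : M → Type)}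

/-- `d(ω²) = 2 dω ∧ ω` in terms of the torsion of a Hermitian connection. -/
lemma IsHermitianConnection.extDerivFields_kahlerFormSq (hc : h.IsHermitianConnection cov)
    {X : Fin 5 → (y : M) → TangentSpace (𝓡 6) y} {x : M} (hX : ∀ i, DiffFieldAt (X i) x) :
    extDerivFields h.kahlerFormSq X x =
      2 * torsionFormWedge (h.omega x) (fun v w => cov.torsion x v w) (fun i => X i x) := by
  have hbr : ∀ i j, mlieBracket (𝓡 6) (X i) (X j) x
      = cov (X j) x (X i x) - cov (X i) x (X j x) - cov.torsion x (X i x) (X j x) :=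
    fun i j => mlieBracket_eq (hX i) (hX j)
  rw [extDerivFields]
  simp only [hc.mvfderiv_kahlerFormSq (X := fun l => X (Fin.succAbove _ l)) (fun i => hX _)]
  simp only [hbr, kahlerFormSq_eq]
  have s0 : ∀ i : Fin 4, (0 : Fin 5).succAbove i = i.succ := fun i => rfl
  simp only [Fin.sum_univ_succ, Fin.sum_univ_zero]
  simp [Fin.succAbove, Function.update, Fin.ext_iff]
  simp only [torsionFormWedge, torsionForm, omega_sub_left, omega_sub_right]
  have ht : ∀ v w u, h.omega x u (cov.torsion x v w) = -h.omega x (cov.torsion x v w) u :=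
    fun _ _ _ => h.omega_swap x _ _
  have hcv : ∀ i v u, h.omega x u (cov (X i) x v) = -h.omega x (cov (X i) x v) u :=
    fun _ _ _ => h.omega_swap x _ _
  have hts : ∀ v w u, h.omega x (cov.torsion x v w) u = -h.omega x (cov.torsion x w v) u := by
    intro v w u
    rw [cov.torsion_antisymm v w]; simp [omega]
  simp only [ht, hcv, hts (X 2 x) (X 0 x), hts (X 3 x) (X 0 x), hts (X 4 x) (X 0 x),
    hts (X 3 x) (X 1 x), hts (X 4 x) (X 1 x), hts (X 4 x) (X 2 x)]
  ring
end AlmostHermitian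

/-! ### Frames with constant structure functions -/

section ConstFrame

variable {M : Type u} [TopologicalSpace M] [ChartedSpace E6 M] [IsManifold (𝓡 6) ∞ M]

/-- A unitary frame over the open set `U`, written as a family of real-linear isomorphisms
`E y : ℂ³ ≃ T_y M` compatible with the complex structures and the metrics, whose brackets are
`[E_z, E_w] = -E_{R z w}` with constant coefficients `R`. -/
structure IsConstFrame (h : AlmostHermitian M) (U : Set M) (R : RealBilin)
    (E : (y : M) → C3 →ₗ[ℝ] TangentSpace (𝓡 6) y) : Prop where
  isOpen : IsOpen U
  surjective : ∀ y ∈ U, Function.Surjective (E y)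
  differentiable : ∀ z, ∀ y ∈ U, DiffFieldAt (fun y => E y z) y
  bracket : ∀ z w, ∀ y ∈ U,
    mlieBracket (𝓡 6) (fun y => E y z) (fun y => E y w) y = -E y (R z w)
  metric : ∀ z w, ∀ y ∈ U, h.metric.inner y (E y z) (E y w) = realDot z w
  complex : ∀ z, ∀ y ∈ U, h.J y (E y z) = E y (Complex.I • z)

namespace IsConstFrame

variable {h : AlmostHermitian M} {U : Set M} {R : RealBilin}
  {E : (y : M) → C3 →ₗ[ℝ] TangentSpace (𝓡 6) y}
  {cov : CovariantDerivative (𝓡 6) E6 (TangentSpace (𝓡 6) : M → Type)} {y : M}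

lemma injective (hE : IsConstFrame h U R E) (hy : y ∈ U) : Function.Injective (E y) := by
  rw [← LinearMap.ker_eq_bot, LinearMap.ker_eq_bot']
  intro z hz
  by_contra hne
  have := realDot_self_pos hne
  rw [← hE.metric z z y hy, hz] at this
  simp at this

/-- The frame obtained by a unitary change of basis. -/
lemma comp (hE : IsConstFrame h U R E) {A : C3 ≃ₗ[ℂ] C3} (hA : IsUnitaryEquiv A) {R' : RealBilin}
    (hR' : ∀ z w, A (R' z w) = R (A z) (A w)) :
    IsConstFrame h U R' (fun y => E y ∘ₗ (A.toLinearMap.restrictScalars ℝ)) where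
  isOpen := hE.isOpen
  surjective y hy := (hE.surjective y hy).comp A.surjective
  differentiable z y hy := hE.differentiable (A z) y hy
  bracket z w y hy := (hE.bracket (A z) (A w) y hy).trans (by simp [hR'])
  metric z w y hy := (hE.metric (A z) (A w) y hy).trans (hA z w)
  complex z y hy := (hE.complex (A z) y hy).trans (by simp)

lemma eventually_mem (hE : IsConstFrame h U R E) (hy : y ∈ U) : ∀ᶠ y in nhds y, y ∈ U :=
  hE.isOpen.mem_nhds hy

/-- The coefficients of a connection at a point. -/
lemma exists_symbol (hE : IsConstFrame h U R E) (hy : y ∈ U)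
    (cov : CovariantDerivative (𝓡 6) E6 (TangentSpace (𝓡 6) : M → Type)) :
    ∃ Γ : RealBilin, ∀ z w, cov (fun y => E y w) y (E y z) = E y (Γ z w) := by
  let e : C3 ≃ₗ[ℝ] TangentSpace (𝓡 6) y :=
    LinearEquiv.ofBijective (E y) ⟨hE.injective hy, hE.surjective y hy⟩
  refine ⟨LinearMap.mk₂ ℝ (fun z w => e.symm (cov (fun y => E y w) y (E y z)))
    (fun a b c => by simp) (fun r a c => by simp) (fun a b c => ?_) (fun r a c => ?_), ?_⟩
  · rw [← map_add]
    congr 1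
    have := cov.isCovariantDerivativeOn.add (hE.differentiable b y hy) (hE.differentiable c y hy)
    rw [← add_apply, ← this]
    congr 2
    funext y'
    simp
  · rw [← map_smul]
    congr 1
    have := cov.isCovariantDerivativeOn.smul_const r (hE.differentiable c y hy)
    rw [← smul_apply, ← this]
    congr 2
    funext y'
    simp
  · intro z w
    exact (e.apply_symm_apply _).symm

lemma cov_congr {X Y : (y : M) → TangentSpace (𝓡 6) y} (hX : DiffFieldAt X y)
    (hY : DiffFieldAt Y y) (hXY : ∀ᶠ y in nhds y, X y = Y y) : cov X y = cov Y y :=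
  cov.isCovariantDerivativeOn.congr_of_eventuallyEq hX hY Filter.univ_mem hXY

section symbol

variable {Γ : RealBilin}

lemma isHermitianSymbol (hE : IsConstFrame h U R E) (hy : y ∈ U)
    (hc : h.IsHermitianConnection cov)
    (hΓ : ∀ z w, cov (fun y => E y w) y (E y z) = E y (Γ z w)) : IsHermitianSymbol Γ where
  complex z w := by
    apply hE.injective hy
    rw [← hΓ, ← hE.complex _ y hy, ← hΓ, ← hc.complex y _ (hE.differentiable w y hy)]
    rw [cov_congr (hE.differentiable _ y hy)
      (AlmostHermitian.diffFieldAt_J (h := h) (hE.differentiable w y hy))]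
    filter_upwards [hE.eventually_mem hy] with y' hy' using (hE.complex w y' hy').symm
  metric z w v := by
    have := hc.metric y _ _ (hE.differentiable w y hy) (hE.differentiable v y hy) (E y z)
    rw [hΓ, hΓ, hE.metric _ _ y hy, hE.metric _ _ y hy] at this
    rw [← this]
    have hev : (fun y => h.metric.inner y (E y w) (E y v)) =ᶠ[nhds y] fun _ => realDot w v := by
      filter_upwards [hE.eventually_mem hy] with y' hy' using hE.metric w v y' hy'
    have : mvfderiv (𝓡 6) (fun y => h.metric.inner y (E y w) (E y v)) y
        = mvfderiv (𝓡 6) (fun _ => realDot w v) y := by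
      simp only [mvfderiv, hev.mfderiv_eq]
      rfl
    rw [this, mvfderiv_const]; rfl

lemma torsion_eq (hE : IsConstFrame h U R E) (hy : y ∈ U)
    (hΓ : ∀ z w, cov (fun y => E y w) y (E y z) = E y (Γ z w)) (z w : C3) :
    cov.torsion y (E y z) (E y w) = E y (symbolTorsion R Γ z w) := by
  have := cov.torsion_apply (hE.differentiable z y hy) (hE.differentiable w y hy)
  rw [this, hΓ, hΓ, hE.bracket z w y hy, symbolTorsion_apply]
  simp

lemma isBismutSymbol (hE : IsConstFrame h U R E) (hy : y ∈ U) (hc : h.IsBismut cov)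
    (hΓ : ∀ z w, cov (fun y => E y w) y (E y z) = E y (Γ z w)) : IsBismutSymbol R Γ where
  hermitian := hE.isHermitianSymbol hy hc.hermitian hΓ
  skew z w v := by
    rw [← hE.metric _ _ y hy, ← hE.metric _ _ y hy, ← hE.torsion_eq hy hΓ, ← hE.torsion_eq hy hΓ]
    exact hc.torsion_skew y _ _ _

/-- The coefficients of the Bismut connection are constant. -/
lemma exists_isBismutSymbol (hE : IsConstFrame h U R E) (hU : U.Nonempty) (hc : h.IsBismut cov) :
    ∃ Γ, IsBismutSymbol R Γ ∧ ∀ y ∈ U, ∀ z w, cov (fun y => E y w) y (E y z) = E y (Γ z w) := by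
  obtain ⟨y₀, hy₀⟩ := hU
  obtain ⟨Γ, hΓ⟩ := hE.exists_symbol hy₀ cov
  refine ⟨Γ, hE.isBismutSymbol hy₀ hc hΓ, fun y hy => ?_⟩
  obtain ⟨Γ', hΓ'⟩ := hE.exists_symbol hy cov
  rwa [(hE.isBismutSymbol hy₀ hc hΓ).unique (hE.isBismutSymbol hy hc hΓ')]

/-- If the torsion is parallel, the coefficients of the connection act on it as derivations. -/
lemma symbol_torsion (hE : IsConstFrame h U R E) (hy : y ∈ U)
    (hΓ : ∀ y ∈ U, ∀ z w, cov (fun y => E y w) y (E y z) = E y (Γ z w))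
    (hpar : ∀ (x : M) (Y Z : (y : M) → TangentSpace (𝓡 6) y), DiffFieldAt Y x → DiffFieldAt Z x →
      ∀ v : TangentSpace (𝓡 6) x,
        cov (fun y => cov.torsion y (Y y) (Z y)) x v
          - cov.torsion x (cov Y x v) (Z x) - cov.torsion x (Y x) (cov Z x v) = 0) (v z w : C3) :
    Γ v (symbolTorsion R Γ z w)
      = symbolTorsion R Γ (Γ v z) w + symbolTorsion R Γ z (Γ v w) := by
  apply hE.injective hy
  have := hpar y _ _ (hE.differentiable z y hy) (hE.differentiable w y hy) (E y v)
  have hev : ∀ᶠ y' in nhds y, E y' (symbolTorsion R Γ z w)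
      = cov.torsion y' (E y' z) (E y' w) := by
    filter_upwards [hE.eventually_mem hy] with y' hy' using (hE.torsion_eq hy' (hΓ y' hy') z w).symm
  have hd : DiffFieldAt (fun y => cov.torsion y (E y z) (E y w)) y :=
    (hE.differentiable (symbolTorsion R Γ z w) y hy).congr_of_eventuallyEq (by
      filter_upwards [hev] with y' hy' using by rw [hy'])
  rw [← cov_congr (hE.differentiable _ y hy) hd hev, hΓ y hy, hΓ y hy, hΓ y hy,
    hE.torsion_eq hy (hΓ y hy), hE.torsion_eq hy (hΓ y hy), sub_sub, sub_eq_zero] at this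
  rw [this, map_add]

lemma isTypeIntegrable (hE : IsConstFrame h U R E) (hy : y ∈ U)
    (hc : h.IsHermitianConnection cov) (hI : h.IsIntegrable)
    (hΓ : ∀ z w, cov (fun y => E y w) y (E y z) = E y (Γ z w)) :
    IsTypeIntegrable (symbolTorsion R Γ) := fun z w => by
  apply hE.injective hy
  have := hI y _ _ (hE.differentiable z y hy) (hE.differentiable w y hy)
  rw [hc.nijenhuis_eq (hE.differentiable z y hy) (hE.differentiable w y hy), neg_eq_zero] at this
  simp only [hE.complex _ y hy, hE.torsion_eq hy hΓ] at this
  simpa using this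

lemma torsionFormWedge_eq_zero (hE : IsConstFrame h U R E) (hy : y ∈ U)
    (hc : h.IsHermitianConnection cov) (hB : h.IsBalanced)
    (hΓ : ∀ z w, cov (fun y => E y w) y (E y z) = E y (Γ z w)) (X : Fin 5 → C3) :
    torsionFormWedge (fun z w => realDot (Complex.I • z) w) (fun z w => symbolTorsion R Γ z w) X
      = 0 := by
  have := hB y (fun i y => E y (X i)) (fun i => hE.differentiable (X i) y hy)
  rw [hc.extDerivFields_kahlerFormSq (fun i => hE.differentiable (X i) y hy)] at this
  have h2 := (mul_eq_zero.1 this).resolve_left two_ne_zero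
  simpa only [torsionFormWedge, torsionForm, AlmostHermitian.omega, hE.torsion_eq hy hΓ,
    hE.complex _ y hy, hE.metric _ _ y hy] using h2

/-- For a metric of middle type, the matrix `B` formed from the complex-bilinear part of the Bismut
torsion has rank two: in the frame `eₖ / √2` the components of the Chern torsion are `-1/2` times
those of this part, so that the two matrices differ by the factor `1/4`. -/
lemma bMatrix_rank (hE : IsConstFrame h U R E) (hy : y ∈ U) (hR : ∀ z w, R z w = -R w z)
    (hb : IsBismutSymbol R Γ) (hN : IsTypeIntegrable (symbolTorsion R Γ)) (hm : h.IsMiddleType) :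
    (Matrix.of fun i j : Fin 3 => ∑ r, ∑ s,
      holPart (symbolTorsion R Γ) (Pi.single r 1) (Pi.single s 1) j
        * conj (holPart (symbolTorsion R Γ) (Pi.single r 1) (Pi.single s 1) i)).rank = 2 := by
  obtain ⟨cov, hc, hr⟩ := hm
  obtain ⟨D, hD⟩ := hE.exists_symbol hy cov
  have hτ : ∀ z w, symbolTorsion R Γ z w = -symbolTorsion R Γ w z := fun z w => by
    rw [symbolTorsion_apply, symbolTorsion_apply, hR]; abel
  have hT : ∀ z w, symbolTorsion R D z w = -holPart (symbolTorsion R Γ) z w := by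
    refine chernTorsion_eq_neg_holPart (D := D - Γ) ⟨fun z w => ?_, fun z w v => ?_⟩
      (fun z w => ?_) hN hτ (fun z w => ?_) hb.skew
    · have h1 := (hE.isHermitianSymbol hy hc.hermitian hD).complex z w
      have h2 := hb.hermitian.complex z w
      simp only [LinearMap.sub_apply, h1, h2, smul_sub]
    · have h1 := (hE.isHermitianSymbol hy hc.hermitian hD).metric z w v
      have h2 := hb.hermitian.metric z w v
      simp only [LinearMap.sub_apply, map_sub]
      linarith
    · simp only [symbolTorsion_apply, LinearMap.sub_apply]; abel
    · apply hE.injective hy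
      rw [map_neg, ← hE.torsion_eq hy hD, ← hE.torsion_eq hy hD, ← hE.complex _ y hy,
        ← hE.complex _ y hy, hc.torsion_J_J]
  have h2 : (√2 : ℝ)⁻¹ * (√2)⁻¹ = 2⁻¹ := by
    rw [← mul_inv, Real.mul_self_sqrt (by norm_num)]
  set ε : Fin 3 → TangentSpace (𝓡 6) y := fun k => E y ((√2 : ℝ)⁻¹ • Pi.single k 1) with hε
  have hεu : h.IsUnitaryFrame y ε := by
    intro i j
    simp only [hε]
    rw [hE.metric _ _ y hy, hE.complex _ y hy, hE.metric _ _ y hy, smul_comm Complex.I]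
    simp only [map_smul, LinearMap.smul_apply, smul_eq_mul]
    have hs : (Complex.I • Pi.single j 1 : C3) = Pi.single j Complex.I := by
      rw [← Pi.single_smul]; simp
    rw [hs, realDot_single, realDot_single, ← mul_assoc, ← mul_assoc, h2]
    by_cases hij : i = j
    · subst hij; simp
    · simp [hij]
  have key : ∀ k r s, h.torsionComponent y (cov.torsion y) ε k r s
      = -(2⁻¹ : ℂ) * holPart (symbolTorsion R Γ) (Pi.single r 1) (Pi.single s 1) k := by
    intro k r s
    have hs : (Complex.I • Pi.single k 1 : C3) = Pi.single k Complex.I := by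
      rw [← Pi.single_smul]; simp
    simp only [AlmostHermitian.torsionComponent, hε]
    rw [hE.torsion_eq hy hD, hE.complex _ y hy, hE.metric _ _ y hy, hE.metric _ _ y hy,
      smul_comm Complex.I]
    simp only [map_smul, LinearMap.smul_apply, hT]
    rw [hs]
    simp only [smul_eq_mul, map_neg, LinearMap.neg_apply, realDot_single]
    generalize holPart (symbolTorsion R Γ) (Pi.single r 1) (Pi.single s 1) k = x
    have h2' : ((√2 : ℝ) : ℂ)⁻¹ * ((√2 : ℝ) : ℂ)⁻¹ = 2⁻¹ := by
      rw [← Complex.ofReal_inv, ← Complex.ofReal_mul, h2]; simp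
    have h4 : ∀ a : ℂ, ((√2 : ℝ) : ℂ)⁻¹ * (((√2 : ℝ) : ℂ)⁻¹ * (((√2 : ℝ) : ℂ)⁻¹ * a))
        / ((√2 : ℝ) : ℂ) = 4⁻¹ * a := fun a => by
      linear_combination a * (((√2 : ℝ) : ℂ)⁻¹ * ((√2 : ℝ) : ℂ)⁻¹ + 2⁻¹) * h2'
    have h1 : (x * conj 1).re = x.re := by simp
    have hi : (x * conj Complex.I).re = x.im := by simp
    rw [h1, hi, add_div, mul_div_assoc]
    push_cast
    rw [h4, h4]
    linear_combination -(2⁻¹ : ℂ) * Complex.re_add_im x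
  have hB := hr y ε hεu
  have : h.bMatrix y (cov.torsion y) ε = (4⁻¹ : ℂ) • (Matrix.of fun i j : Fin 3 => ∑ r, ∑ s,
      holPart (symbolTorsion R Γ) (Pi.single r 1) (Pi.single s 1) j
        * conj (holPart (symbolTorsion R Γ) (Pi.single r 1) (Pi.single s 1) i)) := by
    ext i j
    simp only [AlmostHermitian.bMatrix, key, Matrix.of_apply, Matrix.smul_apply, smul_eq_mul,
      Finset.mul_sum, map_mul, map_neg, map_inv₀, Complex.conj_ofNat]
    refine Finset.sum_congr rfl fun r _ => Finset.sum_congr rfl fun s _ => ?_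
    ring
  rwa [this, Matrix.rank_smul_of_mem_nonZeroDivisors _
    (mem_nonZeroDivisors_of_ne_zero (by norm_num))] at hB

end symbol
end IsConstFrame
end ConstFrame

/-! ### Unitary frames adapted to the torsion -/

lemma realDot_eq_re_inner (z w : C3) :
    realDot z w
      = 2 * (inner ℂ (WithLp.toLp 2 w : EuclideanSpace ℂ (Fin 3)) (WithLp.toLp 2 z)).re := by
  simp [realDot_apply, EuclideanSpace.inner_eq_star_dotProduct, dotProduct, -Complex.mul_re]

/-- An orthonormal basis as a unitary transformation of `ℂ³`. -/
def unitaryOfBasis (b : OrthonormalBasis (Fin 3) ℂ (EuclideanSpace ℂ (Fin 3))) : C3 ≃ₗ[ℂ] C3 :=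
  (WithLp.linearEquiv 2 ℂ C3).symm.trans
    (b.repr.toLinearEquiv.symm.trans (WithLp.linearEquiv 2 ℂ C3))

lemma isUnitaryEquiv_unitaryOfBasis (b : OrthonormalBasis (Fin 3) ℂ (EuclideanSpace ℂ (Fin 3))) :
    IsUnitaryEquiv (unitaryOfBasis b) := fun z w => by
  rw [realDot_eq_re_inner, realDot_eq_re_inner,
    ← b.repr.symm.inner_map_map (WithLp.toLp 2 w) (WithLp.toLp 2 z)]
  rfl

lemma unitaryOfBasis_single (b : OrthonormalBasis (Fin 3) ℂ (EuclideanSpace ℂ (Fin 3)))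
    (i : Fin 3) : unitaryOfBasis b (Pi.single i 1) = (b i).ofLp := by
  rw [← b.repr_symm_single i]; rfl

lemma unitaryOfBasis_symm_apply (b : OrthonormalBasis (Fin 3) ℂ (EuclideanSpace ℂ (Fin 3)))
    (x : C3) (i : Fin 3) :
    (unitaryOfBasis b).symm x i = inner ℂ (b i) (WithLp.toLp 2 x) := by
  rw [← b.repr_apply_apply]; rfl

/-- If the matrix `B` of a complex-bilinear map `N` is degenerate, there is a unitary frame `e` such
that `N` takes its values in the span of `e₁, e₂`, and `e₂` is an eigenvector of `N(e₃, ·)`. -/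
lemma exists_unitary_adapted (N : C3 →ₗ[ℂ] C3 →ₗ[ℂ] C3)
    (hB : (Matrix.of fun i j : Fin 3 => ∑ r, ∑ s,
      N (Pi.single r 1) (Pi.single s 1) j * conj (N (Pi.single r 1) (Pi.single s 1) i)).rank = 2) :
    ∃ (A : C3 ≃ₗ[ℂ] C3) (μ : ℂ), IsUnitaryEquiv A ∧
      (∀ z w, A.symm (N (A z) (A w)) 2 = 0) ∧
      A.symm (N (A (Pi.single 2 1)) (A (Pi.single 1 1))) = μ • Pi.single 1 1 := by
  set B := (Matrix.of fun i j : Fin 3 => ∑ r, ∑ s,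
      N (Pi.single r 1) (Pi.single s 1) j * conj (N (Pi.single r 1) (Pi.single s 1) i)) with hBdef
  have hdet : B.det = 0 := by
    by_contra hne
    have := Matrix.rank_of_isUnit B ((Matrix.isUnit_iff_isUnit_det B).2 (isUnit_iff_ne_zero.2 hne))
    rw [hB] at this
    simp at this
  obtain ⟨v, hv0, hv⟩ := Matrix.exists_mulVec_eq_zero_iff.2 hdet
  -- `v̄` is orthogonal to the image of `N`, since `v* B v = ∑ |⟨N(eᵣ, eₛ), v̄⟩|²`
  have hsum : ∑ r : Fin 3, ∑ s : Fin 3,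
      Complex.normSq (∑ j, N (Pi.single r 1) (Pi.single s 1) j * v j) = 0 := by
    have h0 : ∑ i, conj (v i) * (B *ᵥ v) i = 0 := by simp [hv]
    have h1 : ∑ i, conj (v i) * (B *ᵥ v) i = ((∑ r : Fin 3, ∑ s : Fin 3,
      Complex.normSq (∑ j, N (Pi.single r 1) (Pi.single s 1) j * v j) : ℝ) : ℂ) := by
      simp only [Complex.ofReal_sum, ← Complex.mul_conj, map_sum, map_mul]
      simp only [hBdef, Matrix.mulVec, dotProduct, Matrix.of_apply, Fin.sum_univ_three]
      ring
    rw [h1] at h0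
    exact_mod_cast h0
  have hrs : ∀ r s : Fin 3, ∑ j, N (Pi.single r 1) (Pi.single s 1) j * v j = 0 := by
    intro r s
    rw [Finset.sum_eq_zero_iff_of_nonneg
      (fun _ _ => Finset.sum_nonneg fun _ _ => Complex.normSq_nonneg _)] at hsum
    have := hsum r (Finset.mem_univ _)
    rw [Finset.sum_eq_zero_iff_of_nonneg (fun _ _ => Complex.normSq_nonneg _)] at this
    exact Complex.normSq_eq_zero.1 (this s (Finset.mem_univ _))
  have hall : ∀ z w, ∑ j, N z w j * v j = 0 := by
    intro z w
    have e : ∀ z w, ∑ j, N z w j * v j = (Fintype.linearCombination ℂ v) (N z w) := fun z w => by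
      simp [Fintype.linearCombination_apply]
    simp only [e] at hrs ⊢
    rw [eq_sum_single z, eq_sum_single w]
    simp [hrs]
  set ξ : EuclideanSpace ℂ (Fin 3) := WithLp.toLp 2 (fun i => conj (v i)) with hξ
  have hξ0 : ξ ≠ 0 := by
    intro h0
    apply hv0
    funext i
    have := congrFun (congrArg WithLp.ofLp h0) i
    simpa [hξ] using this
  have hin : ∀ z w, inner ℂ ξ (WithLp.toLp 2 (N z w)) = 0 := fun z w => by
    rw [← hall z w]
    simp [hξ, EuclideanSpace.inner_eq_star_dotProduct, dotProduct]
  set u2 : EuclideanSpace ℂ (Fin 3) := ((‖ξ‖⁻¹ : ℝ) : ℂ) • ξ with hu2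
  have hu2n : ‖u2‖ = 1 := by
    rw [hu2, norm_smul]; simp [hξ0]
  -- the endomorphism `N(e₃, ·)` preserves the orthogonal complement of `e₃`, hence has an
  -- eigenvector there
  set W := (ℂ ∙ ξ)ᗮ with hW
  let T : EuclideanSpace ℂ (Fin 3) →ₗ[ℂ] EuclideanSpace ℂ (Fin 3) :=
    (WithLp.linearEquiv 2 ℂ C3).symm.toLinearMap ∘ₗ (N u2.ofLp) ∘ₗ
      (WithLp.linearEquiv 2 ℂ C3).toLinearMap
  have hT : ∀ x, T x = WithLp.toLp 2 (N u2.ofLp x.ofLp) := fun x => rfl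
  have hTW : ∀ x ∈ W, T x ∈ W := fun x _ =>
    Submodule.mem_orthogonal_singleton_iff_inner_right.2 (hin _ _)
  have hfin : Module.finrank ℂ W = 2 := by
    have : Fact (Module.finrank ℂ (EuclideanSpace ℂ (Fin 3)) = 2 + 1) := ⟨by simp⟩
    exact Submodule.finrank_orthogonal_span_singleton hξ0
  have : Nontrivial W := Module.nontrivial_of_finrank_pos (R := ℂ) (by rw [hfin]; norm_num)
  obtain ⟨μ, hμ⟩ := Module.End.exists_eigenvalue (T.restrict hTW)
  obtain ⟨w, hw⟩ := hμ.exists_hasEigenvector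
  have hw0 : (w : EuclideanSpace ℂ (Fin 3)) ≠ 0 := fun h0 => hw.2 (Subtype.ext h0)
  have hTw : T w = μ • (w : EuclideanSpace ℂ (Fin 3)) := congrArg Subtype.val hw.apply_eq_smul
  set u1 : EuclideanSpace ℂ (Fin 3) :=
    ((‖(w : EuclideanSpace ℂ (Fin 3))‖⁻¹ : ℝ) : ℂ) • (w : EuclideanSpace ℂ (Fin 3)) with hu1
  have hu1n : ‖u1‖ = 1 := by
    rw [hu1, norm_smul]; simp [hw0]
  have hort : inner ℂ u1 u2 = 0 := by
    have := Submodule.mem_orthogonal_singleton_iff_inner_left.1 w.2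
    rw [hu1, hu2, inner_smul_left, inner_smul_right, this]; simp
  have hort' : inner ℂ u2 u1 = 0 := by
    have := Submodule.mem_orthogonal_singleton_iff_inner_right.1 w.2
    rw [hu1, hu2, inner_smul_left, inner_smul_right, this]; simp
  have hon : Orthonormal ℂ (({1, 2} : Set (Fin 3)).domRestrict ![0, u1, u2]) := by
    have hin2 : ∀ i j : Fin 3, (i = 1 ∨ i = 2) → (j = 1 ∨ j = 2) →
        inner ℂ (![0, u1, u2] i) (![0, u1, u2] j) = if i = j then 1 else 0 := by
      rintro i j (rfl | rfl) (rfl | rfl) <;> simp [hort, hort', hu1n, hu2n]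
    rw [orthonormal_iff_ite]
    intro i j
    simpa [Subtype.ext_iff] using hin2 i j i.2 j.2
  obtain ⟨b, hb⟩ := hon.exists_orthonormalBasis_extension_of_card_eq (by simp)
  have hb1 : b 1 = u1 := hb 1 (by simp)
  have hb2 : b 2 = u2 := hb 2 (by simp)
  refine ⟨unitaryOfBasis b, μ, isUnitaryEquiv_unitaryOfBasis b, fun z w => ?_, ?_⟩
  · rw [unitaryOfBasis_symm_apply, hb2, hu2, inner_smul_left, hin, mul_zero]
  · rw [LinearEquiv.symm_apply_eq, map_smul, unitaryOfBasis_single, unitaryOfBasis_single, hb1, hb2]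
    have h1 : T u1 = μ • u1 := by
      rw [hu1, map_smul, hTw, smul_comm]
    have := congrArg WithLp.ofLp h1
    rwa [hT] at this

/-- The values of `dω` on a vector and a complex line, which turn `dω ∧ ω = 0` into the vanishing of
a trace. -/
lemma torsionForm_I {τ : RealBilin} (hN : IsTypeIntegrable τ) (hτ : ∀ z w, τ z w = -τ w z)
    (hs : ∀ z w v, realDot (τ z w) v = -realDot (τ z v) w) (v e : C3) :
    torsionForm (fun z w => realDot (Complex.I • z) w) (fun z w => τ z w) v e (Complex.I • e)
      = -2 * realDot (holPart τ v e) e := by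
  have h1 := hs v e e
  have h2 : realDot (τ (Complex.I • e) v) (Complex.I • e) = 0 := by
    have := hs v (Complex.I • e) (Complex.I • e)
    rw [hτ, map_neg, LinearMap.neg_apply]; linarith
  have h3 := realDot_torsion_eq_cyclic hN hτ hs e (Complex.I • e) (Complex.I • v)
  have h00 : ∀ x, holPart τ x x = 0 := fun x => self_eq_neg.1 (holPart_swap hτ x x)
  rw [holPart_I_left hN, holPart_smul_right hN hτ, holPart_smul_right hN hτ, I_smul_I_smul, h00,
    holPart_I_left hN, realDot_I_I, holPart_swap hτ e v] at h3
  simp only [map_zero, LinearMap.zero_apply, realDot_I_I, neg_neg] at h3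
  simp only [torsionForm, realDot_I_I]
  rw [realDot_I_left (τ e _), realDot_I_left (τ (Complex.I • e) v), h2]
  linarith

/-- For a balanced metric the holomorphic part of the torsion is trace-free. -/
lemma holPart_trace {τ : RealBilin} (hN : IsTypeIntegrable τ) (hτ : ∀ z w, τ z w = -τ w z)
    (hs : ∀ z w v, realDot (τ z w) v = -realDot (τ z v) w)
    (hw : ∀ X, torsionFormWedge (fun z w => realDot (Complex.I • z) w) (fun z w => τ z w) X = 0)
    {a b c : Fin 3} (hab : a ≠ b) (hca : c ≠ a) (hcb : c ≠ b) :
    holPart τ (Pi.single c 1) (Pi.single a 1) a + holPart τ (Pi.single c 1) (Pi.single b 1) b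
      = 0 := by
  have hI : ∀ i, (Complex.I • Pi.single i 1 : C3) = Pi.single i Complex.I := fun i => by
    rw [← Pi.single_smul]; simp
  have key : ∀ p : ℂ, (holPart τ (Pi.single c p) (Pi.single a 1) a).re
      + (holPart τ (Pi.single c p) (Pi.single b 1) b).re = 0 := by
    intro p
    have ta := torsionForm_I hN hτ hs (Pi.single c p) (Pi.single a 1)
    have tb := torsionForm_I hN hτ hs (Pi.single c p) (Pi.single b 1)
    have := hw ![Pi.single c p, Pi.single a 1, Complex.I • Pi.single a 1, Pi.single b 1,
      Complex.I • Pi.single b 1]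
    simp only [torsionFormWedge] at this
    simp only [Matrix.cons_val] at this
    rw [ta, tb] at this
    simp only [hI, realDot_single] at this
    simp [hab.symm, hca.symm, hcb.symm] at this
    linarith
  have h1 := key 1
  have h2 := key Complex.I
  rw [← hI, holPart_I_left hN, holPart_I_left hN] at h2
  simp at h2
  apply Complex.ext
  · simpa using h1
  · simp only [Complex.add_im, Complex.zero_im]; linarith

/-- The torsion of a balanced metric of middle type is adapted, once `e₃` is orthogonal to the image
of its complex-bilinear part and `e₂` is an eigenvector. -/
lemma exists_isAdaptedTorsion {τ : RealBilin} (hN : IsTypeIntegrable τ)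
    (hτ : ∀ z w, τ z w = -τ w z) (hs : ∀ z w v, realDot (τ z w) v = -realDot (τ z v) w)
    (hw : ∀ X, torsionFormWedge (fun z w => realDot (Complex.I • z) w) (fun z w => τ z w) X = 0)
    (hB : (Matrix.of fun i j : Fin 3 => ∑ r, ∑ s,
      holPart τ (Pi.single r 1) (Pi.single s 1) j
        * conj (holPart τ (Pi.single r 1) (Pi.single s 1) i)).rank = 2)
    (h2 : ∀ z w, holPart τ z w 2 = 0) {μ : ℂ}
    (hμ : holPart τ (Pi.single 2 1) (Pi.single 1 1) = μ • Pi.single 1 1) :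
    ∃ s t : ℂ, s ≠ 0 ∧ IsAdaptedTorsion τ s t := by
  have hsw := holPart_swap hτ
  have t0 := holPart_trace hN hτ hs hw (a := 1) (b := 2) (c := 0)
    (by decide) (by decide) (by decide)
  have t1 := holPart_trace hN hτ hs hw (a := 0) (b := 2) (c := 1)
    (by decide) (by decide) (by decide)
  have t2 := holPart_trace hN hτ hs hw (a := 0) (b := 1) (c := 2)
    (by decide) (by decide) (by decide)
  rw [h2, add_zero] at t0 t1
  rw [hμ] at t2
  simp at t2
  have had : IsAdaptedTorsion τ (-μ) (holPart τ (Pi.single 2 1) (Pi.single 0 1) 1) := by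
    refine ⟨?_, ?_, ?_⟩
    · funext i
      fin_cases i
      · rw [hsw]; simp [t1]
      · simp [t0]
      · simp [h2]
    · funext i
      fin_cases i
      · simp; linear_combination t2
      · simp
      · simp [h2]
    · rw [hμ]; funext i
      fin_cases i <;> simp
  refine ⟨_, _, ?_, had⟩
  -- if the eigenvalue vanishes, only one component of the torsion is left, and `B` has rank one
  intro h0
  have hval := had.holPart_eq hN hτ
  rw [h0] at hval
  have hle : (Matrix.of fun i j : Fin 3 => ∑ r, ∑ s,
      holPart τ (Pi.single r 1) (Pi.single s 1) j
        * conj (holPart τ (Pi.single r 1) (Pi.single s 1) i)).rank ≤ 1 := by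
    have : (Matrix.of fun i j : Fin 3 => ∑ r, ∑ s,
      holPart τ (Pi.single r 1) (Pi.single s 1) j
        * conj (holPart τ (Pi.single r 1) (Pi.single s 1) i)) =
      Matrix.vecMulVec (Pi.single 1 1) (Pi.single 1 (2 *
        (holPart τ (Pi.single 2 1) (Pi.single 0 1) 1
        * conj (holPart τ (Pi.single 2 1) (Pi.single 0 1) 1)))) := by
      generalize holPart τ (Pi.single 2 1) (Pi.single 0 1) 1 = t at hval
      ext i j
      simp only [hval, Matrix.vecMulVec_apply, Matrix.of_apply]
      fin_cases i <;> fin_cases j <;> simp [Fin.sum_univ_three]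
      ring
    rw [this]
    exact Matrix.rank_vecMulVec_le _ _
  omega

/-- The structure functions in the frame obtained by applying `A`. -/
def RealBilin.conjBy (A : C3 ≃ₗ[ℂ] C3) (R : RealBilin) : RealBilin :=
  (R.compl₁₂ (A.toLinearMap.restrictScalars ℝ) (A.toLinearMap.restrictScalars ℝ)).compr₂
    (A.symm.toLinearMap.restrictScalars ℝ)

lemma RealBilin.conjBy_apply (A : C3 ≃ₗ[ℂ] C3) (R : RealBilin) (z w : C3) :
    R.conjBy A z w = A.symm (R (A z) (A w)) := rfl

/-- The holomorphic part of the torsion as a complex-bilinear map. -/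
def holBilin {τ : RealBilin} (hN : IsTypeIntegrable τ) (hτ : ∀ z w, τ z w = -τ w z) :
    C3 →ₗ[ℂ] C3 →ₗ[ℂ] C3 :=
  LinearMap.mk₂ ℂ (holPart τ) holPart_add_left (holPart_smul_left hN) holPart_add_right
    (holPart_smul_right hN hτ)

/-- The classification in terms of a unitary frame with constant structure functions. -/
theorem IsConstFrame.exists_isFamilyMember {M : Type u} [TopologicalSpace M] [ChartedSpace E6 M]
    [IsManifold (𝓡 6) ∞ M] {h : AlmostHermitian M} {U : Set M} {R : RealBilin}
    {E : (y : M) → C3 →ₗ[ℝ] TangentSpace (𝓡 6) y} (hE : IsConstFrame h U R E) (hU : U.Nonempty)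
    (hR : ∀ z w, R z w = -R w z) (hJ : StructureEquations.IsConsistent fun z w => R z w)
    (hI : h.IsIntegrable) (hB : h.IsBalanced) (hP : h.IsBTP) (hm : h.IsMiddleType) :
    ∃ (c : ℝ) (A : C3 ≃ₗ[ℂ] C3), 0 < c ∧ (∀ z w, c * realDot (A z) (A w) = realDot z w) ∧
      IsFamilyMember (StructureEquations.conjBy A fun z w => R z w) := by
  obtain ⟨cov, hc, hpar⟩ := hP
  obtain ⟨Γ, hb, hΓ⟩ := hE.exists_isBismutSymbol hU hc
  obtain ⟨y, hy⟩ := hU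
  have hN := hE.isTypeIntegrable hy hc.hermitian hI (hΓ y hy)
  have hτ : ∀ z w, symbolTorsion R Γ z w = -symbolTorsion R Γ w z := fun z w => by
    rw [symbolTorsion_apply, symbolTorsion_apply, hR]; abel
  obtain ⟨A, μ, hA, hA2, hAμ⟩ := exists_unitary_adapted (holBilin hN hτ)
    (hE.bMatrix_rank hy hR hb hN hm)
  -- everything is computed again in the adapted frame
  have hE' := hE.comp hA (R' := R.conjBy A) (fun z w => by simp [RealBilin.conjBy_apply])
  obtain ⟨Γ', hb', hΓ'⟩ := hE'.exists_isBismutSymbol ⟨y, hy⟩ hc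
  have hR' : ∀ z w, R.conjBy A z w = -R.conjBy A w z := fun z w => by
    rw [RealBilin.conjBy_apply, RealBilin.conjBy_apply, hR, map_neg]
  have hN' := hE'.isTypeIntegrable hy hc.hermitian hI (hΓ' y hy)
  have hτ' : ∀ z w, symbolTorsion (R.conjBy A) Γ' z w = -symbolTorsion (R.conjBy A) Γ' w z :=
    fun z w => by rw [symbolTorsion_apply, symbolTorsion_apply, hR']; abel
  have hττ : ∀ z w, symbolTorsion (R.conjBy A) Γ' z w = A.symm (symbolTorsion R Γ (A z) (A w)) := by
    intro z w
    rw [LinearEquiv.eq_symm_apply]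
    apply hE.injective hy
    exact (hE'.torsion_eq hy (hΓ' y hy) z w).symm.trans (hE.torsion_eq hy (hΓ y hy) (A z) (A w))
  have hhol : ∀ z w, holPart (symbolTorsion (R.conjBy A) Γ') z w
      = A.symm (holPart (symbolTorsion R Γ) (A z) (A w)) := by
    intro z w
    have hr : ∀ (r : ℝ) (x : C3), A.symm (r • x) = r • A.symm x := fun r x =>
      (A.symm.toLinearMap.restrictScalars ℝ).map_smul r x
    simp only [holPart, hττ, hr, map_sub, map_smul]
  obtain ⟨s, t, hs, hst⟩ := exists_isAdaptedTorsion hN' hτ' hb'.skew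
    (hE'.torsionFormWedge_eq_zero hy hc.hermitian hB (hΓ' y hy))
    (hE'.bMatrix_rank hy hR' hb' hN' hm) (fun z w => by rw [hhol]; exact hA2 z w)
    (μ := μ) (by rw [hhol]; exact hAμ)
  obtain ⟨c, B, hc0, hcB, hfam⟩ := hst.exists_isFamilyMember hs hR' hb' hN'
    (hE'.symbol_torsion hy hΓ' hpar) (hJ.conjBy A)
  exact ⟨c, B.trans A, hc0, fun z w => (congrArg (c * ·) (hA _ _)).trans (hcB z w), hfam⟩

/-! ### Unitary bases of Hermitian vector spaces -/

section UnitaryBasis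

variable {V : Type*} [AddCommGroup V] [Module ℝ V] [FiniteDimensional ℝ V]

/-- The vector of norm `√2` orthogonal to few given directions. -/
lemma exists_normalized_in_ker (g : V →ₗ[ℝ] V →ₗ[ℝ] ℝ) (hpos : ∀ v, v ≠ 0 → 0 < g v v)
    {n : ℕ} (hn : n < Module.finrank ℝ V) (l : Fin n → V →ₗ[ℝ] ℝ) :
    ∃ v, g v v = 2 ∧ ∀ i, l i v = 0 := by
  have hk : LinearMap.ker (LinearMap.pi l) ≠ ⊥ := by
    apply LinearMap.ker_ne_bot_of_finrank_lt
    simpa using hn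
  obtain ⟨v, hv, hv0⟩ := Submodule.exists_mem_ne_zero_of_ne_bot hk
  have hp := hpos v hv0
  refine ⟨√(2 / g v v) • v, ?_, fun i => ?_⟩
  · simp only [map_smul, LinearMap.smul_apply, smul_eq_mul]
    rw [← mul_assoc, Real.mul_self_sqrt (by positivity)]
    field_simp
  · have := congrFun (LinearMap.mem_ker.1 hv) i
    rw [map_smul]
    simp only [LinearMap.pi_apply, Pi.zero_apply] at this
    rw [this, smul_zero]

/-- A six-dimensional space with a metric and an orthogonal complex structure is isometric to
`ℂ³`. -/
lemma exists_unitary_iso (hV : Module.finrank ℝ V = 6) (g : V →ₗ[ℝ] V →ₗ[ℝ] ℝ)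
    (hpos : ∀ v, v ≠ 0 → 0 < g v v) (hsymm : ∀ v w, g v w = g w v) (J : V →ₗ[ℝ] V)
    (hJ : ∀ v, J (J v) = -v) (hgJ : ∀ v w, g (J v) (J w) = g v w) :
    ∃ Φ : C3 ≃ₗ[ℝ] V, (∀ z w, g (Φ z) (Φ w) = realDot z w) ∧
      ∀ z, J (Φ z) = Φ (Complex.I • z) := by
  have hJr : ∀ v w, g v (J w) = -g (J v) w := fun v w => by
    rw [← hgJ v (J w), hJ, map_neg]
  have hJv : ∀ v, g v (J v) = 0 := fun v => by
    have := hJr v v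
    rw [hsymm (J v)] at this
    linarith
  obtain ⟨f0, h0, -⟩ := exists_normalized_in_ker g hpos (n := 0) (by omega) ![]
  obtain ⟨f1, h1, h1'⟩ := exists_normalized_in_ker g hpos (n := 2) (by omega) ![g f0, g (J f0)]
  obtain ⟨f2, h2, h2'⟩ := exists_normalized_in_ker g hpos (n := 4) (by omega)
    ![g f0, g (J f0), g f1, g (J f1)]
  have a1 : g f0 f1 = 0 := h1' 0
  have a2 : g (J f0) f1 = 0 := h1' 1
  have a3 : g f0 f2 = 0 := h2' 0
  have a4 : g (J f0) f2 = 0 := h2' 1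
  have a5 : g f1 f2 = 0 := h2' 2
  have a6 : g (J f1) f2 = 0 := h2' 3
  have b1 : g f1 f0 = 0 := by rw [hsymm, a1]
  have b3 : g f2 f0 = 0 := by rw [hsymm, a3]
  have b5 : g f2 f1 = 0 := by rw [hsymm, a5]
  have b2 : g (J f1) f0 = 0 := by have := hJr f0 f1; rw [hsymm, this, a2, neg_zero]
  have b4 : g (J f2) f0 = 0 := by have := hJr f0 f2; rw [hsymm, this, a4, neg_zero]
  have b6 : g (J f2) f1 = 0 := by have := hJr f1 f2; rw [hsymm, this, a6, neg_zero]
  have d : ∀ v, g (J v) v = 0 := fun v => by rw [hsymm, hJv]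
  let F : C3 →ₗ[ℝ] V :=
    { toFun := fun z => ((z 0).re • f0 + (z 0).im • J f0) + ((z 1).re • f1 + (z 1).im • J f1)
        + ((z 2).re • f2 + (z 2).im • J f2)
      map_add' := fun z w => by simp only [Pi.add_apply, Complex.add_re, Complex.add_im]; module
      map_smul' := fun r z => by
        simp only [Pi.smul_apply, Complex.real_smul, Complex.re_ofReal_mul, Complex.im_ofReal_mul,
          RingHom.id_apply]
        module }
  have hF : ∀ z, F z = ((z 0).re • f0 + (z 0).im • J f0) + ((z 1).re • f1 + (z 1).im • J f1)
        + ((z 2).re • f2 + (z 2).im • J f2) := fun _ => rfl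
  have hg : ∀ z w, g (F z) (F w) = realDot z w := fun z w => by
    simp only [hF, map_add, map_smul, LinearMap.add_apply, LinearMap.smul_apply, smul_eq_mul, hgJ,
      hJr, h0, h1, h2, a1, a2, a3, a4, a5, a6, b1, b2, b3, b4, b5, b6, d, realDot_apply,
      Fin.sum_univ_three, Complex.mul_re, Complex.conj_re, Complex.conj_im]
    ring
  have hinj : Function.Injective F := by
    rw [← LinearMap.ker_eq_bot, LinearMap.ker_eq_bot']
    intro z hz
    by_contra hne
    have := realDot_self_pos hne
    rw [← hg, hz] at this
    simp at this
  refine ⟨LinearEquiv.ofInjectiveOfFinrankEq F hinj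
    (by rw [hV]; simp [Module.finrank_pi_fintype]), hg, fun z => ?_⟩
  change J (F z) = F (Complex.I • z)
  simp only [hF, map_add, map_smul, hJ, Pi.smul_apply, smul_eq_mul, Complex.mul_re, Complex.mul_im,
    Complex.I_re, Complex.I_im]
  module

end UnitaryBasis

/-! ### Left-invariant frames -/

section LieGroupFrames

variable {G : Type v} [TopologicalSpace G] [ChartedSpace E6 G] [Group G] [LieGroup (𝓡 6) ∞ G]

instance instLieGroupThree : LieGroup (𝓡 6) (minSmoothness ℝ 3) G :=
  LieGroup.of_le (n := ∞) (by simp; norm_cast)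

/-- The left-invariant frame extending an isomorphism of `ℂ³` with the Lie algebra. -/
def invFrame (Φ : C3 ≃ₗ[ℝ] GroupLieAlgebra (𝓡 6) G) (y : G) : C3 →ₗ[ℝ] TangentSpace (𝓡 6) y where
  toFun z := mulInvariantVectorField (Φ z) y
  map_add' z w := by rw [map_add, mulInvariantVectorField_add]; rfl
  map_smul' r z := by rw [map_smul, mulInvariantVectorField_smul]; rfl

/-- The structure functions of a left-invariant frame: minus the Lie bracket. -/
def lieBilin (Φ : C3 ≃ₗ[ℝ] GroupLieAlgebra (𝓡 6) G) : RealBilin :=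
  LinearMap.mk₂ ℝ (fun z w => -Φ.symm ⁅Φ z, Φ w⁆)
    (fun a b c => by simp [add_lie]; abel) (fun r a c => by simp)
    (fun a b c => by simp [lie_add]; abel) (fun r a c => by simp)

lemma lieBilin_apply (Φ : C3 ≃ₗ[ℝ] GroupLieAlgebra (𝓡 6) G) (z w : C3) :
    lieBilin Φ z w = -Φ.symm ⁅Φ z, Φ w⁆ := rfl

lemma lieBilin_swap (Φ : C3 ≃ₗ[ℝ] GroupLieAlgebra (𝓡 6) G) (z w : C3) :
    lieBilin Φ z w = -lieBilin Φ w z := by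
  rw [lieBilin_apply, lieBilin_apply, ← lie_skew, map_neg]

lemma isConsistent_lieBilin (Φ : C3 ≃ₗ[ℝ] GroupLieAlgebra (𝓡 6) G) :
    StructureEquations.IsConsistent fun z w => lieBilin Φ z w := fun x y z => by
  simp only [lieBilin_apply, map_neg, LinearEquiv.apply_symm_apply, neg_neg]
  rw [← map_add, ← map_add, lie_jacobi, map_zero]

lemma mlieBracket_invFrame (Φ : C3 ≃ₗ[ℝ] GroupLieAlgebra (𝓡 6) G) (z w : C3) (y : G) :
    mlieBracket (𝓡 6) (fun y => invFrame Φ y z) (fun y => invFrame Φ y w) y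
      = -invFrame Φ y (lieBilin Φ z w) := by
  have := congrFun (mulInvariantVector_mlieBracket (I := 𝓡 6) (Φ z) (Φ w)) y
  rw [← map_neg, lieBilin_apply, neg_neg]
  change _ = mulInvariantVectorField (Φ (Φ.symm ⁅Φ z, Φ w⁆)) y
  rw [LinearEquiv.apply_symm_apply]
  exact this.symm

lemma diffFieldAt_invFrame (Φ : C3 ≃ₗ[ℝ] GroupLieAlgebra (𝓡 6) G) (z : C3) (y : G) :
    DiffFieldAt (fun y => invFrame Φ y z) y :=
  mdifferentiableAt_mulInvariantVectorField (I := 𝓡 6) (Φ z)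

lemma mfderiv_mul_left_mulInvariantVectorField (a x : G) (v : GroupLieAlgebra (𝓡 6) G) :
    mfderiv (𝓡 6) (𝓡 6) (a * ·) x (mulInvariantVectorField v x)
      = mulInvariantVectorField v (a * x) := by
  have key : ∀ b, x * 1 = b → mfderiv (𝓡 6) (𝓡 6) (a * ·) b
      (show TangentSpace (𝓡 6) b from mfderiv (𝓡 6) (𝓡 6) (x * ·) 1 v)
      = (show TangentSpace (𝓡 6) (a * b) from mfderiv (𝓡 6) (𝓡 6) (a * x * ·) 1 v) := by
    rintro b rfl
    have hd : ∀ a b : G, MDifferentiableAt (𝓡 6) (𝓡 6) (a * ·) b := fun a b =>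
      (contMDiff_mul_left (I := 𝓡 6) (n := ∞)).contMDiffAt.mdifferentiableAt (by simp)
    have : (a * x * ·) = (a * ·) ∘ (x * ·) := funext fun y => mul_assoc a x y
    rw [this, mfderiv_comp (I' := 𝓡 6) _ (hd _ _) (hd _ _)]
    rfl
  exact key x (mul_one x)

variable {h : AlmostHermitian G}

lemma AlmostHermitian.IsLeftInvariant.metric_mulInvariantVectorField (hh : h.IsLeftInvariant)
    (v w : GroupLieAlgebra (𝓡 6) G) (y : G) :
    h.metric.inner y (mulInvariantVectorField v y) (mulInvariantVectorField w y)
      = h.metric.inner 1 v w := by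
  have key : ∀ b, y * 1 = b → h.metric.inner b
      (show TangentSpace (𝓡 6) b from mfderiv (𝓡 6) (𝓡 6) (y * ·) 1 v)
      (show TangentSpace (𝓡 6) b from mfderiv (𝓡 6) (𝓡 6) (y * ·) 1 w) = h.metric.inner 1 v w := by
    rintro b rfl
    exact hh.metric y 1 v w
  exact key y (mul_one y)

lemma AlmostHermitian.IsLeftInvariant.complex_mulInvariantVectorField (hh : h.IsLeftInvariant)
    (v : GroupLieAlgebra (𝓡 6) G) (y : G) :
    h.J y (mulInvariantVectorField v y)
      = mulInvariantVectorField (h.J 1 v : GroupLieAlgebra (𝓡 6) G) y := by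
  have key : ∀ b, y * 1 = b → h.J b
      (show TangentSpace (𝓡 6) b from mfderiv (𝓡 6) (𝓡 6) (y * ·) 1 v)
      = (show TangentSpace (𝓡 6) b from mfderiv (𝓡 6) (𝓡 6) (y * ·) 1 (h.J 1 v)) := by
    rintro b rfl
    exact hh.complex y 1 v
  exact key y (mul_one y)

lemma isConstFrame_invFrame (hh : h.IsLeftInvariant) (Φ : C3 ≃ₗ[ℝ] GroupLieAlgebra (𝓡 6) G)
    (hm : ∀ z w, h.metric.inner 1 (Φ z) (Φ w) = realDot z w)
    (hJ : ∀ z, h.J 1 (Φ z) = Φ (Complex.I • z)) :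
    IsConstFrame h Set.univ (lieBilin Φ) (invFrame Φ) := by
  have hmet : ∀ z w y, h.metric.inner y (invFrame Φ y z) (invFrame Φ y w) = realDot z w :=
    fun z w y => (hh.metric_mulInvariantVectorField _ _ y).trans (hm z w)
  refine ⟨isOpen_univ, fun y _ => ?_, fun z y _ => diffFieldAt_invFrame Φ z y,
    fun z w y _ => mlieBracket_invFrame Φ z w y, fun z w y _ => hmet z w y, fun z y _ => ?_⟩
  · have hinj : Function.Injective (invFrame Φ y) := by
      rw [← LinearMap.ker_eq_bot, LinearMap.ker_eq_bot']
      intro z hz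
      by_contra hne
      have := realDot_self_pos hne
      rw [← hmet z z y, hz] at this
      simp at this
    have : FiniteDimensional ℝ (TangentSpace (𝓡 6) y) := inferInstanceAs (FiniteDimensional ℝ E6)
    have hf : Module.finrank ℝ (TangentSpace (𝓡 6) y) = 6 :=
      (finrank_euclideanSpace_fin : Module.finrank ℝ E6 = 6)
    refine (LinearMap.injective_iff_surjective_of_finrank_eq_finrank ?_).1 hinj
    rw [hf]; simp [Module.finrank_pi_fintype]
  · refine (hh.complex_mulInvariantVectorField (Φ z) y).trans ?_
    rw [hJ]; rfl

/-- The Lie algebra of an almost Hermitian Lie group has a unitary basis. -/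
lemma exists_unitary_lieAlgebra (h : AlmostHermitian G) :
    ∃ Φ : C3 ≃ₗ[ℝ] GroupLieAlgebra (𝓡 6) G,
      (∀ z w, h.metric.inner 1 (Φ z) (Φ w) = realDot z w) ∧
      ∀ z, h.J 1 (Φ z) = Φ (Complex.I • z) := by
  have : FiniteDimensional ℝ (TangentSpace (𝓡 6) (1 : G)) :=
    inferInstanceAs (FiniteDimensional ℝ E6)
  have hf : Module.finrank ℝ (TangentSpace (𝓡 6) (1 : G)) = 6 :=
    (finrank_euclideanSpace_fin : Module.finrank ℝ E6 = 6)
  exact exists_unitary_iso hf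
    (LinearMap.mk₂ ℝ (fun v w => h.metric.inner 1 v w) (by simp) (by simp) (by simp) (by simp))
    (h.metric.pos 1) (h.metric.symm 1) (h.J 1).toLinearMap (h.J_J 1) (h.metric_J_J 1)

/-- A left-invariant frame whose structure functions belong to a family. -/
lemma isMember_of_isConstFrame {Φ : C3 ≃ₗ[ℝ] GroupLieAlgebra (𝓡 6) G}
    (hE : IsConstFrame h Set.univ (lieBilin Φ) (invFrame Φ))
    (hfam : IsFamilyMember fun z w => lieBilin Φ z w) : h.IsMember := by
  let e : (y : G) → C3 ≃ₗ[ℝ] TangentSpace (𝓡 6) y := fun y =>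
    LinearEquiv.ofBijective (invFrame Φ y)
      ⟨hE.injective (Set.mem_univ y), hE.surjective y (Set.mem_univ y)⟩
  have hfin : ∀ y : G, FiniteDimensional ℝ (TangentSpace (𝓡 6) y) := fun y =>
    inferInstanceAs (FiniteDimensional ℝ E6)
  have hT2 : ∀ y : G, T2Space (TangentSpace (𝓡 6) y) := fun y => inferInstanceAs (T2Space E6)
  let φ : Fin 3 → (x : G) → TangentSpace (𝓡 6) x →L[ℝ] ℂ := fun i x =>
    LinearMap.toContinuousLinearMap ((LinearMap.proj i : C3 →ₗ[ℝ] ℂ) ∘ₗ (e x).symm.toLinearMap)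
  have hφ : ∀ i x z, φ i x (invFrame Φ x z) = z i := fun i x z => by
    exact congrFun ((e x).symm_apply_apply z : (e x).symm (invFrame Φ x z) = z) i
  refine ⟨_, φ, hfam, ⟨fun i a x v => ?_, fun i x v => ?_, fun x v w => ?_⟩, fun v w x k => ?_⟩
  · obtain ⟨z, rfl⟩ := hE.surjective x (Set.mem_univ x) v
    have : mfderiv (𝓡 6) (𝓡 6) (a * ·) x (invFrame Φ x z) = invFrame Φ (a * x) z :=
      mfderiv_mul_left_mulInvariantVectorField a x (Φ z)
    rw [this, hφ i, hφ i]
  · obtain ⟨z, rfl⟩ := hE.surjective x (Set.mem_univ x) v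
    rw [hE.complex z x (Set.mem_univ x), hφ i, hφ i]; rfl
  · obtain ⟨z, rfl⟩ := hE.surjective x (Set.mem_univ x) v
    obtain ⟨w, rfl⟩ := hE.surjective x (Set.mem_univ x) w
    rw [hE.metric z w x (Set.mem_univ x)]
    simp only [hφ, realDot_apply]
    push_cast
    rw [Finset.mul_sum]
    refine Finset.sum_congr rfl fun i _ => ?_
    apply Complex.ext
    · simp; ring
    · simp; ring
  · obtain ⟨z, rfl⟩ := Φ.surjective v
    obtain ⟨w, rfl⟩ := Φ.surjective w
    have hz : ∀ i, φ i x (mulInvariantVectorField (Φ z) x) = z i := fun i => hφ i x z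
    have hw : ∀ i, φ i x (mulInvariantVectorField (Φ w) x) = w i := fun i => hφ i x w
    simp only [hz, hw]
    have hz' : (fun y => φ k y (mulInvariantVectorField (Φ z) y)) = fun _ => z k :=
      funext fun y => hφ k y z
    have hw' : (fun y => φ k y (mulInvariantVectorField (Φ w) y)) = fun _ => w k :=
      funext fun y => hφ k y w
    have hbr : φ k x (mlieBracket (𝓡 6) (mulInvariantVectorField (Φ z))
        (mulInvariantVectorField (Φ w)) x) = -lieBilin Φ z w k := by
      have := mlieBracket_invFrame Φ z w x
      rw [← map_neg] at this
      exact (congrArg (φ k x) this).trans (hφ k x _)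
    rw [extDerivFields_two, hz', hw', mvfderiv_const, mvfderiv_const, hbr]
    simp

end LieGroupFrames

/-! ### Frames on the quotient of a Lie-Hermitian covering -/

section Cover

variable {G : Type v} [TopologicalSpace G] [ChartedSpace E6 G] [Group G] [LieGroup (𝓡 6) ∞ G]
  {M : Type u} [TopologicalSpace M] [ChartedSpace E6 M] [IsManifold (𝓡 6) ∞ M]
  {hM : AlmostHermitian M} {hG : AlmostHermitian G} {π : G → M}

/-- The frame transported by a local section `σ` of the covering. -/
def pullFrame (E : (x : G) → C3 →ₗ[ℝ] TangentSpace (𝓡 6) x) (σ : M → G) (y : M) :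
    C3 →ₗ[ℝ] TangentSpace (𝓡 6) y :=
  (mfderiv (𝓡 6) (𝓡 6) σ y).inverse.toLinearMap ∘ₗ E (σ y)

/-- A frame with constant structure functions on the covering group induces one on an open subset
of the quotient. -/
lemma IsConstFrame.pullFrame (hπ : IsLieHermitianCover hM hG π) {R : RealBilin}
    {E : (x : G) → C3 →ₗ[ℝ] TangentSpace (𝓡 6) x} (hE : IsConstFrame hG Set.univ R E) :
    IsConstFrame hM (hπ.isLocalDiffeomorph 1).localInverse.source R
      (pullFrame E (hπ.isLocalDiffeomorph 1).localInverse) := by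
  have hl := hπ.isLocalDiffeomorph 1
  set σ := hl.localInverse with hσ
  have hσy : ∀ y ∈ σ.source, IsLocalDiffeomorphAt (𝓡 6) (𝓡 6) ∞ σ y := fun y hy =>
    σ.isLocalDiffeomorphAt _ _ _ hy
  have hinv : ∀ y ∈ σ.source, (mfderiv (𝓡 6) (𝓡 6) σ y).IsInvertible := fun y hy =>
    ⟨(hσy y hy).mfderivToContinuousLinearEquiv (by simp),
      (hσy y hy).mfderivToContinuousLinearEquiv_coe (by simp)⟩
  -- the inverse of `dσ` is `dπ`
  have hdπ : ∀ y ∈ σ.source, ∀ v : TangentSpace (𝓡 6) (σ y),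
      (mfderiv (𝓡 6) (𝓡 6) σ y).inverse v
        = (show TangentSpace (𝓡 6) y from mfderiv (𝓡 6) (𝓡 6) π (σ y) v) := by
    intro y hy v
    obtain ⟨w, rfl⟩ : ∃ w, mfderiv (𝓡 6) (𝓡 6) σ y w = v := (hinv y hy).bijective.2 v
    have h1 : (mfderiv (𝓡 6) (𝓡 6) σ y).inverse (mfderiv (𝓡 6) (𝓡 6) σ y w) = w := by
      obtain ⟨e, he⟩ := hinv y hy
      rw [← he]; simp
    rw [h1]
    have hcomp : mfderiv (𝓡 6) (𝓡 6) (π ∘ σ) y = ContinuousLinearMap.id ℝ _ := by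
      have : π ∘ σ =ᶠ[nhds y] id := by
        filter_upwards [σ.open_source.mem_nhds hy] with y' hy' using hl.localInverse_right_inv hy'
      rw [this.mfderiv_eq, mfderiv_id]
    rw [mfderiv_comp y ((hπ.isLocalDiffeomorph (σ y)).mdifferentiableAt (by simp))
      ((hσy y hy).mdifferentiableAt (by simp))] at hcomp
    exact (congrArg (fun L => L w) hcomp).symm
  have hmet : ∀ (x : G) (b : M), π x = b → ∀ v w : TangentSpace (𝓡 6) x, hM.metric.inner b
      (show TangentSpace (𝓡 6) b from mfderiv (𝓡 6) (𝓡 6) π x v)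
      (show TangentSpace (𝓡 6) b from mfderiv (𝓡 6) (𝓡 6) π x w) = hG.metric.inner x v w := by
    rintro x b rfl v w
    exact hπ.isometry x v w
  have hcom : ∀ (x : G) (b : M), π x = b → ∀ v : TangentSpace (𝓡 6) x, hM.J b
      (show TangentSpace (𝓡 6) b from mfderiv (𝓡 6) (𝓡 6) π x v)
      = (show TangentSpace (𝓡 6) b from mfderiv (𝓡 6) (𝓡 6) π x (hG.J x v)) := by
    rintro x b rfl v
    exact hπ.holomorphic x v
  have happ : ∀ y ∈ σ.source, ∀ z, _root_.pullFrame E σ y z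
      = (show TangentSpace (𝓡 6) y from mfderiv (𝓡 6) (𝓡 6) π (σ y) (E (σ y) z)) :=
    fun y hy z => hdπ y hy _
  have hsm : ∀ y ∈ σ.source, ContMDiffAt (𝓡 6) (𝓡 6) ∞ σ y := fun y hy => (hσy y hy).contMDiffAt
  refine ⟨σ.open_source, fun y hy => ?_, fun z y hy => ?_, fun z w y hy => ?_, fun z w y hy => ?_,
    fun z y hy => ?_⟩
  · obtain ⟨e, he⟩ := hinv y hy
    have hs : Function.Surjective (mfderiv (𝓡 6) (𝓡 6) σ y).inverse := by
      rw [← he, ContinuousLinearMap.inverse_equiv]; exact e.symm.surjective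
    exact hs.comp (hE.surjective (σ y) (Set.mem_univ _))
  · exact MDifferentiableAt.mpullback_vectorField (hE.differentiable z (σ y) (Set.mem_univ _))
      (hsm y hy) (hinv y hy) (by norm_cast)
  · have : IsManifold (𝓡 6) (minSmoothness ℝ 2) M := by
      rw [minSmoothness_of_isRCLikeNormedField]; infer_instance
    have : IsManifold (𝓡 6) (minSmoothness ℝ 2) G := by
      rw [minSmoothness_of_isRCLikeNormedField]; infer_instance
    have := mpullback_mlieBracket (n := ∞) (hE.differentiable z (σ y) (Set.mem_univ _))
      (hE.differentiable w (σ y) (Set.mem_univ _)) (hsm y hy) (by simp; norm_cast)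
    refine this.symm.trans ?_
    rw [mpullback_apply, hE.bracket z w (σ y) (Set.mem_univ _), map_neg]
    rfl
  · rw [happ y hy, happ y hy, hmet _ _ (hl.localInverse_right_inv hy),
      hE.metric _ _ _ (Set.mem_univ _)]
  · rw [happ y hy, happ y hy, hcom _ _ (hl.localInverse_right_inv hy),
      hE.complex _ _ (Set.mem_univ _)]

lemma AlmostHermitian.IsLeftInvariant.scale (hh : hG.IsLeftInvariant) (c : ℝ) (hc : 0 < c) :
    (hG.scale c hc).IsLeftInvariant where
  metric a x v w := congrArg (c * ·) (hh.metric a x v w)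
  complex a x v := hh.complex a x v

/-- The classification of balanced BTP Lie-Hermitian threefolds of middle type. -/
theorem IsLieHermitianCover.exists_isMember (hπ : IsLieHermitianCover hM hG π)
    (hI : hM.IsIntegrable) (hB : hM.IsBalanced) (hP : hM.IsBTP) (hm : hM.IsMiddleType) :
    ∃ (c : ℝ) (hc : 0 < c), (hG.scale c hc).IsMember := by
  obtain ⟨Φ, hΦm, hΦJ⟩ := exists_unitary_lieAlgebra hG
  have hE := isConstFrame_invFrame hπ.isLeftInvariant Φ hΦm hΦJ
  obtain ⟨c, A, hc, hA, hfam⟩ := (hE.pullFrame hπ).exists_isFamilyMember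
    ⟨_, (hπ.isLocalDiffeomorph 1).localInverse_mem_source⟩ (lieBilin_swap Φ)
    (isConsistent_lieBilin Φ) hI hB hP hm
  let Ψ : C3 ≃ₗ[ℝ] GroupLieAlgebra (𝓡 6) G := (A.restrictScalars ℝ).trans Φ
  refine ⟨c, hc, isMember_of_isConstFrame (Φ := Ψ) (isConstFrame_invFrame
    (hπ.isLeftInvariant.scale c hc) Ψ (fun z w => ?_) (fun z => ?_)) ?_⟩
  · exact (congrArg (c * ·) (hΦm (A z) (A w))).trans (hA z w)
  · exact (hΦJ (A z)).trans (congrArg Φ (A.map_smul _ _).symm)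
  · have : (fun z w => lieBilin Ψ z w)
        = StructureEquations.conjBy A fun z w => lieBilin Φ z w := by
      funext z w
      exact (map_neg A.symm _).symm
    rw [this]
    exact hfam

end Cover

/-! ### The connection with given coefficients in a global frame -/

section FrameConnection

variable {M : Type u} [TopologicalSpace M] [ChartedSpace E6 M]
  {F : Type*} [NormedAddCommGroup F] [NormedSpace ℝ F]

/-- A real-bilinear map on `ℂ³`, as a continuous bilinear map. -/
def toContBilin (B : C3 →ₗ[ℝ] C3 →ₗ[ℝ] F) : C3 →L[ℝ] C3 →L[ℝ] F :=
  LinearMap.toContinuousLinearMap (LinearMap.toContinuousLinearMap.toLinearMap ∘ₗ B)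

lemma mdifferentiableAt_bilin (B : C3 →ₗ[ℝ] C3 →ₗ[ℝ] F) {f g : M → C3} {x : M}
    (hf : MDifferentiableAt (𝓡 6) 𝓘(ℝ, C3) f x) (hg : MDifferentiableAt (𝓡 6) 𝓘(ℝ, C3) g x) :
    MDifferentiableAt (𝓡 6) 𝓘(ℝ, F) (fun y => B (f y) (g y)) x := by
  have h1 : MDifferentiableAt (𝓡 6) 𝓘(ℝ, C3 →L[ℝ] F) (fun y => toContBilin B (f y)) x :=
    (toContBilin B).differentiable.comp_mdifferentiableAt hf
  exact h1.clm_apply hg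

/-- The product rule. -/
lemma mvfderiv_bilin (B : C3 →ₗ[ℝ] C3 →ₗ[ℝ] F) {f g : M → C3} {x : M}
    (hf : MDifferentiableAt (𝓡 6) 𝓘(ℝ, C3) f x) (hg : MDifferentiableAt (𝓡 6) 𝓘(ℝ, C3) g x)
    (v : TangentSpace (𝓡 6) x) :
    mvfderiv (𝓡 6) (fun y => B (f y) (g y)) x v
      = B (mvfderiv (𝓡 6) f x v) (g x) + B (f x) (mvfderiv (𝓡 6) g x v) := by
  rw [(mdifferentiableAt_bilin B hf hg).mvfderiv, hf.mvfderiv, hg.mvfderiv]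
  have := (toContBilin B).fderivWithin_of_bilinear hf.differentiableWithinAt_writtenInExtChartAt
    hg.differentiableWithinAt_writtenInExtChartAt
    ((𝓡 6).uniqueDiffOn _ (Set.mem_range_self _))
  have e1 : writtenInExtChartAt (𝓡 6) 𝓘(ℝ, C3) x f (extChartAt (𝓡 6) x x) = f x := by
    simp [writtenInExtChartAt]; rfl
  have e2 : writtenInExtChartAt (𝓡 6) 𝓘(ℝ, C3) x g (extChartAt (𝓡 6) x x) = g x := by
    simp [writtenInExtChartAt]; rfl
  rw [e1, e2] at this
  exact (congrArg (fun L => L v) this).trans (add_comm _ _)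

lemma mvfderiv_linear (L : C3 →ₗ[ℝ] F) {f : M → C3} {x : M}
    (hf : MDifferentiableAt (𝓡 6) 𝓘(ℝ, C3) f x) (v : TangentSpace (𝓡 6) x) :
    mvfderiv (𝓡 6) (fun y => L (f y)) x v = L (mvfderiv (𝓡 6) f x v) := by
  have hL : MDifferentiableAt 𝓘(ℝ, C3) 𝓘(ℝ, F) L (f x) :=
    (LinearMap.toContinuousLinearMap L).differentiable.differentiableAt.mdifferentiableAt
  have h1 : mfderiv (𝓡 6) 𝓘(ℝ, F) (L ∘ f) x v
    = mfderiv 𝓘(ℝ, C3) 𝓘(ℝ, F) L (f x) (mfderiv (𝓡 6) 𝓘(ℝ, C3) f x v) := by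
    rw [mfderiv_comp x hL hf]; rfl
  have h2 : mfderiv 𝓘(ℝ, C3) 𝓘(ℝ, F) L (f x) = LinearMap.toContinuousLinearMap L := by
    rw [mfderiv_eq_fderiv]
    exact (LinearMap.toContinuousLinearMap L).fderiv
  rw [h2] at h1
  exact h1

variable [IsManifold (𝓡 6) ∞ M] {h : AlmostHermitian M} {R : RealBilin}
  {E : (y : M) → C3 →ₗ[ℝ] TangentSpace (𝓡 6) y}

variable (h E) in
/-- The coordinates of a tangent vector in a unitary frame. The factors `1/2` compensate for the
squared length `2` of the vectors `E y eₖ` and `E y (i eₖ)`. -/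
def frameCoords (y : M) : TangentSpace (𝓡 6) y →L[ℝ] C3 :=
  ∑ k, ((h.metric.inner y (E y (Pi.single k 1))).smulRight (Pi.single k (2⁻¹ : ℂ) : C3)
    + (h.metric.inner y (E y (Pi.single k Complex.I))).smulRight
      (Pi.single k (2⁻¹ * Complex.I) : C3))

lemma frameCoords_apply (y : M) (v : TangentSpace (𝓡 6) y) : frameCoords h E y v
    = ∑ k, (h.metric.inner y (E y (Pi.single k 1)) v • (Pi.single k (2⁻¹ : ℂ) : C3)
      + h.metric.inner y (E y (Pi.single k Complex.I)) v
        • (Pi.single k (2⁻¹ * Complex.I) : C3)) := by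
  simp [frameCoords]

namespace IsConstFrame

lemma frameCoords_frame (hE : IsConstFrame h Set.univ R E) (y : M) (z : C3) :
    frameCoords h E y (E y z) = z := by
  rw [frameCoords_apply]
  simp only [hE.metric _ _ y (Set.mem_univ y), realDot_comm _ z, realDot_single]
  conv_rhs => rw [eq_sum_single z]
  rw [Fin.sum_univ_three]
  funext k
  fin_cases k <;> apply Complex.ext <;> simp <;> ring

lemma frame_frameCoords (hE : IsConstFrame h Set.univ R E) (y : M) (v : TangentSpace (𝓡 6) y) :
    E y (frameCoords h E y v) = v := by
  obtain ⟨z, rfl⟩ := hE.surjective y (Set.mem_univ y) v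
  rw [hE.frameCoords_frame]

lemma mdifferentiableAt_frameCoords (hE : IsConstFrame h Set.univ R E)
    {Y : (y : M) → TangentSpace (𝓡 6) y} {x : M} (hY : DiffFieldAt Y x) :
    MDifferentiableAt (𝓡 6) 𝓘(ℝ, C3) (fun y => frameCoords h E y (Y y)) x := by
  have hd : ∀ z, MDifferentiableAt (𝓡 6) 𝓘(ℝ, ℝ) (fun y => h.metric.inner y (E y z) (Y y)) x :=
    fun z => h.mdifferentiableAt_metric (hE.differentiable z x (Set.mem_univ x)) hY
  have hs : ∀ z c, MDifferentiableAt (𝓡 6) 𝓘(ℝ, C3)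
      (fun y => h.metric.inner y (E y z) (Y y) • (c : C3)) x := fun z c =>
    (hd z).smul mdifferentiableAt_const
  simp only [frameCoords_apply, Fin.sum_univ_three]
  exact (((hs _ _).add (hs _ _)).add ((hs _ _).add (hs _ _))).add ((hs _ _).add (hs _ _))

/-- The connection with constant coefficients `Γ` in the frame `E`. -/
def frameConnection (hE : IsConstFrame h Set.univ R E) (Γ : RealBilin) :
    CovariantDerivative (𝓡 6) E6 (TangentSpace (𝓡 6) : M → Type) where
  toFun Y x := (LinearMap.toContinuousLinearMap (E x)) ∘L
    (mvfderiv (𝓡 6) (fun y => frameCoords h E y (Y y)) x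
      + ((toContBilin Γ).flip (frameCoords h E x (Y x))) ∘L frameCoords h E x)
  isCovariantDerivativeOnUniv :=
    { add := by
        intro Y Z x hY hZ _
        have hf := hE.mdifferentiableAt_frameCoords hY
        have hg := hE.mdifferentiableAt_frameCoords hZ
        have : (fun y => frameCoords h E y ((Y + Z) y))
            = (fun y => frameCoords h E y (Y y)) + fun y => frameCoords h E y (Z y) :=
          funext fun y => map_add _ _ _
        ext1 v
        rw [this, mvfderiv_add hf hg]
        simp only [Pi.add_apply, map_add, ContinuousLinearMap.comp_apply, add_apply]
        abel
      leibniz := by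
        intro Y a x hY ha _
        have hf := hE.mdifferentiableAt_frameCoords hY
        have : (fun y => frameCoords h E y ((a • Y) y))
            = a • (fun y => frameCoords h E y (Y y)) :=
          funext fun y => (frameCoords h E y).map_smul (a y) (Y y)
        ext1 v
        have he : E x (frameCoords h E x (Y x)) = Y x := hE.frame_frameCoords x (Y x)
        rw [this, mvfderiv_smul ha hf]
        simp [he]
        module }

lemma frameConnection_apply (hE : IsConstFrame h Set.univ R E) (Γ : RealBilin)
    (Y : (y : M) → TangentSpace (𝓡 6) y) (x : M) (v : TangentSpace (𝓡 6) x) :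
    hE.frameConnection Γ Y x v = E x (mvfderiv (𝓡 6) (fun y => frameCoords h E y (Y y)) x v
      + Γ (frameCoords h E x v) (frameCoords h E x (Y x))) := rfl

lemma frameConnection_frame (hE : IsConstFrame h Set.univ R E) (Γ : RealBilin) (x : M) (z w : C3) :
    hE.frameConnection Γ (fun y => E y w) x (E x z) = E x (Γ z w) := by
  rw [frameConnection_apply]
  simp only [hE.frameCoords_frame]
  rw [mvfderiv_const]
  simp

lemma isHermitianConnection_frameConnection (hE : IsConstFrame h Set.univ R E) {Γ : RealBilin}
    (hΓ : IsHermitianSymbol Γ) : h.IsHermitianConnection (hE.frameConnection Γ) where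
  metric x Y Z hY hZ v := by
    have hYZ : (fun y => h.metric.inner y (Y y) (Z y)) = fun y =>
        realDot (frameCoords h E y (Y y)) (frameCoords h E y (Z y)) := funext fun y => by
      rw [← hE.metric _ _ y (Set.mem_univ y), hE.frame_frameCoords, hE.frame_frameCoords]
    rw [hYZ, mvfderiv_bilin realDot (hE.mdifferentiableAt_frameCoords hY)
      (hE.mdifferentiableAt_frameCoords hZ)]
    conv_rhs => rw [← hE.frame_frameCoords x (Y x), ← hE.frame_frameCoords x (Z x)]
    rw [frameConnection_apply, frameConnection_apply, hE.metric _ _ x (Set.mem_univ x),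
      hE.metric _ _ x (Set.mem_univ x)]
    have := hΓ.metric (frameCoords h E x v) (frameCoords h E x (Y x)) (frameCoords h E x (Z x))
    simp only [map_add, LinearMap.add_apply]
    linarith
  complex x Y hY v := by
    have hJ : ∀ y, frameCoords h E y (h.J y (Y y)) = Complex.I • frameCoords h E y (Y y) := by
      intro y
      apply hE.injective (Set.mem_univ y)
      rw [hE.frame_frameCoords, ← hE.complex _ y (Set.mem_univ y), hE.frame_frameCoords]
    have hL := mvfderiv_linear ((LinearMap.lsmul ℂ C3 Complex.I).restrictScalars ℝ)
      (hE.mdifferentiableAt_frameCoords hY) v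
    simp only [LinearMap.restrictScalars_apply, LinearMap.lsmul_apply] at hL
    rw [frameConnection_apply, frameConnection_apply, hE.complex _ x (Set.mem_univ x)]
    simp only [hJ]
    rw [hL, hΓ.complex, smul_add]

lemma isBismut_frameConnection (hE : IsConstFrame h Set.univ R E) {Γ : RealBilin}
    (hΓ : IsBismutSymbol R Γ) : h.IsBismut (hE.frameConnection Γ) where
  hermitian := hE.isHermitianConnection_frameConnection hΓ.hermitian
  torsion_skew x v w z := by
    obtain ⟨v, rfl⟩ := hE.surjective x (Set.mem_univ x) v
    obtain ⟨w, rfl⟩ := hE.surjective x (Set.mem_univ x) w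
    obtain ⟨z, rfl⟩ := hE.surjective x (Set.mem_univ x) z
    rw [hE.torsion_eq (Set.mem_univ x) (hE.frameConnection_frame Γ x),
      hE.torsion_eq (Set.mem_univ x) (hE.frameConnection_frame Γ x),
      hE.metric _ _ x (Set.mem_univ x), hE.metric _ _ x (Set.mem_univ x), hΓ.skew]

/-- A frame with constant structure functions, together with a Bismut symbol that annihilates its
torsion, gives a BTP metric. -/
lemma isBTP (hE : IsConstFrame h Set.univ R E) {Γ : RealBilin} (hΓ : IsBismutSymbol R Γ)
    (hpar : ∀ v z w, Γ v (symbolTorsion R Γ z w)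
      = symbolTorsion R Γ (Γ v z) w + symbolTorsion R Γ z (Γ v w)) : h.IsBTP := by
  refine ⟨hE.frameConnection Γ, hE.isBismut_frameConnection hΓ, fun x Y Z hY hZ v => ?_⟩
  have hτ : ∀ y (v w : TangentSpace (𝓡 6) y), (hE.frameConnection Γ).torsion y v w
      = E y (symbolTorsion R Γ (frameCoords h E y v) (frameCoords h E y w)) := fun y v w => by
    rw [← hE.torsion_eq (Set.mem_univ y) (hE.frameConnection_frame Γ y), hE.frame_frameCoords,
      hE.frame_frameCoords]
  simp only [hτ, frameConnection_apply, hE.frameCoords_frame]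
  rw [mvfderiv_bilin (symbolTorsion R Γ) (hE.mdifferentiableAt_frameCoords hY)
      (hE.mdifferentiableAt_frameCoords hZ), hpar, ← map_sub, ← map_sub]
  simp only [map_add, LinearMap.add_apply]
  rw [← map_zero (E x)]
  congr 1
  abel

lemma isIntegrable (hE : IsConstFrame h Set.univ R E) {Γ : RealBilin} (hΓ : IsHermitianSymbol Γ)
    (hN : IsTypeIntegrable (symbolTorsion R Γ)) : h.IsIntegrable := fun x X Y hX hY => by
  rw [(hE.isHermitianConnection_frameConnection hΓ).nijenhuis_eq hX hY, neg_eq_zero,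
    ← hE.frame_frameCoords x (X x), ← hE.frame_frameCoords x (Y x)]
  simp only [hE.complex _ x (Set.mem_univ x),
    hE.torsion_eq (Set.mem_univ x) (hE.frameConnection_frame Γ x)]
  rw [← map_sub, ← map_sub, ← map_sub, hN, map_zero]

lemma isBalanced (hE : IsConstFrame h Set.univ R E) {Γ : RealBilin} (hΓ : IsHermitianSymbol Γ)
    (hw : ∀ X, torsionFormWedge (fun z w => realDot (Complex.I • z) w)
      (fun z w => symbolTorsion R Γ z w) X = 0) : h.IsBalanced := fun x X hX => by
  rw [(hE.isHermitianConnection_frameConnection hΓ).extDerivFields_kahlerFormSq hX]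
  have hX' : (fun i => X i x) = fun i => E x (frameCoords h E x (X i x)) :=
    funext fun i => (hE.frame_frameCoords x (X i x)).symm
  rw [hX', ← mul_zero (2 : ℝ), ← hw fun i => frameCoords h E x (X i x)]
  simp only [torsionFormWedge, torsionForm, AlmostHermitian.omega,
    hE.torsion_eq (Set.mem_univ x) (hE.frameConnection_frame Γ x),
    hE.complex _ x (Set.mem_univ x), hE.metric _ _ x (Set.mem_univ x)]

end IsConstFrame
end FrameConnection

/-! ### The Bismut connection of the normal form -/

section NormalFormSymbol

lemma reCovector_add (a z w : C3) : reCovector a (z + w) = reCovector a z + reCovector a w := by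
  simp only [reCovector, Pi.add_apply, mul_add, Complex.add_re, Finset.sum_add_distrib]

lemma reCovector_smul (a : C3) (r : ℝ) (z : C3) : reCovector a (r • z) = r * reCovector a z := by
  simp only [reCovector, Pi.smul_apply, Complex.real_smul, mul_left_comm _ (r : ℂ),
    Complex.re_ofReal_mul, ← Finset.mul_sum]
  ring

/-- The coefficients of the Bismut connection of the normal form: `∇e₁ = -i (α + φ₃ + φ̄₃) e₁`,
`∇e₂ = -i (β - φ₃ - φ̄₃) e₂` and `∇e₃ = 0`. -/
def normalFormSymbol (a b : C3) : RealBilin :=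
  LinearMap.mk₂ ℝ (fun z w => ![-Complex.I * (reCovector a z + 2 * (z 2).re : ℝ) * w 0,
      -Complex.I * (reCovector b z - 2 * (z 2).re : ℝ) * w 1, 0])
    (fun x y z => by
      ext i; fin_cases i <;> simp [reCovector_add] <;> ring)
    (fun r x y => by
      ext i; fin_cases i <;> simp [reCovector_smul] <;> ring)
    (fun x y z => by
      ext i; fin_cases i <;> simp <;> ring)
    (fun r x y => by
      ext i; fin_cases i <;> simp <;> ring)

variable {a b : C3} {R : RealBilin}

lemma normalFormSymbol_apply (a b z w : C3) : normalFormSymbol a b z w =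
    ![-Complex.I * (reCovector a z + 2 * (z 2).re : ℝ) * w 0,
      -Complex.I * (reCovector b z - 2 * (z 2).re : ℝ) * w 1, 0] := rfl

lemma symbolTorsion_normalForm (hR : ∀ z w, R z w = normalForm a b z w) (z w : C3) :
    symbolTorsion R (normalFormSymbol a b) z w =
      ![-Complex.I * ((2 * (z 2).re : ℝ) * w 0 - (2 * (w 2).re : ℝ) * z 0),
        Complex.I * ((2 * (z 2).re : ℝ) * w 1 - (2 * (w 2).re : ℝ) * z 1),
        Complex.I * (wedgeBar 1 1 z w - wedgeBar 0 0 z w)] := by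
  rw [symbolTorsion_apply, hR, normalFormSymbol_apply, normalFormSymbol_apply]
  funext k
  fin_cases k <;> simp [normalForm] <;> ring

lemma isBismutSymbol_normalForm (hR : ∀ z w, R z w = normalForm a b z w) :
    IsBismutSymbol R (normalFormSymbol a b) where
  hermitian :=
    { complex := fun z w => by
        funext k
        fin_cases k <;> simp [normalFormSymbol_apply] <;> ring
      metric := fun z w v => by
        simp [normalFormSymbol_apply, realDot_apply, Fin.sum_univ_three]
        ring }
  skew z w v := by
    simp [symbolTorsion_normalForm hR, realDot_apply, Fin.sum_univ_three, wedgeBar]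
    ring

lemma isTypeIntegrable_normalForm (hR : ∀ z w, R z w = normalForm a b z w) :
    IsTypeIntegrable (symbolTorsion R (normalFormSymbol a b)) := fun z w => by
  funext k
  fin_cases k <;> apply Complex.ext <;>
    simp [symbolTorsion_normalForm hR, wedgeBar] <;> ring

lemma normalFormSymbol_torsion (hR : ∀ z w, R z w = normalForm a b z w) (v z w : C3) :
    normalFormSymbol a b v (symbolTorsion R (normalFormSymbol a b) z w)
      = symbolTorsion R (normalFormSymbol a b) (normalFormSymbol a b v z) w
        + symbolTorsion R (normalFormSymbol a b) z (normalFormSymbol a b v w) := by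
  funext k
  fin_cases k <;> apply Complex.ext <;>
    simp [symbolTorsion_normalForm hR, normalFormSymbol_apply, wedgeBar] <;> ring

/-- The two-form `i φₖ∧φ̄ₖ`, up to sign. -/
def kForm (k : Fin 3) (x y : C3) : ℝ := 2 * ((x k).im * (y k).re - (x k).re * (y k).im)

/-- For the normal form, `dω` is the product of `i (φ₃ - φ̄₃)` and `i (φ₁∧φ̄₁ - φ₂∧φ̄₂)`. -/
lemma torsionForm_normalForm (hR : ∀ z w, R z w = normalForm a b z w) (x y z : C3) :
    torsionForm (fun z w => realDot (Complex.I • z) w)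
      (fun z w => symbolTorsion R (normalFormSymbol a b) z w) x y z =
      2 * ((kForm 0 x y - kForm 1 x y) * (z 2).im + (kForm 0 y z - kForm 1 y z) * (x 2).im
        + (kForm 0 z x - kForm 1 z x) * (y 2).im) := by
  simp [torsionForm, symbolTorsion_normalForm hR, realDot_apply, Fin.sum_univ_three, wedgeBar,
    kForm]
  ring

lemma torsionFormWedge_normalForm (hR : ∀ z w, R z w = normalForm a b z w) (X : Fin 5 → C3) :
    torsionFormWedge (fun z w => realDot (Complex.I • z) w)
      (fun z w => symbolTorsion R (normalFormSymbol a b) z w) X = 0 := by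
  have hom : ∀ x y, realDot (Complex.I • x) y = -(kForm 0 x y + kForm 1 x y + kForm 2 x y) :=
    fun x y => by
      simp [realDot_apply, Fin.sum_univ_three, kForm]
      ring
  simp only [torsionFormWedge, torsionForm_normalForm hR]
  simp only [hom, kForm]
  ring

end NormalFormSymbol

/-! ### The members of the families -/

section Members

variable {G : Type v} [TopologicalSpace G] [ChartedSpace E6 G] [Group G] [LieGroup (𝓡 6) ∞ G]
  {h : AlmostHermitian G}

/-- The metric is determined by the values of a unitary coframe. -/
lemma AlmostHermitian.IsLeftInvariantUnitaryCoframe.inner_eq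
    {φ : Fin 3 → (x : G) → TangentSpace (𝓡 6) x →L[ℝ] ℂ} (hφ : h.IsLeftInvariantUnitaryCoframe φ)
    (x : G) (v w : TangentSpace (𝓡 6) x) :
    h.metric.inner x v w = realDot (fun i => φ i x v) (fun i => φ i x w) := by
  have := congrArg Complex.re (hφ.unitary x v w)
  rw [Complex.ofReal_re] at this
  rw [this, realDot_apply, Fin.sum_univ_three, Fin.sum_univ_three]
  simp
  ring

lemma AlmostHermitian.IsLeftInvariantUnitaryCoframe.ext
    {φ : Fin 3 → (x : G) → TangentSpace (𝓡 6) x →L[ℝ] ℂ} (hφ : h.IsLeftInvariantUnitaryCoframe φ)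
    {x : G} {v w : TangentSpace (𝓡 6) x} (hvw : ∀ i, φ i x v = φ i x w) : v = w := by
  by_contra hne
  have := h.metric.pos x (v - w) (sub_ne_zero.2 hne)
  rw [hφ.inner_eq] at this
  have h0 : (fun i => φ i x (v - w)) = (0 : C3) := funext fun i => by
    rw [map_sub, hvw, sub_self]; rfl
  rw [h0] at this
  simp at this

lemma AlmostHermitian.IsLeftInvariantUnitaryCoframe.isLeftInvariant
    {φ : Fin 3 → (x : G) → TangentSpace (𝓡 6) x →L[ℝ] ℂ}
    (hφ : h.IsLeftInvariantUnitaryCoframe φ) : h.IsLeftInvariant where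
  metric a x v w := by
    rw [hφ.inner_eq, hφ.inner_eq]
    simp only [hφ.leftInvariant]
  complex a x v := hφ.ext fun i => by
    rw [hφ.type_one_zero, hφ.leftInvariant, hφ.leftInvariant, hφ.type_one_zero]

/-- A member of a family has a left-invariant unitary frame with the structure functions of the
family. -/
lemma AlmostHermitian.IsMember.exists_lieBilin (hm : h.IsMember) :
    ∃ Φ : C3 ≃ₗ[ℝ] GroupLieAlgebra (𝓡 6) G,
      IsConstFrame h Set.univ (lieBilin Φ) (invFrame Φ) ∧
      IsFamilyMember fun z w => lieBilin Φ z w := by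
  obtain ⟨R, φ, hR, hφ, hS⟩ := hm
  let L : TangentSpace (𝓡 6) (1 : G) →ₗ[ℝ] C3 :=
    LinearMap.pi fun i => (φ i 1).toLinearMap
  have hL : ∀ v i, L v i = φ i 1 v := fun _ _ => rfl
  have hinj : Function.Injective L := fun v w hvw => hφ.ext fun i => congrFun hvw i
  have : FiniteDimensional ℝ (TangentSpace (𝓡 6) (1 : G)) :=
    inferInstanceAs (FiniteDimensional ℝ E6)
  have hf : Module.finrank ℝ (TangentSpace (𝓡 6) (1 : G)) = 6 :=
    (finrank_euclideanSpace_fin : Module.finrank ℝ E6 = 6)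
  let e : TangentSpace (𝓡 6) (1 : G) ≃ₗ[ℝ] C3 :=
    LinearEquiv.ofInjectiveOfFinrankEq L hinj (by rw [hf]; simp [Module.finrank_pi_fintype])
  let Φ : C3 ≃ₗ[ℝ] GroupLieAlgebra (𝓡 6) G := e.symm
  have hφΦ : ∀ z i, φ i 1 (Φ z) = z i := fun z i => congrFun (e.apply_symm_apply z) i
  have hE : IsConstFrame h Set.univ (lieBilin Φ) (invFrame Φ) := by
    refine isConstFrame_invFrame hφ.isLeftInvariant Φ (fun z w => ?_) (fun z => ?_)
    · rw [hφ.inner_eq]; simp only [hφΦ]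
    · refine hφ.ext fun i => ?_
      rw [hφ.type_one_zero, hφΦ, hφΦ]; rfl
  refine ⟨Φ, hE, ?_⟩
  have hval : ∀ y z i, φ i y (invFrame Φ y z) = z i := fun y z i => by
    have key : ∀ b, y * 1 = b → φ i b
        (show TangentSpace (𝓡 6) b from mfderiv (𝓡 6) (𝓡 6) (y * ·) 1 (Φ z)) = z i := by
      rintro b rfl
      exact (hφ.leftInvariant i y 1 (Φ z)).trans (hφΦ z i)
    exact key y (mul_one y)
  have : (fun z w => lieBilin Φ z w) = R := by
    funext z w k
    have h1 := hS (Φ z) (Φ w) 1 k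
    have hz : ∀ y i, φ i y (mulInvariantVectorField (Φ z) y) = z i := fun y i => hval y z i
    have hw : ∀ y i, φ i y (mulInvariantVectorField (Φ w) y) = w i := fun y i => hval y w i
    have hbr : φ k 1 (mlieBracket (𝓡 6) (mulInvariantVectorField (Φ z))
        (mulInvariantVectorField (Φ w)) 1) = -lieBilin Φ z w k := by
      have := mlieBracket_invFrame Φ z w 1
      rw [← map_neg] at this
      exact (congrArg (φ k 1) this).trans (hval 1 _ k)
    rw [extDerivFields_two] at h1
    simp only [hz, hw] at h1
    rw [mvfderiv_const, mvfderiv_const, hbr] at h1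
    simpa using h1
  rwa [this]

/-- On every member of the families the complex structure is integrable and the metric is balanced
and BTP. -/
theorem AlmostHermitian.IsMember.isBTP (hm : h.IsMember) :
    h.IsIntegrable ∧ h.IsBalanced ∧ h.IsBTP := by
  obtain ⟨Φ, hE, hfam⟩ := hm.exists_lieBilin
  obtain ⟨A, a, b, hA, -, hab⟩ := hfam.exists_eq_conjBy_normalForm
  have hR : ∀ z w, (lieBilin Φ).conjBy A.symm z w = normalForm a b z w := fun z w => by
    have := congrFun (congrFun (congrArg (StructureEquations.conjBy A.symm) hab) z) w
    rw [StructureEquations.conjBy_symm] at this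
    exact this
  have hE' := hE.comp hA.symm (R' := (lieBilin Φ).conjBy A.symm)
    (fun z w => by simp [RealBilin.conjBy_apply])
  have hb := isBismutSymbol_normalForm hR
  exact ⟨hE'.isIntegrable hb.hermitian (isTypeIntegrable_normalForm hR),
    hE'.isBalanced hb.hermitian (torsionFormWedge_normalForm hR),
    hE'.isBTP hb (normalFormSymbol_torsion hR)⟩

end Members

end

theorem theorem1p11 :
    -- classification
    (∀ (M : Type u) [TopologicalSpace M] [T2Space M] [ChartedSpace E6 M]
      [IsManifold (𝓡 6) ∞ M]
      (G : Type v) [TopologicalSpace G] [T2Space G] [SimplyConnectedSpace G] [ChartedSpace E6 G]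
      [Group G] [LieGroup (𝓡 6) ∞ G]
      (hM : AlmostHermitian M) (hG : AlmostHermitian G) (π : G → M),
      IsLieHermitianCover hM hG π → hM.IsIntegrable → ¬ hM.IsKahler → hM.IsBalanced →
      hM.IsBTP → hM.IsMiddleType →
      ∃ (c : ℝ) (hc : 0 < c), (hG.scale c hc).IsMember) ∧
    -- converse
    (∀ (G : Type v) [TopologicalSpace G] [T2Space G] [ChartedSpace E6 G]
      [Group G] [LieGroup (𝓡 6) ∞ G] (hG : AlmostHermitian G),
      hG.IsMember → hG.IsIntegrable ∧ hG.IsBalanced ∧ hG.IsBTP) ∧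
    -- every system in the families does define a Lie algebra
    (∀ R : StructureEquations, IsFamilyMember R → R.IsConsistent) := by
  exact ⟨fun _ _ _ _ _ _ _ _ _ _ _ _ _ _ _ hπ hI _ hB hP hm => hπ.exists_isMember hI hB hP hm,
    fun _ _ _ _ _ _ _ hm => hm.isBTP, fun _ hR => hR.isConsistent⟩
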